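/- **Setting.** Consider a discounted Markov decision process with finite state, action and reward sets $\mathcal S$, $\mathcal A$, $\mathcal R\subset\mathbb R$, transition law $P(s'|s,a)$, reward law $P(r|s,a)$ ($s'$ and $r$ are independent given $(s,a)$), and discount factor $\gamma\in(0,1)$. For a policy $\pi$ let $P^\pi(s,s')=\sum_a\pi(a|s)P(s'|s,a)$, $\xi^\pi(s)=\sum_{a,r}\pi(a|s)P(r|s,a)\,r$, and $V^\pi(s)=\mathbb E_s^\pi\sum_{t\ge0}\gamma^t r(s_t,a_t)$. A policy $b$ (the behavior policy) generates the data; $\mu^b$ is its stationary distribution. $\Pi$ is a set of admissible policies that contains an optimal policy $\pi^*$; $V^*=V^{\pi^*}$, and $\mu^*$ is a stationary distribution of $P^{\pi^*}$. Values are parameterized by $V_\theta(s)=\varphi(s)^T\theta$ with features $\varphi:\mathcal S\to\mathbb R^d$, and $\mathcal C\subset\mathbb R^d$ is a compact convex set with Euclidean projection $\mathbf P_{\mathcal C}$. Put $\phi^\pi(s)=\sum_{s'}P^\pi(s,s')\varphi(s')$, $\delta(\theta,s)=\xi^\pi(s)+(\gamma\phi^\pi(s)-\varphi(s))^T\theta$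 and $l(\theta)=\sum_s\mu^b(s)\,\tfrac12\delta(\theta,s)^2$. **Policy evaluation (Algorithm 1).** From samples $z_t=(s_t,a_t,r_t,s_t')$, $0\le t\le T$, with $s_{t+1}=s_t'$, start at $\theta_1=\theta_0\in\mathcal C$, iterate $\theta_{t+1}=\mathbf P_{\mathcal C}(\theta_t-\eta_t\hat g_t(\theta_t,z_t))$ for $t\ge1$, and return $\bar\theta_T=\frac1{T+1}\sum_{t=0}^T\theta_t$. Here $\hat g_t$ is obtained from one of the directions $g$, with $z=(s,a,r,s')$, - direct-SGD: $\delta(\theta,s)(\gamma\phi^\pi(s)-\varphi(s))$, - TD-SGD: $\frac{\pi(a|s)}{b(a|s)}\delta(\theta,s)(\gamma\varphi(s')-\varphi(s))$, - TD(0): $-\frac1{\mu^b(s)}\frac{\pi(a|s)}{b(a|s)}\bigl(r+\gamma\varphi(s')^T\theta-\varphi(s)^T\theta\bigr)\varphi(s)$, by replacing the laws $p(s'|s)=\sum_a\pi(a|s)P(s'|s,a)$ and $p(r|s)=\sum_a\pi(a|s)P(r|s,a)$ and the distribution $\mu^b$ by the sample averages $\hat p_t(\cdot|s)=\sum_a\pi(a|s)\frac{\#\{l\le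 t:\ s_l=s,\ a_l=a,\ \text{outcome}_l=\cdot\}}{\#\{l\le t:\ s_l=s,\ a_l=a\}}$ and $\hat\mu^b_t(s)=\frac1t\sum_{l=1}^t1_{s_l=s}$. Direct-SGD and TD-SGD are the SGD-based updates. Let $\bar g(\theta)=\sum_{s,a,r,s'}\mu^b(s)b(a|s)P(s'|s,a)P(r|s,a)\,g(\theta,(s,a,r,s'))$. **Policy iteration.** Starting from $\pi_0\in\Pi$, for $0\le k<K$ let $\widehat V^{\pi_k}=V_{\bar\theta_T}$ be the output of Algorithm 1 for $\pi_k$, run on the $k$-th batch of $T+1$ samples, and let $\pi_{k+1}\in\Pi$ maximize $\xi^\pi(s)+\gamma\sum_{s'}P^\pi(s,s')\widehat V^{\pi_k}(s')$ over $\pi\in\Pi$, for every $s$. Given the past, each batch is a trajectory under $b$ (from any initial state), and $\pi_k$ depends only on the data before batch $k$. The total number of samples is $N=K(T+1)$, and $\epsilon$-accuracy means $\mathbb E\sum_s\mu^*(s)(V^*(s)-V^{\pi_K}(s))\le\epsilon$. **Assumptions.** (1) $|\mathcal R|\le n$, $|r|<\tilde M$ almost surely, $\|\varphi(s)\|\le\tilde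 C_0$ for all $s$, $\mathcal C\subset\{\|\theta\|\le\tilde C_1\}$; for every $\pi\in\Pi$ there is $\theta^*\in\mathcal C$ such that $V_{\theta^*}$ solves the Bellman equation of $\pi$. (2) The chain $P^b$ is irreducible and $\|(P^b)^\tau(s,\cdot)-\mu^b\|_{TV}\le\frac14$ for all $s$. (3) In each evaluation and for $1\le t\le T$ there is a random variable $\tilde e_t$ with $\mathbb E\tilde e_t^2\le B/t$ that almost surely bounds $\|\hat p_t(\cdot|s_t)-p(\cdot|s_t)\|_\infty$ (for next states and for rewards) and $|1/\hat\mu^b_t(s_t)-1/\mu^b(s_t)|$. (4) For all $\pi\in\Pi$: $\pi(a|s)\le C\mu^b(s)b(a|s)$, and $\mu(s)\le C\mu^b(s)$ for every stationary distribution $\mu$ of $P^\pi$. **Claim.** There is an absolute $p\in\mathbb N$ such that for all $n,\tilde M,\tilde C_0,\tilde C_1,C,\tau,B$, all $\eta_0>0$ and all $c>0$ there is a constant $K_0$ such that, with $\Lambda=\bigl(1+\log(1+\tfrac1\epsilon)\bigr)\bigl(1+\log\tfrac1{1-\gamma}\bigr)$, the following holds for all $\gamma\in(0,1)$ and $\epsilon>0$.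 1. There are $T,K$ with $$N=K(T+1)\le K_0\,\frac{\Lambda^p}{(1-\gamma)^9\epsilon^4}$$ such that policy iteration with either of the SGD-based updates and step sizes $\eta_t=\eta_0t^{-1/2}$ achieves $\epsilon$-accuracy for every problem that satisfies (1)–(4) with these constants. 2. There are $T,K$ with $$N=K(T+1)\le K_0\,\frac{\Lambda^p}{(1-\gamma)^5\epsilon^2}$$ such that, with any step sizes satisfying $\eta_1\in[1/c,2/c]$ and $\eta_{t+1}=e^{-c\eta_t/2}\eta_t$ for $t\ge1$, policy iteration achieves $\epsilon$-accuracy for every problem that satisfies (1)–(4) with these constants, provided that either an SGD-based update is used and $l$ is $c$-strongly convex for every $\pi\in\Pi$, or TD(0) is used and for every $\pi\in\Pi$ the field $\bar g$ is a $c$-contraction towards a $\theta^*\in\mathcal C$ for which $V_{\theta^*}$ solves the Bellman equation of $\pi$, i.e. $\langle\theta-\theta^*,\bar g(\theta)\rangle\ge c\|\theta-\theta^*\|^2$ for all $\theta$ and $\bar g(\theta^*)=0$. In short, the sample complexity is $\tilde O(\epsilon^{-4}(1-\gamma)^{-9})$ in general and $\tilde O(\epsilon^{-2}(1-\gamma)^{-5})$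 under strong convexity or a TD(0) contraction. -/

import Mathlib

open MeasureTheory ProbabilityTheory

universe u v w

noncomputable section

namespace OfflineRL

/-- A Markov decision process with state space `S`, action space `A` and set of reward values `R`.
Given `(s, a)`, the reward has law `rew s a` and, independently, the next state has law `P s a`. -/
structure MDP (S A : Type*) [Fintype S] (R : Finset ℝ) where
  P : S → A → S → ℝ
  P_nonneg : ∀ s a s', 0 ≤ P s a s'
  P_sum : ∀ s a, ∑ s', P s a s' = 1
  rew : S → A → R → ℝ
  rew_nonneg : ∀ s a r, 0 ≤ rew s a r
  rew_sum : ∀ s a, ∑ r, rew s a r = 1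

/-- One observation `z = (s, a, r, s')`. -/
structure Sample (S A : Type*) (R : Finset ℝ) where
  s : S
  a : A
  r : R
  s' : S

/-- A (stationary, randomized) policy, `π s a = π(a|s)`. -/
structure IsPolicy {S A : Type*} [Fintype A] (π : S → A → ℝ) : Prop where
  nonneg : ∀ s a, 0 ≤ π s a
  sum_one : ∀ s, ∑ a, π s a = 1

/-- `μ` is a stationary distribution of the transition matrix `Q`. -/
structure IsStationary {S : Type*} [Fintype S] (Q : Matrix S S ℝ) (μ : S → ℝ) : Prop where
  nonneg : ∀ s, 0 ≤ μ s
  sum_one : ∑ s, μ s = 1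
  invariant : ∀ s', ∑ s, μ s * Q s s' = μ s'

section Model

variable {S A : Type*} [Fintype S] [DecidableEq S] [Fintype A] [DecidableEq A] {R : Finset ℝ}
  {d : ℕ}

/-- The transition matrix `P^π`. -/
def MDP.trans (M : MDP S A R) (π : S → A → ℝ) : Matrix S S ℝ :=
  Matrix.of fun s s' => ∑ a, π s a * M.P s a s'

/-- The conditional mean reward `ξ^π(s) = E^π_s[r]`. -/
def MDP.meanReward (M : MDP S A R) (π : S → A → ℝ) (s : S) : ℝ :=
  ∑ a, ∑ r : R, π s a * M.rew s a r * (r : ℝ)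

/-- The discounted value `V^π(s) = ∑ₜ γᵗ E^π_s[r(sₜ, aₜ)]`. -/
def MDP.value (M : MDP S A R) (γ : ℝ) (π : S → A → ℝ) (s : S) : ℝ :=
  ∑' t : ℕ, γ ^ t * ∑ x, (M.trans π ^ t) s x * M.meanReward π x

/-- The Bellman operator of the policy `π`. -/
def MDP.bellman (M : MDP S A R) (γ : ℝ) (π : S → A → ℝ) (v : S → ℝ) (s : S) : ℝ :=
  M.meanReward π s + γ * ∑ s', M.trans π s s' * v s'

/-- `π` is optimal among all policies. -/
def MDP.IsOptimal (M : MDP S A R) (γ : ℝ) (π : S → A → ℝ) : Prop :=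
  IsPolicy π ∧ ∀ σ, IsPolicy σ → ∀ s, M.value γ σ s ≤ M.value γ π s

/-- `σ = argmax_{π ∈ Adm} (E^π r + γ ∑ P^π v)`, simultaneously at every state. -/
def MDP.IsGreedy (M : MDP S A R) (γ : ℝ) (Adm : Set (S → A → ℝ)) (v : S → ℝ)
    (σ : S → A → ℝ) : Prop :=
  σ ∈ Adm ∧ ∀ π ∈ Adm, ∀ s, M.bellman γ π v s ≤ M.bellman γ σ v s

/-- The chain generated by `b` is irreducible, with `τ` as a mixing time towards `μ`
(total variation distance at most `1/4` after `τ` steps, from every initial state). -/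
def MDP.IsMixing (M : MDP S A R) (b : S → A → ℝ) (μ : S → ℝ) (τ : ℕ) : Prop :=
  (∀ s s', ∃ n : ℕ, 0 < (M.trans b ^ n) s s') ∧
  ∀ s, (1 / 2) * ∑ s', |(M.trans b ^ τ) s s' - μ s'| ≤ 1 / 4

/-- Linear parameterization `V_θ(s) = φ(s)ᵀ θ`. -/
def linValue (φ : S → EuclideanSpace ℝ (Fin d)) (θ : EuclideanSpace ℝ (Fin d)) (s : S) : ℝ :=
  inner ℝ (φ s) θ

/-- `V_θ` solves the Bellman equation of `π`. -/
def MDP.SolvesBellman (M : MDP S A R) (γ : ℝ) (φ : S → EuclideanSpace ℝ (Fin d))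
    (π : S → A → ℝ) (θ : EuclideanSpace ℝ (Fin d)) : Prop :=
  ∀ s, linValue φ θ s = M.bellman γ π (linValue φ θ) s

/-- The mean feature after one transition, `φ^π(s) = E^π_s[φ(s')]`. -/
def MDP.nextFeature (M : MDP S A R) (φ : S → EuclideanSpace ℝ (Fin d)) (π : S → A → ℝ) (s : S) :
    EuclideanSpace ℝ (Fin d) :=
  ∑ s', M.trans π s s' • φ s'

/-- The Bellman residual `δ(θ, s) = ξ(s) + (γ ψ(s) - φ(s))ᵀ θ`, for a mean reward `ξ` and a mean
feature after transition `ψ`, which may be the exact or the estimated ones. -/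
def residual (γ : ℝ) (φ : S → EuclideanSpace ℝ (Fin d)) (ξ : S → ℝ)
    (ψ : S → EuclideanSpace ℝ (Fin d)) (θ : EuclideanSpace ℝ (Fin d)) (s : S) : ℝ :=
  ξ s + inner ℝ (γ • ψ s - φ s) θ

/-- The loss `l(θ) = E_μ[L(θ, s)]`, `L(θ, s) = δ(θ, s)² / 2`. -/
def MDP.loss (M : MDP S A R) (γ : ℝ) (φ : S → EuclideanSpace ℝ (Fin d)) (μ : S → ℝ)
    (π : S → A → ℝ) (θ : EuclideanSpace ℝ (Fin d)) : ℝ :=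
  ∑ s, μ s * ((1 / 2) * residual γ φ (M.meanReward π) (M.nextFeature φ π) θ s ^ 2)

/-- The three update rules. -/
inductive Method
  | directSGD
  | tdSGD
  | td0

/-- The SGD-based updates. -/
def Method.IsSGD : Method → Prop
  | .directSGD => True
  | .tdSGD => True
  | .td0 => False

/-- The update direction `g(θ, z)`, given a mean reward `ξ`, a mean feature after transition `ψ`
and a stationary distribution `μ`, which may be the exact or the estimated ones. -/
def direction (m : Method) (γ : ℝ) (φ : S → EuclideanSpace ℝ (Fin d)) (b π : S → A → ℝ)
    (ξ : S → ℝ) (ψ : S → EuclideanSpace ℝ (Fin d)) (μ : S → ℝ)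
    (θ : EuclideanSpace ℝ (Fin d)) (z : Sample S A R) : EuclideanSpace ℝ (Fin d) :=
  match m with
  | .directSGD => residual γ φ ξ ψ θ z.s • (γ • ψ z.s - φ z.s)
  | .tdSGD => (π z.s z.a / b z.s z.a * residual γ φ ξ ψ θ z.s) • (γ • φ z.s' - φ z.s)
  | .td0 =>
      -((1 / μ z.s * (π z.s z.a / b z.s z.a) *
          ((z.r : ℝ) + γ * linValue φ θ z.s' - linValue φ θ z.s)) • φ z.s)

/-- The stationary average `ḡ(θ)` of the exact direction. -/
def MDP.meanDirection (M : MDP S A R) (m : Method) (γ : ℝ) (φ : S → EuclideanSpace ℝ (Fin d))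
    (b : S → A → ℝ) (μ : S → ℝ) (π : S → A → ℝ) (θ : EuclideanSpace ℝ (Fin d)) :
    EuclideanSpace ℝ (Fin d) :=
  ∑ s, ∑ a, ∑ r : R, ∑ s', (μ s * b s a * M.P s a s' * M.rew s a r) •
    direction m γ φ b π (M.meanReward π) (M.nextFeature φ π) μ θ ⟨s, a, r, s'⟩

/-- The vector field `h` generates a `c`-contraction towards `θs`. -/
def IsContraction (c : ℝ) (h : EuclideanSpace ℝ (Fin d) → EuclideanSpace ℝ (Fin d))
    (θs : EuclideanSpace ℝ (Fin d)) : Prop :=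
  (∀ θ, c * ‖θ - θs‖ ^ 2 ≤ inner ℝ (θ - θs) (h θ)) ∧ h θs = 0

/-- Euclidean projection onto `C`. -/
def proj (C : Set (EuclideanSpace ℝ (Fin d))) (x : EuclideanSpace ℝ (Fin d)) :
    EuclideanSpace ℝ (Fin d) :=
  open Classical in
  if h : ∃ y ∈ C, ∀ w ∈ C, ‖x - y‖ ≤ ‖x - w‖ then h.choose else x

/-! Sample-average estimators computed from a data sequence `z₀, z₁, …`. -/

/-- Number of `l ≤ t` with `s_l = s`, `a_l = a`. -/
def visits (z : ℕ → Sample S A R) (t : ℕ) (s : S) (a : A) : ℝ :=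
  ∑ l ∈ Finset.range (t + 1), if (z l).s = s ∧ (z l).a = a then 1 else 0

/-- The estimate `p̂ₜ(s'|s)` of the transition probability under `π`. -/
def estTrans (z : ℕ → Sample S A R) (π : S → A → ℝ) (t : ℕ) (s s' : S) : ℝ :=
  ∑ a, π s a * ((∑ l ∈ Finset.range (t + 1),
    if (z l).s = s ∧ (z l).a = a ∧ (z l).s' = s' then 1 else 0) / visits z t s a)

/-- The estimate `p̂ₜ(r|s)` of the reward probability under `π`. -/
def estRew (z : ℕ → Sample S A R) (π : S → A → ℝ) (t : ℕ) (s : S) (r : R) : ℝ :=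
  ∑ a, π s a * ((∑ l ∈ Finset.range (t + 1),
    if (z l).s = s ∧ (z l).a = a ∧ (z l).r = r then 1 else 0) / visits z t s a)

/-- The estimate `μ̂ₜ(s)` of the stationary distribution of the data. -/
def estStat (z : ℕ → Sample S A R) (t : ℕ) (s : S) : ℝ :=
  (1 / (t : ℝ)) * ∑ l ∈ Finset.Icc 1 t, if (z l).s = s then 1 else 0

/-- The approximate direction `ĝₜ(θ, zₜ)`. -/
def estDirection (m : Method) (γ : ℝ) (φ : S → EuclideanSpace ℝ (Fin d)) (b π : S → A → ℝ)
    (z : ℕ → Sample S A R) (t : ℕ) (θ : EuclideanSpace ℝ (Fin d)) : EuclideanSpace ℝ (Fin d) :=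
  direction m γ φ b π (fun s => ∑ r : R, (r : ℝ) * estRew z π t s r)
    (fun s => ∑ s', estTrans z π t s s' • φ s') (estStat z t) θ (z t)

/-- The iterates of the policy evaluation algorithm. The loop runs over `t = 1, 2, …`, with
`θ₁ = θ₀` the initial parameter. -/
def evalIterate (m : Method) (γ : ℝ) (φ : S → EuclideanSpace ℝ (Fin d)) (b π : S → A → ℝ)
    (C : Set (EuclideanSpace ℝ (Fin d))) (η : ℕ → ℝ) (θ₀ : EuclideanSpace ℝ (Fin d))
    (z : ℕ → Sample S A R) : ℕ → EuclideanSpace ℝ (Fin d)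
  | 0 => θ₀
  | 1 => θ₀
  | t + 2 =>
      let θ := evalIterate m γ φ b π C η θ₀ z (t + 1)
      proj C (θ - η (t + 1) • estDirection m γ φ b π z (t + 1) θ)

/-- The output `θ̄_T` of the policy evaluation algorithm. -/
def evalOutput (m : Method) (γ : ℝ) (φ : S → EuclideanSpace ℝ (Fin d)) (b π : S → A → ℝ)
    (C : Set (EuclideanSpace ℝ (Fin d))) (η : ℕ → ℝ) (θ₀ : EuclideanSpace ℝ (Fin d))
    (z : ℕ → Sample S A R) (T : ℕ) : EuclideanSpace ℝ (Fin d) :=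
  (1 / ((T : ℝ) + 1)) • ∑ t ∈ Finset.range (T + 1), evalIterate m γ φ b π C η θ₀ z t

/-- The constants on which the hidden constants of the complexity bounds may depend. -/
structure Constants where
  /-- bound on the rewards -/
  rewardBound : ℝ
  /-- number of possible reward values -/
  rewardCard : ℕ
  /-- bound on the features -/
  featureBound : ℝ
  /-- radius of a ball containing the feasibility set -/
  radius : ℝ
  /-- bound on the distribution shift -/
  shift : ℝ
  /-- mixing time of the data generating chain -/
  mixingTime : ℕ
  /-- constant in the mean square accuracy of the estimators -/
  estError : ℝ
  radius_pos : 0 < radius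
  featureBound_pos : 0 < featureBound
  shift_pos : 0 < shift
  estError_pos : 0 < estError

/-- The standing assumptions: `b` is the behavior policy, with stationary distribution `μb`, `Adm`
is the set of admissible policies, `φ` is the feature function, `C` is the feasibility set. -/
structure Standing (κ : Constants) (M : MDP S A R) (γ : ℝ) (b : S → A → ℝ) (μb : S → ℝ)
    (Adm : Set (S → A → ℝ)) (φ : S → EuclideanSpace ℝ (Fin d))
    (C : Set (EuclideanSpace ℝ (Fin d))) : Prop where
  reward_card : R.card ≤ κ.rewardCard
  reward_bound : ∀ s a (r : R), 0 < M.rew s a r → |(r : ℝ)| < κ.rewardBound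
  feature_bound : ∀ s, ‖φ s‖ ≤ κ.featureBound
  compact : IsCompact C
  convex : Convex ℝ C
  bounded : ∀ θ ∈ C, ‖θ‖ ≤ κ.radius
  behavior : IsPolicy b
  stationary : IsStationary (M.trans b) μb
  mixing : M.IsMixing b μb κ.mixingTime
  admissible : ∀ π ∈ Adm, IsPolicy π
  realizable : ∀ π ∈ Adm, ∃ θs ∈ C, M.SolvesBellman γ φ π θs
  policy_shift : ∀ π ∈ Adm, ∀ s a, π s a ≤ κ.shift * μb s * b s a
  stationary_shift : ∀ π ∈ Adm, ∀ μ, IsStationary (M.trans π) μ → ∀ s, μ s ≤ κ.shift * μb s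

end Model

section Learning

variable {S A : Type*} [Fintype S] [DecidableEq S] [Fintype A] [DecidableEq A] {R : Finset ℝ}
  {d : ℕ} {Ω : Type*} {mΩ : MeasurableSpace Ω}

/-- The samples `z₀, …, z_{K(T+1)-1}` are generated under the behavior policy `b`, in `K`
consecutive batches of `T + 1` samples each. Within a batch they form one trajectory. The initial
state of a batch is arbitrary: it may continue the previous batch or be a fresh restart.
`ℱ n` is the information available before the action of sample `n` is taken. -/
structure IsOfflineData (M : MDP S A R) (b : S → A → ℝ) (T K : ℕ) (ρ : Measure Ω)
    (ℱ : Filtration ℕ mΩ) (z : ℕ → Ω → Sample S A R) : Prop where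
  state_adapted : ∀ n < K * (T + 1), ∀ x, MeasurableSet[ℱ n] {ω | (z n ω).s = x}
  sample_adapted : ∀ n < K * (T + 1), ∀ y, MeasurableSet[ℱ (n + 1)] {ω | z n ω = y}
  law : ∀ n < K * (T + 1), ∀ x a r y,
    ρ⟦{ω | z n ω = ⟨x, a, r, y⟩} | ℱ n⟧ =ᵐ[ρ]
      fun ω => if (z n ω).s = x then b x a * M.rew x a r * M.P x a y else 0
  continues : ∀ n, n + 1 < K * (T + 1) → ¬ (T + 1 ∣ n + 1) →
    ∀ᵐ ω ∂ρ, (z (n + 1) ω).s = (z n ω).s'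

/-- The `k`-th batch of `T + 1` samples. -/
def batch (z : ℕ → Ω → Sample S A R) (T k : ℕ) (ω : Ω) (t : ℕ) : Sample S A R :=
  z (k * (T + 1) + t) ω

/-- `π₀, …, π_K` are produced by policy iteration with approximate policy evaluation, where `π_k`
is evaluated by the update rule `m` on the `k`-th batch of data. -/
structure IsPolicyIteration (M : MDP S A R) (γ : ℝ) (b : S → A → ℝ) (Adm : Set (S → A → ℝ))
    (φ : S → EuclideanSpace ℝ (Fin d)) (C : Set (EuclideanSpace ℝ (Fin d)))
    (m : Method) (η : ℕ → ℝ) (θ₀ : ℕ → EuclideanSpace ℝ (Fin d)) (T K : ℕ) (ρ : Measure Ω)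
    (ℱ : Filtration ℕ mΩ) (z : ℕ → Ω → Sample S A R) (π : ℕ → Ω → S → A → ℝ) : Prop where
  initial_param : ∀ k, θ₀ k ∈ C
  adapted : ∀ k ≤ K, ∀ s a, Measurable[ℱ (k * (T + 1))] fun ω => π k ω s a
  initial : ∀ᵐ ω ∂ρ, π 0 ω ∈ Adm
  improve : ∀ k < K, ∀ᵐ ω ∂ρ, M.IsGreedy γ Adm
    (linValue φ (evalOutput m γ φ b (π k ω) C η (θ₀ k) (batch z T k ω) T)) (π (k + 1) ω)

/-- Accuracy of the estimators in every policy evaluation: the errors at time `t` are dominated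
by a random variable `e` with `E e² ≤ B / t`. -/
def AccurateEstimates (M : MDP S A R) (μb : S → ℝ) (T K : ℕ) (ρ : Measure Ω)
    (z : ℕ → Ω → Sample S A R) (π : ℕ → Ω → S → A → ℝ) (B : ℝ) : Prop :=
  ∀ k < K, ∀ t, 1 ≤ t → t ≤ T → ∃ e : Ω → ℝ, MemLp e 2 ρ ∧ ∫ ω, e ω ^ 2 ∂ρ ≤ B / t ∧
    ∀ᵐ ω ∂ρ,
      (∀ s', |estTrans (batch z T k ω) (π k ω) t (batch z T k ω t).s s'
        - M.trans (π k ω) (batch z T k ω t).s s'| ≤ e ω) ∧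
      (∀ r : R, |estRew (batch z T k ω) (π k ω) t (batch z T k ω t).s r
        - ∑ a, π k ω (batch z T k ω t).s a * M.rew (batch z T k ω t).s a r| ≤ e ω) ∧
      |1 / estStat (batch z T k ω) t (batch z T k ω t).s - 1 / μb (batch z T k ω t).s| ≤ e ω

/-- `E ∑ₛ μ*(s) (V*(s) - V^{σ}(s)) ≤ ε` for the random policy `σ`. -/
def MDP.IsAccurate (M : MDP S A R) (γ : ℝ) (πs : S → A → ℝ) (μs : S → ℝ) (ρ : Measure Ω)
    (σ : Ω → S → A → ℝ) (ε : ℝ) : Prop :=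
  Integrable (fun ω => ∑ s, μs s * (M.value γ πs s - M.value γ (σ ω) s)) ρ ∧
  ∫ ω, ∑ s, μs s * (M.value γ πs s - M.value γ (σ ω) s) ∂ρ ≤ ε

end Learning

/-- Step sizes used under a `c`-contraction. -/
def IsContractionStep (c : ℝ) (η : ℕ → ℝ) : Prop :=
  1 / c ≤ η 1 ∧ η 1 ≤ 2 / c ∧ ∀ t, 1 ≤ t → η (t + 1) = Real.exp (-(1 / 2) * c * η t) * η t

/-- The logarithmic factors hidden in `Õ`. -/
def logFactor (γ ε : ℝ) : ℝ :=
  (1 + Real.log (1 + 1 / ε)) * (1 + Real.log (1 / (1 - γ)))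

end OfflineRL

end

/-!
Fix a policy `π`, let `θ*` solve its Bellman equation and let `l` be the loss. For both SGD-based
directions `⟨θ - θ*, ḡ(θ)⟩ = 2 l(θ)`, so expanding the square of `‖θ - θ*‖` along the projected
iteration bounds the sum of the `ηₜ l(θₜ)` by a telescoping sum, up to the Markovian noise and the
estimation errors. For the noise one looks back `O(τ log T)` steps: given the data up to then, the
current state is stationary up to an error `1 / T`, by Dobrushin's contraction, while the iterate
has moved only by the sum of the last step sizes. The estimation errors have mean `O(t ^ (-1/2))`.
Steps of order `t ^ (-1/2)` thus give a mean loss of order `T ^ (-1/2)` up to logarithms. Under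
strong convexity or a contraction `⟨θ - θ*, ḡ(θ)⟩ ≥ c ‖θ - θ*‖ ^ 2`; the distance then contracts by
`(ηₜ₊₁ / ηₜ) ^ 2` in step `t`, which makes the mean of `‖θₜ - θ*‖ ^ 2` of order `1 / t` and the mean
loss of order `1 / T`, up to logarithms.

The shift condition turns the mean loss into a uniform bound on the Bellman error, so if the mean
loss is of order `q ^ 2`, one round of policy iteration contracts the gap to any comparator by `γ`
up to an error `2 q / (1 - γ)`. Accuracy `ε` needs `q` of order `(1 - γ) ^ 2 ε` and `K` of order
`1 / (1 - γ)`, hence `T` of order `(1 - γ) ^ (-8) ε ^ (-4)`, respectively `(1 - γ) ^ (-4) ε ^ (-2)`.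
-/

noncomputable section

namespace OfflineRL

open scoped Matrix

/-! ### Stochastic matrices -/

section Stochastic

variable {S : Type*} [Fintype S] {μ ν v ξ : S → ℝ} {γ ε : ℝ}

/-- Dobrushin's contraction: subtracting `∑ x, ν x = 0` copies of `μ` centers the rows of `Q`. -/
lemma sum_abs_vecMul_le_mul_of_sum_eq_zero {Q : Matrix S S ℝ} {c : ℝ}
    (hQ : ∀ x, ∑ y, |Q x y - μ y| ≤ c) (hν : ∑ x, ν x = 0) :
    ∑ y, |(ν ᵥ* Q) y| ≤ c * ∑ x, |ν x| := by
  have hcentered : ∀ y, (ν ᵥ* Q) y = ∑ x, ν x * (Q x y - μ y) := fun y => by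
    simp_rw [mul_sub, Finset.sum_sub_distrib, ← Finset.sum_mul, hν, zero_mul, sub_zero]
    rfl
  calc ∑ y, |(ν ᵥ* Q) y| ≤ ∑ y, ∑ x, |ν x| * |Q x y - μ y| := by
        gcongr with y
        rw [hcentered]
        exact (Finset.abs_sum_le_sum_abs _ _).trans_eq
          (Finset.sum_congr rfl fun x _ => abs_mul _ _)
    _ = ∑ x, |ν x| * ∑ y, |Q x y - μ y| := by
        rw [Finset.sum_comm]; simp_rw [← Finset.mul_sum]
    _ ≤ ∑ x, |ν x| * c := by gcongr with x; exact hQ x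
    _ = c * ∑ x, |ν x| := by rw [← Finset.sum_mul, mul_comm]

lemma IsStationary.vecMul_eq {Q : Matrix S S ℝ} (h : IsStationary Q μ) : μ ᵥ* Q = μ :=
  funext h.invariant

variable [DecidableEq S] {Q : Matrix S S ℝ}

lemma sum_abs_vecMul_le_of_rowStochastic (hQ : Q ∈ Matrix.rowStochastic ℝ S) (ν : S → ℝ) :
    ∑ y, |(ν ᵥ* Q) y| ≤ ∑ x, |ν x| :=
  calc ∑ y, |(ν ᵥ* Q) y| ≤ ∑ y, ∑ x, |ν x| * Q x y := by
        gcongr with y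
        refine (Finset.abs_sum_le_sum_abs _ _).trans_eq (Finset.sum_congr rfl fun x _ => ?_)
        rw [abs_mul, abs_of_nonneg (hQ.1 x y)]
    _ = ∑ x, |ν x| := by
        rw [Finset.sum_comm]
        simp_rw [← Finset.mul_sum, Matrix.sum_row_of_mem_rowStochastic hQ, mul_one]

lemma mulVec_le_of_rowStochastic (hQ : Q ∈ Matrix.rowStochastic ℝ S) {L : ℝ}
    (hv : ∀ s, v s ≤ L) (s : S) : (Q *ᵥ v) s ≤ L :=
  calc (Q *ᵥ v) s ≤ ∑ y, Q s y * L :=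
        Finset.sum_le_sum fun y _ => mul_le_mul_of_nonneg_left (hv y) (hQ.1 s y)
    _ = L := by rw [← Finset.sum_mul, Matrix.sum_row_of_mem_rowStochastic hQ, one_mul]

lemma abs_mulVec_le_of_rowStochastic (hQ : Q ∈ Matrix.rowStochastic ℝ S) {L : ℝ}
    (hv : ∀ s, |v s| ≤ L) (s : S) : |(Q *ᵥ v) s| ≤ L := by
  have hneg := mulVec_le_of_rowStochastic hQ (v := -v) (fun y => (neg_le_abs _).trans (hv y)) s
  rw [Matrix.mulVec_neg, Pi.neg_apply] at hneg
  exact abs_le'.2 ⟨mulVec_le_of_rowStochastic hQ (fun y => (le_abs_self _).trans (hv y)) s, hneg⟩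

namespace IsStationary

variable (h : IsStationary Q μ)
include h

lemma vecMul_pow_eq (n : ℕ) : μ ᵥ* Q ^ n = μ := by
  induction n with
  | zero => rw [pow_zero, Matrix.vecMul_one]
  | succ n ih => rw [pow_succ, ← Matrix.vecMul_vecMul, ih, h.vecMul_eq]

lemma pow_add_row_sub (i j : ℕ) (s : S) :
    (Q ^ (i + j)) s - μ = ((Q ^ i) s - μ) ᵥ* Q ^ j := by
  rw [Matrix.sub_vecMul, h.vecMul_pow_eq, pow_add, Matrix.mul_apply_eq_vecMul]

lemma sum_abs_pow_succ_sub_le (hQ : Q ∈ Matrix.rowStochastic ℝ S) (i : ℕ) (s : S) :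
    ∑ y, |(Q ^ (i + 1)) s y - μ y| ≤ ∑ y, |(Q ^ i) s y - μ y| := by
  simpa only [← h.pow_add_row_sub, Pi.sub_apply] using
    sum_abs_vecMul_le_of_rowStochastic (pow_mem hQ 1) ((Q ^ i) s - μ)

lemma sum_abs_pow_add_sub_le_half (hQ : Q ∈ Matrix.rowStochastic ℝ S) {τ : ℕ}
    (hτ : ∀ s, (1 / 2) * ∑ y, |(Q ^ τ) s y - μ y| ≤ 1 / 4) (i : ℕ) (s : S) :
    ∑ y, |(Q ^ (i + τ)) s y - μ y| ≤ (1 / 2) * ∑ y, |(Q ^ i) s y - μ y| := by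
  have hsum : ∑ x, ((Q ^ i) s - μ) x = 0 := by
    simp only [Pi.sub_apply, Finset.sum_sub_distrib, h.sum_one,
      Matrix.sum_row_of_mem_rowStochastic (pow_mem hQ i), sub_self]
  have hrows : ∀ x, ∑ y, |(Q ^ τ) x y - μ y| ≤ 1 / 2 := fun x => by linarith [hτ x]
  simpa only [← h.pow_add_row_sub, Pi.sub_apply] using
    sum_abs_vecMul_le_mul_of_sum_eq_zero hrows hsum

lemma sum_abs_pow_sub_le_two (hQ : Q ∈ Matrix.rowStochastic ℝ S) (i : ℕ) (s : S) :
    ∑ y, |(Q ^ i) s y - μ y| ≤ 2 :=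
  calc ∑ y, |(Q ^ i) s y - μ y| ≤ ∑ y, ((Q ^ i) s y + μ y) := by
        gcongr with y
        have hpow := (pow_mem hQ i).1 s y
        have hμ := h.nonneg y
        exact abs_le.2 ⟨by linarith, by linarith⟩
    _ = 2 := by
        rw [Finset.sum_add_distrib, Matrix.sum_row_of_mem_rowStochastic (pow_mem hQ i), h.sum_one]
        norm_num

lemma sum_abs_pow_sub_le (hQ : Q ∈ Matrix.rowStochastic ℝ S) {τ : ℕ}
    (hτ : ∀ s, (1 / 2) * ∑ y, |(Q ^ τ) s y - μ y| ≤ 1 / 4) (n : ℕ) (s : S) :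
    ∑ y, |(Q ^ n) s y - μ y| ≤ 2 * (1 / 2) ^ (n / (τ + 1)) := by
  have hblocks : ∀ q r : ℕ, ∑ y, |(Q ^ (r + q * (τ + 1))) s y - μ y| ≤ 2 * (1 / 2) ^ q := by
    intro q r
    induction q with
    | zero => simpa using h.sum_abs_pow_sub_le_two hQ r s
    | succ q ih =>
      calc ∑ y, |(Q ^ (r + (q + 1) * (τ + 1))) s y - μ y|
          = ∑ y, |(Q ^ (r + q * (τ + 1) + τ + 1)) s y - μ y| := by
            rw [show r + (q + 1) * (τ + 1) = r + q * (τ + 1) + τ + 1 by ring]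
        _ ≤ ∑ y, |(Q ^ (r + q * (τ + 1) + τ)) s y - μ y| := h.sum_abs_pow_succ_sub_le hQ _ s
        _ ≤ (1 / 2) * ∑ y, |(Q ^ (r + q * (τ + 1))) s y - μ y| :=
            h.sum_abs_pow_add_sub_le_half hQ hτ _ s
        _ ≤ (1 / 2) * (2 * (1 / 2) ^ q) := by gcongr
        _ = 2 * (1 / 2) ^ (q + 1) := by ring
  simpa only [Nat.mod_add_div'] using hblocks (n / (τ + 1)) (n % (τ + 1))

end IsStationary

lemma IsStationary.abs_pow_mulVec_le (h : IsStationary Q μ) (hQ : Q ∈ Matrix.rowStochastic ℝ S)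
    {τ : ℕ} (hτ : ∀ s, (1 / 2) * ∑ y, |(Q ^ τ) s y - μ y| ≤ 1 / 4)
    {f : S → ℝ} {L : ℝ} (hf : ∀ s, |f s| ≤ L) (hmean : ∑ s, μ s * f s = 0) (n : ℕ) (s : S) :
    |(Q ^ n *ᵥ f) s| ≤ 2 * L * (1 / 2) ^ (n / (τ + 1)) := by
  have hcenter : (Q ^ n *ᵥ f) s = ∑ y, ((Q ^ n) s y - μ y) * f y := by
    simp_rw [sub_mul, Finset.sum_sub_distrib, hmean, sub_zero]
    rfl
  calc |(Q ^ n *ᵥ f) s| ≤ ∑ y, |(Q ^ n) s y - μ y| * L := by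
        rw [hcenter]
        refine (Finset.abs_sum_le_sum_abs _ _).trans (Finset.sum_le_sum fun y _ => ?_)
        rw [abs_mul]
        exact mul_le_mul_of_nonneg_left (hf y) (abs_nonneg _)
    _ ≤ 2 * (1 / 2) ^ (n / (τ + 1)) * L := by
        rw [← Finset.sum_mul]
        exact mul_le_mul_of_nonneg_right (h.sum_abs_pow_sub_le hQ hτ n s)
          ((abs_nonneg _).trans (hf s))
    _ = 2 * L * (1 / 2) ^ (n / (τ + 1)) := by ring

lemma sum_pow_smul_mulVec (hv : v = ξ + γ • Q *ᵥ v) (n : ℕ) :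
    ∑ t ∈ Finset.range n, γ ^ t • Q ^ t *ᵥ ξ = v - γ ^ n • Q ^ n *ᵥ v := by
  induction n with
  | zero => simp
  | succ n ih =>
    have hstep : Q ^ n *ᵥ v = Q ^ n *ᵥ ξ + γ • Q ^ (n + 1) *ᵥ v := by
      conv_lhs => rw [hv]
      rw [Matrix.mulVec_add, Matrix.mulVec_smul, Matrix.mulVec_mulVec, ← pow_succ]
    rw [Finset.sum_range_succ, ih, hstep, smul_add, smul_smul, ← pow_succ]
    abel

lemma hasSum_pow_mul_mulVec (hQ : Q ∈ Matrix.rowStochastic ℝ S) (h0 : 0 ≤ γ) (h1 : γ < 1)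
    (hv : v = ξ + γ • Q *ᵥ v) (s : S) :
    HasSum (fun t : ℕ => γ ^ t * (Q ^ t *ᵥ ξ) s) (v s) := by
  have hbound : ∀ (w : S → ℝ) (t : ℕ), ‖γ ^ t * (Q ^ t *ᵥ w) s‖ ≤ γ ^ t * ∑ x, |w x| := by
    intro w t
    rw [Real.norm_eq_abs, abs_mul, abs_of_nonneg (pow_nonneg h0 t)]
    gcongr
    exact abs_mulVec_le_of_rowStochastic (pow_mem hQ t)
      (fun x => Finset.single_le_sum (f := fun x => |w x|) (fun _ _ => abs_nonneg _)
        (Finset.mem_univ x)) s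
  have hsummable : Summable fun t : ℕ => γ ^ t * (Q ^ t *ᵥ ξ) s :=
    .of_norm_bounded ((summable_geometric_of_lt_one h0 h1).mul_right _) (hbound ξ)
  have hremainder : Filter.Tendsto (fun n : ℕ => γ ^ n * (Q ^ n *ᵥ v) s) .atTop (nhds 0) :=
    squeeze_zero_norm (hbound v) (by
      simpa using (tendsto_pow_atTop_nhds_zero_of_lt_one h0 h1).mul_const (∑ x, |v x|))
  have hpartial : ∀ n : ℕ, ∑ t ∈ Finset.range n, γ ^ t * (Q ^ t *ᵥ ξ) s
      = v s - γ ^ n * (Q ^ n *ᵥ v) s := fun n => by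
    simpa using congrFun (sum_pow_smul_mulVec hv n) s
  rw [hsummable.hasSum_iff_tendsto_nat]
  simpa only [hpartial, sub_zero] using hremainder.const_sub (v s)

lemma le_div_one_sub_of_le_mulVec_add (hQ : Q ∈ Matrix.rowStochastic ℝ S) (h0 : 0 ≤ γ)
    (h1 : γ < 1) (hv : ∀ s, v s ≤ γ * (Q *ᵥ v) s + ε) (s : S) : v s ≤ ε / (1 - γ) := by
  have : Nonempty S := ⟨s⟩
  obtain ⟨x, hmax⟩ := Finite.exists_max v
  have hcontract : γ * (Q *ᵥ v) x ≤ γ * v x :=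
    mul_le_mul_of_nonneg_left (mulVec_le_of_rowStochastic hQ hmax x) h0
  rw [le_div_iff₀ (by linarith)]
  nlinarith [hv x, hmax s]

end Stochastic

/-! ### Values and approximate policy improvement -/

section Values

variable {S A : Type*} [Fintype S] [DecidableEq S] [Fintype A] {R : Finset ℝ} {M : MDP S A R}
  {γ ε : ℝ} {π πs σ : S → A → ℝ} {u us uσ v : S → ℝ}

lemma IsPolicy.trans_mem_rowStochastic (hπ : IsPolicy π) (M : MDP S A R) :
    M.trans π ∈ Matrix.rowStochastic ℝ S := by
  refine Matrix.mem_rowStochastic_iff_sum.2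
    ⟨fun s s' => Finset.sum_nonneg fun a _ => mul_nonneg (hπ.nonneg s a) (M.P_nonneg s a s'),
      fun s => ?_⟩
  simp only [MDP.trans, Matrix.of_apply]
  rw [Finset.sum_comm]
  simp_rw [← Finset.mul_sum, M.P_sum, mul_one, hπ.sum_one]

omit [DecidableEq S] in
lemma MDP.bellman_sub (M : MDP S A R) (γ : ℝ) (σ : S → A → ℝ) (v u : S → ℝ) (s : S) :
    M.bellman γ σ v s - M.bellman γ σ u s = γ * (M.trans σ *ᵥ (v - u)) s := by
  rw [Matrix.mulVec_sub, Pi.sub_apply, mul_sub]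
  exact add_sub_add_left_eq_sub _ _ _

lemma MDP.value_eq_of_bellman_eq (M : MDP S A R) (h0 : 0 ≤ γ) (h1 : γ < 1) (hπ : IsPolicy π)
    (hv : ∀ s, v s = M.bellman γ π v s) (s : S) : M.value γ π s = v s :=
  (hasSum_pow_mul_mulVec (hπ.trans_mem_rowStochastic M) h0 h1 (funext hv) s).tsum_eq

lemma MDP.SolvesBellman.value_eq_linValue {d : ℕ} {φ : S → EuclideanSpace ℝ (Fin d)}
    {θ : EuclideanSpace ℝ (Fin d)} (h : M.SolvesBellman γ φ π θ) (h0 : 0 ≤ γ) (h1 : γ < 1)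
    (hπ : IsPolicy π) : M.value γ π = linValue φ θ :=
  funext (M.value_eq_of_bellman_eq h0 h1 hπ h)

omit [DecidableEq S] in
lemma MDP.bellman_le_add_of_le_add (M : MDP S A R) (h0 : 0 ≤ γ) (hσ : IsPolicy σ)
    (h : ∀ s, v s ≤ u s + ε) (s : S) : M.bellman γ σ v s ≤ M.bellman γ σ u s + γ * ε := by
  classical
  have hmean : (M.trans σ *ᵥ (v - u)) s ≤ ε :=
    mulVec_le_of_rowStochastic (hσ.trans_mem_rowStochastic M)
      (fun y => sub_le_iff_le_add'.2 (h y)) s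
  linarith [M.bellman_sub γ σ v u s, mul_le_mul_of_nonneg_left hmean h0]

omit [DecidableEq S] in
lemma MDP.le_add_div_of_le_bellman_add (M : MDP S A R) (h0 : 0 ≤ γ) (h1 : γ < 1)
    (hσ : IsPolicy σ) (hv : ∀ s, v s ≤ M.bellman γ σ v s + ε)
    (hu : ∀ s, M.bellman γ σ u s ≤ u s) (s : S) : v s ≤ u s + ε / (1 - γ) := by
  classical
  have hdiff := le_div_one_sub_of_le_mulVec_add (v := v - u) (ε := ε)
    (hσ.trans_mem_rowStochastic M)
    h0 h1 (fun s => by rw [← M.bellman_sub, Pi.sub_apply]; linarith [hv s, hu s]) s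
  rw [Pi.sub_apply] at hdiff
  linarith

omit [DecidableEq S] in
lemma MDP.IsGreedy.value_gap_le {Adm : Set (S → A → ℝ)} (hgreedy : M.IsGreedy γ Adm v σ)
    (h0 : 0 ≤ γ) (h1 : γ < 1) (hAdm : ∀ π ∈ Adm, IsPolicy π) (hπ : π ∈ Adm) (hπs : πs ∈ Adm)
    (hu : ∀ s, u s = M.bellman γ π u s) (hus : ∀ s, us s = M.bellman γ πs us s)
    (huσ : ∀ s, uσ s = M.bellman γ σ uσ s) (hv : ∀ s, |M.bellman γ π v s - v s| ≤ ε) (s : S) :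
    us s - uσ s ≤ γ * (M.trans πs *ᵥ (us - u)) s + 2 * (ε / (1 - γ)) := by
  classical
  have hσ := hAdm σ hgreedy.1
  have hlow : ∀ s, v s ≤ uσ s + ε / (1 - γ) := M.le_add_div_of_le_bellman_add h0 h1 hσ
    (fun s => by linarith [(abs_le.1 (hv s)).1, hgreedy.2 π hπ s]) fun s => (huσ s).ge
  have hup : ∀ s, u s ≤ v s + ε / (1 - γ) := by
    have hgap := M.le_add_div_of_le_bellman_add (v := u) (u := v + fun _ => ε / (1 - γ)) (ε := 0)
      h0 h1 (hAdm π hπ) (fun s => by rw [add_zero, ← hu s]) fun s => ?_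
    · simpa using hgap
    · have hshift := M.bellman_le_add_of_le_add (v := v + fun _ => ε / (1 - γ)) (u := v) h0
        (hAdm π hπ) (fun _ => le_rfl) s
      have hsplit : γ * (ε / (1 - γ)) + ε = ε / (1 - γ) := by
        field_simp [(sub_pos.2 h1).ne']; ring
      simp only [Pi.add_apply]
      linarith [(abs_le.1 (hv s)).2]
  have hε : 0 ≤ ε / (1 - γ) := div_nonneg ((abs_nonneg _).trans (hv s)) (by linarith)
  have hlowσ := M.bellman_le_add_of_le_add h0 hσ hlow s
  have hups := M.bellman_le_add_of_le_add h0 (hAdm πs hπs) hup s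
  have hcompare := hgreedy.2 πs hπs s
  have hcontract : γ * (ε / (1 - γ)) ≤ ε / (1 - γ) := mul_le_of_le_one_left hε h1.le
  rw [← M.bellman_sub, ← hus]
  rw [← huσ] at hlowσ
  linarith

omit [DecidableEq S] in
/-- Averaging the pointwise bound over a stationary distribution of the comparator removes its
transition matrix. -/
lemma MDP.IsGreedy.sum_stationary_value_gap_le {Adm : Set (S → A → ℝ)}
    (hgreedy : M.IsGreedy γ Adm v σ) (h0 : 0 ≤ γ) (h1 : γ < 1) (hAdm : ∀ π ∈ Adm, IsPolicy π)
    (hπ : π ∈ Adm) (hπs : πs ∈ Adm) (hu : ∀ s, u s = M.bellman γ π u s)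
    (hus : ∀ s, us s = M.bellman γ πs us s) (huσ : ∀ s, uσ s = M.bellman γ σ uσ s)
    (hv : ∀ s, |M.bellman γ π v s - v s| ≤ ε) {μs : S → ℝ}
    (hμ : IsStationary (M.trans πs) μs) :
    ∑ s, μs s * (us s - uσ s) ≤ γ * ∑ s, μs s * (us s - u s) + 2 * (ε / (1 - γ)) := by
  classical
  have hinvariant : ∑ s, μs s * (M.trans πs *ᵥ (us - u)) s = ∑ s, μs s * (us s - u s) := by
    change μs ⬝ᵥ (M.trans πs *ᵥ (us - u)) = μs ⬝ᵥ (us - u)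
    rw [Matrix.dotProduct_mulVec, hμ.vecMul_eq]
  calc ∑ s, μs s * (us s - uσ s)
      ≤ ∑ s, μs s * (γ * (M.trans πs *ᵥ (us - u)) s + 2 * (ε / (1 - γ))) := by
        gcongr with s
        · exact hμ.nonneg s
        · exact hgreedy.value_gap_le h0 h1 hAdm hπ hπs hu hus huσ hv s
    _ = γ * ∑ s, μs s * (us s - u s) + 2 * (ε / (1 - γ)) := by
        simp_rw [mul_add, Finset.sum_add_distrib, ← Finset.sum_mul, hμ.sum_one, one_mul,
          mul_left_comm _ γ, ← Finset.mul_sum, hinvariant]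

end Values

/-! ### Euclidean projection -/

section Projection

variable {d : ℕ} {C : Set (EuclideanSpace ℝ (Fin d))}

lemma proj_mem_and_le (hC : IsCompact C) (hne : C.Nonempty) (x : EuclideanSpace ℝ (Fin d)) :
    proj C x ∈ C ∧ ∀ w ∈ C, ‖x - proj C x‖ ≤ ‖x - w‖ := by
  have hmin : ∃ y ∈ C, ∀ w ∈ C, ‖x - y‖ ≤ ‖x - w‖ :=
    hC.exists_isMinOn hne (continuous_const.sub continuous_id).norm.continuousOn
  rw [proj, dif_pos hmin]
  exact hmin.choose_spec

lemma inner_sub_proj_sub_proj_nonpos (hC : IsCompact C) (hconv : Convex ℝ C)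
    (x : EuclideanSpace ℝ (Fin d)) {w : EuclideanSpace ℝ (Fin d)} (hw : w ∈ C) :
    inner ℝ (x - proj C x) (w - proj C x) ≤ 0 := by
  have hne : C.Nonempty := ⟨w, hw⟩
  obtain ⟨hmem, hmin⟩ := proj_mem_and_le hC hne x
  have : Nonempty C := hne.to_subtype
  refine (norm_eq_iInf_iff_real_inner_le_zero hconv hmem).1 ?_ w hw
  exact le_antisymm (le_ciInf fun w => hmin w w.2)
    (ciInf_le ⟨0, by rintro _ ⟨w, rfl⟩; exact norm_nonneg _⟩ (⟨_, hmem⟩ : C))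

lemma lipschitzWith_proj (hC : IsCompact C) (hconv : Convex ℝ C) (hne : C.Nonempty) :
    LipschitzWith 1 (proj C) := by
  refine LipschitzWith.of_dist_le_mul fun x y => ?_
  have hx := inner_sub_proj_sub_proj_nonpos hC hconv x (proj_mem_and_le hC hne y).1
  have hy := inner_sub_proj_sub_proj_nonpos hC hconv y (proj_mem_and_le hC hne x).1
  have hfirm : ‖proj C x - proj C y‖ ^ 2 ≤ inner ℝ (x - y) (proj C x - proj C y) := by
    rw [← real_inner_self_eq_norm_sq]
    simp only [inner_sub_left, inner_sub_right] at hx hy ⊢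
    linarith
  have hcauchy := real_inner_le_norm (x - y) (proj C x - proj C y)
  rw [NNReal.coe_one, one_mul, dist_eq_norm, dist_eq_norm]
  by_contra! hlt
  nlinarith [norm_nonneg (x - y)]

lemma proj_eq_self_of_mem (hC : IsCompact C) {x : EuclideanSpace ℝ (Fin d)} (hx : x ∈ C) :
    proj C x = x := by
  have hzero := (proj_mem_and_le hC ⟨x, hx⟩ x).2 x hx
  rw [sub_self, norm_zero] at hzero
  exact (sub_eq_zero.1 (norm_le_zero_iff.1 hzero)).symm

lemma norm_proj_sub_le (hC : IsCompact C) (hconv : Convex ℝ C) {w : EuclideanSpace ℝ (Fin d)}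
    (hw : w ∈ C) (x : EuclideanSpace ℝ (Fin d)) : ‖proj C x - w‖ ≤ ‖x - w‖ := by
  simpa [proj_eq_self_of_mem hC hw, dist_eq_norm] using
    (lipschitzWith_proj hC hconv ⟨w, hw⟩).dist_le_mul x w

end Projection

/-! ### Bounds on the update directions -/

section Bounds

variable {S A : Type*} [Fintype S] [DecidableEq S] [Fintype A] {R : Finset ℝ}
  {d : ℕ} {κ : Constants} {M : MDP S A R} {γ : ℝ} {b : S → A → ℝ} {μb : S → ℝ}
  {Adm : Set (S → A → ℝ)} {φ : S → EuclideanSpace ℝ (Fin d)}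
  {C : Set (EuclideanSpace ℝ (Fin d))} {π : S → A → ℝ}

namespace Standing

lemma one_le_shift_mul (h : Standing κ M γ b μb Adm φ C) (hπ : π ∈ Adm) (s : S) :
    1 ≤ κ.shift * μb s :=
  calc (1 : ℝ) = ∑ a, π s a := ((h.admissible π hπ).sum_one s).symm
    _ ≤ ∑ a, κ.shift * μb s * b s a := Finset.sum_le_sum fun a _ => h.policy_shift π hπ s a
    _ = κ.shift * μb s := by rw [← Finset.mul_sum, h.behavior.sum_one, mul_one]

lemma stat_pos (h : Standing κ M γ b μb Adm φ C) (hπ : π ∈ Adm) (s : S) : 0 < μb s :=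
  pos_of_mul_pos_right (one_pos.trans_le (h.one_le_shift_mul hπ s)) κ.shift_pos.le

lemma stat_le_one (h : Standing κ M γ b μb Adm φ C) (s : S) : μb s ≤ 1 := by
  rw [← h.stationary.sum_one]
  exact Finset.single_le_sum (fun s _ => h.stationary.nonneg s) (Finset.mem_univ s)

lemma card_le_shift (h : Standing κ M γ b μb Adm φ C) (hπ : π ∈ Adm) :
    (Fintype.card S : ℝ) ≤ κ.shift :=
  calc (Fintype.card S : ℝ) = ∑ _s : S, (1 : ℝ) := by simp
    _ ≤ ∑ s, κ.shift * μb s := Finset.sum_le_sum fun s _ => h.one_le_shift_mul hπ s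
    _ = κ.shift := by rw [← Finset.mul_sum, h.stationary.sum_one, mul_one]

lemma one_le_shift [Nonempty S] (h : Standing κ M γ b μb Adm φ C) (hπ : π ∈ Adm) :
    1 ≤ κ.shift :=
  (Nat.one_le_cast.2 Fintype.card_pos).trans (h.card_le_shift hπ)

lemma ratio_nonneg (h : Standing κ M γ b μb Adm φ C) (hπ : π ∈ Adm) (s : S) (a : A) :
    0 ≤ π s a / b s a :=
  div_nonneg ((h.admissible π hπ).nonneg s a) (h.behavior.nonneg s a)

lemma ratio_le (h : Standing κ M γ b μb Adm φ C) (hπ : π ∈ Adm) (s : S) (a : A) :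
    π s a / b s a ≤ κ.shift * μb s :=
  div_le_of_le_mul₀ (h.behavior.nonneg s a)
    (mul_nonneg κ.shift_pos.le (h.stationary.nonneg s)) (h.policy_shift π hπ s a)

lemma abs_ratio_le (h : Standing κ M γ b μb Adm φ C) (hπ : π ∈ Adm) (s : S) (a : A) :
    |π s a / b s a| ≤ κ.shift := by
  rw [abs_of_nonneg (h.ratio_nonneg hπ s a)]
  exact (h.ratio_le hπ s a).trans (mul_le_of_le_one_right κ.shift_pos.le (h.stat_le_one s))

lemma abs_one_div_stat_mul_ratio_le (h : Standing κ M γ b μb Adm φ C) (hπ : π ∈ Adm) (s : S)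
    (a : A) : |1 / μb s * (π s a / b s a)| ≤ κ.shift := by
  have hμ := h.stat_pos hπ s
  rw [abs_of_nonneg (mul_nonneg (one_div_nonneg.2 hμ.le) (h.ratio_nonneg hπ s a)),
    one_div_mul_eq_div, div_le_iff₀ hμ]
  exact h.ratio_le hπ s a

/-- The shift condition forces `π(a|s) = 0` where `b(a|s) = 0`, so the junk value of the ratio is
harmless. -/
lemma mul_ratio (h : Standing κ M γ b μb Adm φ C) (hπ : π ∈ Adm) (s : S) (a : A) :
    b s a * (π s a / b s a) = π s a :=
  mul_div_cancel_of_imp' fun hb =>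
    le_antisymm (by simpa [hb] using h.policy_shift π hπ s a) ((h.admissible π hπ).nonneg s a)

lemma rewardBound_pos [Nonempty S] (h : Standing κ M γ b μb Adm φ C) : 0 < κ.rewardBound := by
  obtain ⟨s⟩ := ‹Nonempty S›
  obtain ⟨a, -, -⟩ := Finset.exists_ne_zero_of_sum_ne_zero
    (by rw [h.behavior.sum_one s]; exact one_ne_zero : ∑ a, b s a ≠ 0)
  obtain ⟨r, -, hr⟩ := Finset.exists_ne_zero_of_sum_ne_zero
    (by rw [M.rew_sum s a]; exact one_ne_zero : ∑ r, M.rew s a r ≠ 0)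
  exact (abs_nonneg _).trans_lt (h.reward_bound s a r ((M.rew_nonneg s a r).lt_of_ne' hr))

lemma abs_meanReward_le (h : Standing κ M γ b μb Adm φ C) (hπ : π ∈ Adm) (s : S) :
    |M.meanReward π s| ≤ κ.rewardBound := by
  have hp := h.admissible π hπ
  have hterm : ∀ a, ∀ r : R,
      |π s a * M.rew s a r * (r : ℝ)| ≤ π s a * M.rew s a r * κ.rewardBound := fun a r => by
    have hweight := mul_nonneg (hp.nonneg s a) (M.rew_nonneg s a r)
    rw [abs_mul, abs_of_nonneg hweight]
    rcases (M.rew_nonneg s a r).eq_or_lt' with hzero | hpos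
    · simp [hzero]
    · exact mul_le_mul_of_nonneg_left (h.reward_bound s a r hpos).le hweight
  calc |M.meanReward π s| ≤ ∑ a, ∑ r : R, π s a * M.rew s a r * κ.rewardBound :=
        (Finset.abs_sum_le_sum_abs _ _).trans <| Finset.sum_le_sum fun a _ =>
          (Finset.abs_sum_le_sum_abs _ _).trans <| Finset.sum_le_sum fun r _ => hterm a r
    _ = κ.rewardBound := by
        simp_rw [← Finset.sum_mul, ← Finset.mul_sum, M.rew_sum, mul_one, hp.sum_one, one_mul]

lemma norm_nextFeature_le (h : Standing κ M γ b μb Adm φ C) (hπ : π ∈ Adm) (s : S) :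
    ‖M.nextFeature φ π s‖ ≤ κ.featureBound := by
  obtain ⟨hnonneg, hsum⟩ :=
    Matrix.mem_rowStochastic_iff_sum.1 ((h.admissible π hπ).trans_mem_rowStochastic M)
  calc ‖M.nextFeature φ π s‖ ≤ ∑ s', M.trans π s s' * κ.featureBound :=
        norm_sum_le_of_le _ fun s' _ => by
          rw [norm_smul, Real.norm_eq_abs, abs_of_nonneg (hnonneg s s')]
          exact mul_le_mul_of_nonneg_left (h.feature_bound s') (hnonneg s s')
    _ = κ.featureBound := by rw [← Finset.sum_mul, hsum, one_mul]

end Standing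

/-- Bound on the temporal differences over the feasibility set. -/
def Constants.residualBound (κ : Constants) : ℝ :=
  κ.rewardBound + 2 * κ.featureBound * κ.radius

/-- Bound on the exact update directions over the feasibility set. -/
def Constants.dirBound (κ : Constants) : ℝ :=
  2 * κ.shift * κ.residualBound * κ.featureBound

/-- Lipschitz constant in the parameter of the exact update directions. -/
def Constants.dirLip (κ : Constants) : ℝ :=
  4 * κ.shift * κ.featureBound ^ 2

/-- Sensitivity of the residual to the estimation errors. -/
def Constants.residualErr (κ : Constants) : ℝ :=
  κ.rewardCard * κ.rewardBound + κ.shift * κ.featureBound * κ.radius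

/-- Sensitivity of the update directions to the estimation errors. -/
def Constants.dirErr (κ : Constants) : ℝ :=
  2 * κ.shift * (κ.residualErr + κ.residualBound) * κ.featureBound

lemma Constants.dirLip_pos (κ : Constants) : 0 < κ.dirLip :=
  mul_pos (mul_pos four_pos κ.shift_pos) (pow_pos κ.featureBound_pos 2)

section InnerProduct

variable {E : Type*} [NormedAddCommGroup E] [InnerProductSpace ℝ E] {x y : E} {K L : ℝ}

lemma norm_smul_le_mul {a : ℝ} (ha : ‖a‖ ≤ K) (hx : ‖x‖ ≤ L) : ‖a • x‖ ≤ K * L := by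
  rw [norm_smul]
  exact mul_le_mul ha hx (norm_nonneg _) ((norm_nonneg _).trans ha)

lemma norm_smul_sub_le (h0 : 0 ≤ γ) (h1 : γ ≤ 1) (hx : ‖x‖ ≤ K) (hy : ‖y‖ ≤ L) :
    ‖γ • x - y‖ ≤ K + L := by
  refine norm_sub_le_of_le ?_ hy
  rw [norm_smul, Real.norm_eq_abs, abs_of_nonneg h0]
  exact (mul_le_of_le_one_left (norm_nonneg _) h1).trans hx

lemma abs_inner_le_mul (hx : ‖x‖ ≤ K) (hy : ‖y‖ ≤ L) : |inner ℝ x y| ≤ K * L :=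
  (abs_real_inner_le_norm x y).trans
    (mul_le_mul hx hy (norm_nonneg _) ((norm_nonneg _).trans hx))

end InnerProduct

omit [Fintype S] [DecidableEq S] in
lemma td_eq_inner (r : ℝ) (θ : EuclideanSpace ℝ (Fin d)) (s s' : S) :
    r + γ * linValue φ θ s' - linValue φ θ s = r + inner ℝ (γ • φ s' - φ s) θ := by
  simp only [linValue, inner_sub_left, inner_smul_left, RCLike.conj_to_real]; ring

lemma abs_add_inner_le_residualBound (h0 : 0 ≤ γ) (h1 : γ ≤ 1) {r : ℝ}
    (hr : |r| ≤ κ.rewardBound) {θ x y : EuclideanSpace ℝ (Fin d)} (hθ : ‖θ‖ ≤ κ.radius)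
    (hx : ‖x‖ ≤ κ.featureBound) (hy : ‖y‖ ≤ κ.featureBound) :
    |r + inner ℝ (γ • x - y) θ| ≤ κ.residualBound := by
  refine (abs_add_le _ _).trans (add_le_add hr ?_)
  rw [two_mul]
  exact abs_inner_le_mul (norm_smul_sub_le h0 h1 hx hy) hθ

namespace Standing

lemma residualBound_pos [Nonempty S] (h : Standing κ M γ b μb Adm φ C) : 0 < κ.residualBound :=
  add_pos h.rewardBound_pos (mul_pos (mul_pos two_pos κ.featureBound_pos) κ.radius_pos)

lemma dirBound_pos [Nonempty S] (h : Standing κ M γ b μb Adm φ C) : 0 < κ.dirBound :=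
  mul_pos (mul_pos (mul_pos two_pos κ.shift_pos) h.residualBound_pos) κ.featureBound_pos

lemma residualErr_pos [Nonempty S] (h : Standing κ M γ b μb Adm φ C) : 0 < κ.residualErr :=
  add_pos_of_nonneg_of_pos (mul_nonneg (Nat.cast_nonneg _) h.rewardBound_pos.le)
    (mul_pos (mul_pos κ.shift_pos κ.featureBound_pos) κ.radius_pos)

lemma dirErr_pos [Nonempty S] (h : Standing κ M γ b μb Adm φ C) : 0 < κ.dirErr :=
  mul_pos (mul_pos (mul_pos two_pos κ.shift_pos) (add_pos h.residualErr_pos h.residualBound_pos))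
    κ.featureBound_pos

variable (h : Standing κ M γ b μb Adm φ C) (h0 : 0 ≤ γ) (h1 : γ ≤ 1) (hπ : π ∈ Adm)
  {θ θ' : EuclideanSpace ℝ (Fin d)}

include h h0 h1 hπ

lemma abs_residual_le (hθ : ‖θ‖ ≤ κ.radius) (s : S) :
    |residual γ φ (M.meanReward π) (M.nextFeature φ π) θ s| ≤ κ.residualBound :=
  abs_add_inner_le_residualBound h0 h1 (h.abs_meanReward_le hπ s) hθ (h.norm_nextFeature_le hπ s)
    (h.feature_bound s)

lemma abs_residual_sub_le (s : S) :
    |residual γ φ (M.meanReward π) (M.nextFeature φ π) θ s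
      - residual γ φ (M.meanReward π) (M.nextFeature φ π) θ' s|
      ≤ (κ.featureBound + κ.featureBound) * ‖θ - θ'‖ := by
  rw [residual, residual, add_sub_add_left_eq_sub, ← inner_sub_right]
  exact abs_inner_le_mul (norm_smul_sub_le h0 h1 (h.norm_nextFeature_le hπ s) (h.feature_bound s))
    le_rfl

lemma norm_direction_le (m : Method) (hθ : ‖θ‖ ≤ κ.radius) {z : Sample S A R}
    (hz : |(z.r : ℝ)| ≤ κ.rewardBound) :
    ‖direction m γ φ b π (M.meanReward π) (M.nextFeature φ π) μb θ z‖ ≤ κ.dirBound := by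
  have : Nonempty S := ⟨z.s⟩
  have hfeature := κ.featureBound_pos
  have hresidual := h.abs_residual_le h0 h1 hπ hθ z.s
  have hdiff := norm_smul_sub_le h0 h1 (h.feature_bound z.s') (h.feature_bound z.s)
  have hbound : κ.dirBound
      = κ.shift * κ.residualBound * (κ.featureBound + κ.featureBound) := by
    rw [Constants.dirBound]; ring
  rw [hbound]
  cases m with
  | directSGD =>
    exact norm_smul_le_mul
      (hresidual.trans (le_mul_of_one_le_left h.residualBound_pos.le (h.one_le_shift hπ)))
      (norm_smul_sub_le h0 h1 (h.norm_nextFeature_le hπ _) (h.feature_bound _))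
  | tdSGD => exact norm_smul_le_mul (norm_mul_le_of_le (h.abs_ratio_le hπ _ _) hresidual) hdiff
  | td0 =>
    rw [direction, norm_neg, td_eq_inner]
    exact norm_smul_le_mul (norm_mul_le_of_le (h.abs_one_div_stat_mul_ratio_le hπ _ _)
      (abs_add_inner_le_residualBound h0 h1 hz hθ (h.feature_bound _) (h.feature_bound _)))
      (by linarith [h.feature_bound z.s])

lemma norm_direction_sub_le (m : Method) (z : Sample S A R) :
    ‖direction m γ φ b π (M.meanReward π) (M.nextFeature φ π) μb θ z
      - direction m γ φ b π (M.meanReward π) (M.nextFeature φ π) μb θ' z‖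
      ≤ κ.dirLip * ‖θ - θ'‖ := by
  have : Nonempty S := ⟨z.s⟩
  have hfeature := κ.featureBound_pos
  have hresidual := h.abs_residual_sub_le h0 h1 hπ (θ := θ) (θ' := θ') z.s
  have hdiff := norm_smul_sub_le h0 h1 (h.feature_bound z.s') (h.feature_bound z.s)
  have hlip : κ.dirLip * ‖θ - θ'‖ = κ.shift * ((κ.featureBound + κ.featureBound) * ‖θ - θ'‖)
      * (κ.featureBound + κ.featureBound) := by
    rw [Constants.dirLip]; ring
  rw [hlip]
  cases m with
  | directSGD =>
    simp only [direction, ← sub_smul]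
    exact norm_smul_le_mul
      (hresidual.trans (le_mul_of_one_le_left (by positivity) (h.one_le_shift hπ)))
      (norm_smul_sub_le h0 h1 (h.norm_nextFeature_le hπ _) (h.feature_bound _))
  | tdSGD =>
    simp only [direction, ← sub_smul, ← mul_sub]
    exact norm_smul_le_mul (norm_mul_le_of_le (h.abs_ratio_le hπ _ _) hresidual) hdiff
  | td0 =>
    simp only [direction, neg_sub_neg, td_eq_inner, ← sub_smul, ← mul_sub,
      add_sub_add_left_eq_sub, ← inner_sub_right, norm_sub_rev θ θ']
    exact norm_smul_le_mul (norm_mul_le_of_le (h.abs_one_div_stat_mul_ratio_le hπ _ _)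
      (abs_inner_le_mul hdiff le_rfl)) (by linarith [h.feature_bound z.s])

omit [Fintype S] [DecidableEq S] h hπ in
lemma abs_residual_sub_residual_le {ξ ξ' : S → ℝ} {ψ ψ' : S → EuclideanSpace ℝ (Fin d)}
    {s : S} {e : ℝ} (hθ : ‖θ‖ ≤ κ.radius)
    (hξ : |ξ s - ξ' s| ≤ κ.rewardCard * κ.rewardBound * e)
    (hψ : ‖ψ s - ψ' s‖ ≤ κ.shift * κ.featureBound * e) :
    |residual γ φ ξ ψ θ s - residual γ φ ξ' ψ' θ s| ≤ κ.residualErr * e := by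
  have hsplit : residual γ φ ξ ψ θ s - residual γ φ ξ' ψ' θ s
      = (ξ s - ξ' s) + inner ℝ (γ • (ψ s - ψ' s) - 0) θ := by
    simp only [residual, inner_sub_left, smul_sub, inner_zero_left]; ring
  rw [hsplit]
  refine (abs_add_le _ _).trans ((add_le_add hξ
    (abs_inner_le_mul (norm_smul_sub_le h0 h1 hψ norm_zero.le) hθ)).trans_eq ?_)
  rw [Constants.residualErr]; ring

lemma norm_residual_smul_sub_le {s : S} {ξ : S → ℝ} {ψ : S → EuclideanSpace ℝ (Fin d)} {e : ℝ}
    (hθ : ‖θ‖ ≤ κ.radius) (he : 0 ≤ e)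
    (hξ : |ξ s - M.meanReward π s| ≤ κ.rewardCard * κ.rewardBound * e)
    (hψ : ‖ψ s - M.nextFeature φ π s‖ ≤ κ.shift * κ.featureBound * e)
    (hψ_bound : ‖ψ s‖ ≤ κ.shift * κ.featureBound) :
    ‖residual γ φ ξ ψ θ s • (γ • ψ s - φ s)
      - residual γ φ (M.meanReward π) (M.nextFeature φ π) θ s
        • (γ • M.nextFeature φ π s - φ s)‖ ≤ κ.dirErr * e := by
  have : Nonempty S := ⟨s⟩
  have hfeature := κ.featureBound_pos
  have hshift := κ.shift_pos
  have hB := h.residualBound_pos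
  have hE := h.residualErr_pos
  set δ := residual γ φ (M.meanReward π) (M.nextFeature φ π) θ s
  have hsplit : residual γ φ ξ ψ θ s • (γ • ψ s - φ s) - δ • (γ • M.nextFeature φ π s - φ s)
      = (residual γ φ ξ ψ θ s - δ) • (γ • ψ s - φ s)
        + δ • (γ • (ψ s - M.nextFeature φ π s) - 0) := by
    module
  rw [hsplit]
  calc _ ≤ κ.residualErr * e * (κ.shift * κ.featureBound + κ.featureBound)
        + κ.residualBound * (κ.shift * κ.featureBound * e + 0) :=
        norm_add_le_of_le
          (norm_smul_le_mul (abs_residual_sub_residual_le h0 h1 hθ hξ hψ)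
            (norm_smul_sub_le h0 h1 hψ_bound (h.feature_bound s)))
          (norm_smul_le_mul (h.abs_residual_le h0 h1 hπ hθ s)
            (norm_smul_sub_le h0 h1 hψ norm_zero.le))
    _ ≤ κ.dirErr * e := by
        have hone : κ.residualErr * e * κ.featureBound
            ≤ κ.shift * (κ.residualErr * e * κ.featureBound) :=
          le_mul_of_one_le_left (by positivity) (h.one_le_shift hπ)
        have hnonneg : 0 ≤ κ.shift * κ.residualBound * κ.featureBound * e := by positivity
        rw [Constants.dirErr]
        linarith

lemma norm_direction_sub_exact_le (m : Method) {z : Sample S A R} {ξ : S → ℝ}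
    {ψ : S → EuclideanSpace ℝ (Fin d)} {μ : S → ℝ} {e : ℝ} (hθ : ‖θ‖ ≤ κ.radius)
    (hz : |(z.r : ℝ)| ≤ κ.rewardBound)
    (hξ : |ξ z.s - M.meanReward π z.s| ≤ κ.rewardCard * κ.rewardBound * e)
    (hψ : ‖ψ z.s - M.nextFeature φ π z.s‖ ≤ κ.shift * κ.featureBound * e)
    (hψ_bound : ‖ψ z.s‖ ≤ κ.shift * κ.featureBound) (hμ : |1 / μ z.s - 1 / μb z.s| ≤ e) :
    ‖direction m γ φ b π ξ ψ μ θ z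
      - direction m γ φ b π (M.meanReward π) (M.nextFeature φ π) μb θ z‖ ≤ κ.dirErr * e := by
  have : Nonempty S := ⟨z.s⟩
  have he : 0 ≤ e := (abs_nonneg _).trans hμ
  have hfeature := κ.featureBound_pos
  have hshift := κ.shift_pos
  have hB := h.residualBound_pos
  have hE := h.residualErr_pos
  have hBerr : 0 ≤ κ.shift * κ.residualBound * κ.featureBound * e := by positivity
  have hEerr : 0 ≤ κ.shift * κ.residualErr * κ.featureBound * e := by positivity
  cases m with
  | directSGD => exact h.norm_residual_smul_sub_le h0 h1 hπ hθ he hξ hψ hψ_bound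
  | tdSGD =>
    simp only [direction, ← sub_smul, ← mul_sub]
    refine (norm_smul_le_mul (norm_mul_le_of_le (h.abs_ratio_le hπ _ _)
      (abs_residual_sub_residual_le h0 h1 hθ hξ hψ))
      (norm_smul_sub_le h0 h1 (h.feature_bound z.s') (h.feature_bound z.s))).trans ?_
    rw [Constants.dirErr]
    linarith
  | td0 =>
    simp only [direction, neg_sub_neg, td_eq_inner, ← sub_smul, ← sub_mul]
    rw [abs_sub_comm] at hμ
    refine (norm_smul_le_mul (norm_mul_le_of_le (norm_mul_le_of_le hμ (h.abs_ratio_le hπ _ _))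
      (abs_add_inner_le_residualBound h0 h1 hz hθ (h.feature_bound _) (h.feature_bound _)))
      (h.feature_bound z.s)).trans ?_
    rw [Constants.dirErr]
    linarith

end Standing

end Bounds

/-! ### Estimated directions -/

section Estimates

variable {S A : Type*} [Fintype S] [DecidableEq S] [Fintype A] {R : Finset ℝ}
  {d : ℕ} {κ : Constants} {M : MDP S A R} {γ : ℝ} {b : S → A → ℝ} {μb : S → ℝ}
  {Adm : Set (S → A → ℝ)} {φ : S → EuclideanSpace ℝ (Fin d)}
  {C : Set (EuclideanSpace ℝ (Fin d))} {π : S → A → ℝ}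

omit [Fintype S] in
lemma estTrans_nonneg [DecidableEq A] (hπ : IsPolicy π) (z : ℕ → Sample S A R) (t : ℕ)
    (s s' : S) : 0 ≤ estTrans z π t s s' :=
  Finset.sum_nonneg fun a _ => mul_nonneg (hπ.nonneg s a) (div_nonneg
    (Finset.sum_nonneg fun l _ => by split_ifs <;> norm_num)
    (Finset.sum_nonneg fun l _ => by split_ifs <;> norm_num))

omit [Fintype S] in
lemma estTrans_le_one [DecidableEq A] (hπ : IsPolicy π) (z : ℕ → Sample S A R) (t : ℕ)
    (s s' : S) : estTrans z π t s s' ≤ 1 := by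
  have hvisits : ∀ a, 0 ≤ visits z t s a := fun a =>
    Finset.sum_nonneg fun l _ => by split_ifs <;> norm_num
  have htransitions : ∀ a, (∑ l ∈ Finset.range (t + 1),
      if (z l).s = s ∧ (z l).a = a ∧ (z l).s' = s' then (1 : ℝ) else 0) ≤ visits z t s a :=
    fun a => Finset.sum_le_sum fun l _ => by split_ifs <;> simp_all
  calc estTrans z π t s s' ≤ ∑ a, π s a * 1 := Finset.sum_le_sum fun a _ =>
        mul_le_mul_of_nonneg_left (div_le_one_of_le₀ (htransitions a) (hvisits a)) (hπ.nonneg s a)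
    _ = 1 := by simp only [mul_one, hπ.sum_one]

omit [Fintype S] in
lemma estRew_eq_zero [DecidableEq A] {z : ℕ → Sample S A R} {t : ℕ} {r : R}
    (hr : ∀ l ≤ t, (z l).r ≠ r) (π : S → A → ℝ) (s : S) : estRew z π t s r = 0 := by
  refine Finset.sum_eq_zero fun a _ => ?_
  rw [Finset.sum_eq_zero, zero_div, mul_zero]
  exact fun l hl => if_neg fun hmatch => hr l (Finset.mem_range_succ_iff.1 hl) hmatch.2.2

omit [DecidableEq S] in
lemma MDP.meanReward_eq_sum_mul (M : MDP S A R) (π : S → A → ℝ) (s : S) :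
    M.meanReward π s = ∑ r : R, (r : ℝ) * ∑ a, π s a * M.rew s a r := by
  rw [MDP.meanReward, Finset.sum_comm]
  simp_rw [Finset.mul_sum, mul_comm (Subtype.val _)]

namespace Standing

lemma norm_sum_smul_feature_le (h : Standing κ M γ b μb Adm φ C) (hπ : π ∈ Adm) {q : S → ℝ}
    {e : ℝ} (he : 0 ≤ e) (hq : ∀ s, |q s| ≤ e) :
    ‖∑ s, q s • φ s‖ ≤ κ.shift * κ.featureBound * e :=
  calc ‖∑ s, q s • φ s‖ ≤ ∑ _s : S, e * κ.featureBound :=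
        norm_sum_le_of_le _ fun s _ => norm_smul_le_mul (hq s) (h.feature_bound s)
    _ = Fintype.card S * (e * κ.featureBound) := by simp
    _ ≤ κ.shift * (e * κ.featureBound) :=
        mul_le_mul_of_nonneg_right (h.card_le_shift hπ) (mul_nonneg he κ.featureBound_pos.le)
    _ = κ.shift * κ.featureBound * e := by ring

variable [DecidableEq A]

lemma abs_sum_estRew_sub_le (h : Standing κ M γ b μb Adm φ C)
    {z : ℕ → Sample S A R} {t : ℕ} (hz : ∀ l ≤ t, |((z l).r : ℝ)| < κ.rewardBound) {s : S} {e : ℝ}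
    (he : 0 ≤ e) (hr : ∀ r : R, |estRew z π t s r - ∑ a, π s a * M.rew s a r| ≤ e) :
    |∑ r : R, (r : ℝ) * estRew z π t s r - M.meanReward π s|
      ≤ κ.rewardCard * κ.rewardBound * e := by
  have hbound : 0 ≤ κ.rewardBound * e :=
    mul_nonneg ((abs_nonneg _).trans (hz t le_rfl).le) he
  have hterm : ∀ r : R, |(r : ℝ) * estRew z π t s r - (r : ℝ) * ∑ a, π s a * M.rew s a r|
      ≤ κ.rewardBound * e := fun r => by
    by_cases hrb : |(r : ℝ)| < κ.rewardBound
    · rw [← mul_sub, abs_mul]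
      exact mul_le_mul hrb.le (hr r) (abs_nonneg _) ((abs_nonneg _).trans hrb.le)
    · have hexact : ∑ a, π s a * M.rew s a r = 0 := Finset.sum_eq_zero fun a _ => by
        rw [le_antisymm (not_lt.1 fun hpos => hrb (h.reward_bound s a r hpos)) (M.rew_nonneg s a r),
          mul_zero]
      have hest : estRew z π t s r = 0 :=
        estRew_eq_zero (fun l hl hlr => hrb (by rw [← hlr]; exact hz l hl)) π s
      rwa [hest, hexact, sub_self, abs_zero]
  rw [M.meanReward_eq_sum_mul, ← Finset.sum_sub_distrib]
  calc _ ≤ ∑ _r : R, κ.rewardBound * e :=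
        (Finset.abs_sum_le_sum_abs _ _).trans (Finset.sum_le_sum fun r _ => hterm r)
    _ = R.card * (κ.rewardBound * e) := by simp
    _ ≤ κ.rewardCard * (κ.rewardBound * e) :=
        mul_le_mul_of_nonneg_right (Nat.cast_le.2 h.reward_card) hbound
    _ = κ.rewardCard * κ.rewardBound * e := (mul_assoc _ _ _).symm

lemma norm_estDirection_sub_le (h : Standing κ M γ b μb Adm φ C)
    (h0 : 0 ≤ γ) (h1 : γ ≤ 1) (hπ : π ∈ Adm) (m : Method) {θ : EuclideanSpace ℝ (Fin d)}
    (hθ : ‖θ‖ ≤ κ.radius) {z : ℕ → Sample S A R} {t : ℕ}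
    (hz : ∀ l ≤ t, |((z l).r : ℝ)| < κ.rewardBound) {e : ℝ}
    (hT : ∀ s', |estTrans z π t (z t).s s' - M.trans π (z t).s s'| ≤ e)
    (hR : ∀ r : R, |estRew z π t (z t).s r - ∑ a, π (z t).s a * M.rew (z t).s a r| ≤ e)
    (hμ : |1 / estStat z t (z t).s - 1 / μb (z t).s| ≤ e) :
    ‖estDirection m γ φ b π z t θ
      - direction m γ φ b π (M.meanReward π) (M.nextFeature φ π) μb θ (z t)‖ ≤ κ.dirErr * e := by
  have hp := h.admissible π hπ
  have he : 0 ≤ e := (abs_nonneg _).trans hμ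
  refine h.norm_direction_sub_exact_le h0 h1 hπ m hθ (hz t le_rfl).le
    (h.abs_sum_estRew_sub_le hz he hR) ?_ ?_ hμ
  · simp only [MDP.nextFeature, ← Finset.sum_sub_distrib, ← sub_smul]
    exact h.norm_sum_smul_feature_le hπ he hT
  · simpa using h.norm_sum_smul_feature_le hπ zero_le_one fun s' => by
      rw [abs_of_nonneg (estTrans_nonneg hp z t (z t).s s')]
      exact estTrans_le_one hp z t (z t).s s'

end Standing

end Estimates

/-! ### The drift towards a solution and its Markovian noise -/

section Averages

variable {S A : Type*} [Fintype S] [Fintype A] {R : Finset ℝ} (M : MDP S A R) (b : S → A → ℝ)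

/-- The conditional mean of `F(z)` given the state, when the action is drawn from `b`. -/
def MDP.condMean (F : Sample S A R → ℝ) (s : S) : ℝ :=
  ∑ a, ∑ r : R, ∑ s', (b s a * M.rew s a r * M.P s a s') * F ⟨s, a, r, s'⟩

/-- The mean of `F(z)` when the state has law `μ` and the action is drawn from `b`. -/
def MDP.stateMean (μ : S → ℝ) (F : Sample S A R → ℝ) : ℝ := ∑ s, μ s * M.condMean b F s

variable {b}

lemma MDP.condMean_const (hb : IsPolicy b) (x : ℝ) (s : S) : M.condMean b (fun _ => x) s = x := by
  simp_rw [MDP.condMean, ← Finset.sum_mul, ← Finset.mul_sum, M.P_sum, mul_one, ← Finset.mul_sum,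
    M.rew_sum, mul_one, hb.sum_one, one_mul]

lemma MDP.abs_condMean_le (hb : IsPolicy b) {F : Sample S A R → ℝ} {L : ℝ} {s : S}
    (hF : ∀ a r s', 0 < M.rew s a r → |F ⟨s, a, r, s'⟩| ≤ L) : |M.condMean b F s| ≤ L := by
  have hterm : ∀ a r s', |(b s a * M.rew s a r * M.P s a s') * F ⟨s, a, r, s'⟩|
      ≤ (b s a * M.rew s a r * M.P s a s') * L := fun a r s' => by
    have hweight : 0 ≤ b s a * M.rew s a r * M.P s a s' :=
      mul_nonneg (mul_nonneg (hb.nonneg s a) (M.rew_nonneg s a r)) (M.P_nonneg s a s')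
    rw [abs_mul, abs_of_nonneg hweight]
    rcases (M.rew_nonneg s a r).eq_or_lt' with hzero | hpos
    · simp [hzero]
    · exact mul_le_mul_of_nonneg_left (hF a r s' hpos) hweight
  rw [← M.condMean_const hb L s, MDP.condMean, MDP.condMean]
  exact (Finset.abs_sum_le_sum_abs _ _).trans <| Finset.sum_le_sum fun a _ =>
    (Finset.abs_sum_le_sum_abs _ _).trans <| Finset.sum_le_sum fun r _ =>
      (Finset.abs_sum_le_sum_abs _ _).trans <| Finset.sum_le_sum fun s' _ => hterm a r s'

lemma MDP.stateMean_sub (μ : S → ℝ) (F G : Sample S A R → ℝ) :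
    M.stateMean b μ (fun z => F z - G z) = M.stateMean b μ F - M.stateMean b μ G := by
  simp_rw [MDP.stateMean, MDP.condMean, mul_sub, Finset.sum_sub_distrib, mul_sub,
    Finset.sum_sub_distrib]

lemma MDP.stateMean_const (hb : IsPolicy b) {μ : S → ℝ} (hμ : ∑ s, μ s = 1) (x : ℝ) :
    M.stateMean b μ (fun _ => x) = x := by
  simp_rw [MDP.stateMean, M.condMean_const hb, ← Finset.sum_mul, hμ, one_mul]

lemma MDP.abs_stateMean_le (hb : IsPolicy b) {μ : S → ℝ} (hμ0 : ∀ s, 0 ≤ μ s) (hμ : ∑ s, μ s = 1)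
    {F : Sample S A R → ℝ} {L : ℝ} (hF : ∀ z, 0 < M.rew z.s z.a z.r → |F z| ≤ L) :
    |M.stateMean b μ F| ≤ L :=
  calc |M.stateMean b μ F| ≤ ∑ s, |μ s * M.condMean b F s| := Finset.abs_sum_le_sum_abs _ _
    _ ≤ ∑ s, μ s * L := Finset.sum_le_sum fun s _ => by
        rw [abs_mul, abs_of_nonneg (hμ0 s)]
        exact mul_le_mul_of_nonneg_left (M.abs_condMean_le hb fun a r s' h => hF _ h) (hμ0 s)
    _ = L := by rw [← Finset.sum_mul, hμ, one_mul]

end Averages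

section Pairing

variable {S A : Type*} [Fintype S] [Fintype A] {R : Finset ℝ} {d : ℕ} {M : MDP S A R} {γ : ℝ}
  {b : S → A → ℝ} {μb : S → ℝ} {φ : S → EuclideanSpace ℝ (Fin d)} {π : S → A → ℝ}

/-- The inner product of `θ - θ*` with the exact direction at `θ`. It is expressed through the
values `v = V_{θ*}`, which for a random policy depend measurably on the policy, whereas `θ*` is
merely chosen. -/
def MDP.pairing (M : MDP S A R) (m : Method) (γ : ℝ) (φ : S → EuclideanSpace ℝ (Fin d))
    (b : S → A → ℝ) (μ : S → ℝ) (π : S → A → ℝ) (v : S → ℝ) (θ : EuclideanSpace ℝ (Fin d))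
    (z : Sample S A R) : ℝ :=
  match m with
  | .directSGD => residual γ φ (M.meanReward π) (M.nextFeature φ π) θ z.s *
      (γ * ∑ s', M.trans π z.s s' * (linValue φ θ s' - v s') - (linValue φ θ z.s - v z.s))
  | .tdSGD => (π z.s z.a / b z.s z.a *
      residual γ φ (M.meanReward π) (M.nextFeature φ π) θ z.s) *
      (γ * (linValue φ θ z.s' - v z.s') - (linValue φ θ z.s - v z.s))
  | .td0 => -((1 / μ z.s * (π z.s z.a / b z.s z.a) *
      ((z.r : ℝ) + γ * linValue φ θ z.s' - linValue φ θ z.s)) * (linValue φ θ z.s - v z.s))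

/-- The pairing centered at its stationary mean, which is the noise due to the Markovian sampling
of the directions. -/
def MDP.noise (M : MDP S A R) (m : Method) (γ : ℝ) (φ : S → EuclideanSpace ℝ (Fin d))
    (b : S → A → ℝ) (μ : S → ℝ) (π : S → A → ℝ) (v : S → ℝ) (θ : EuclideanSpace ℝ (Fin d))
    (z : Sample S A R) : ℝ :=
  M.pairing m γ φ b μ π v θ z - M.stateMean b μ (M.pairing m γ φ b μ π v θ)

omit [Fintype S] in
lemma inner_sub_feature (θ θs : EuclideanSpace ℝ (Fin d)) (s : S) :
    inner ℝ (θ - θs) (φ s) = linValue φ θ s - linValue φ θs s := by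
  rw [real_inner_comm, inner_sub_right, linValue, linValue]

lemma MDP.inner_sub_nextFeature (M : MDP S A R) (θ θs : EuclideanSpace ℝ (Fin d)) (s : S) :
    inner ℝ (θ - θs) (M.nextFeature φ π s)
      = ∑ s', M.trans π s s' * (linValue φ θ s' - linValue φ θs s') := by
  simp_rw [MDP.nextFeature, inner_sum, inner_smul_right, inner_sub_feature]

lemma MDP.inner_direction_eq_pairing (M : MDP S A R) (m : Method)
    (θ θs : EuclideanSpace ℝ (Fin d)) (z : Sample S A R) :
    inner ℝ (θ - θs) (direction m γ φ b π (M.meanReward π) (M.nextFeature φ π) μb θ z)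
      = M.pairing m γ φ b μb π (linValue φ θs) θ z := by
  cases m <;> simp only [direction, MDP.pairing, inner_neg_right, inner_smul_right,
    inner_sub_right (𝕜 := ℝ) (θ - θs), M.inner_sub_nextFeature, inner_sub_feature]

lemma MDP.inner_meanDirection_eq_stateMean (M : MDP S A R) (m : Method)
    (θ θs : EuclideanSpace ℝ (Fin d)) :
    inner ℝ (θ - θs) (M.meanDirection m γ φ b μb π θ)
      = M.stateMean b μb (M.pairing m γ φ b μb π (linValue φ θs) θ) := by
  simp_rw [MDP.meanDirection, MDP.stateMean, MDP.condMean, inner_sum, inner_smul_right,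
    M.inner_direction_eq_pairing, Finset.mul_sum]
  refine Finset.sum_congr rfl fun s _ => Finset.sum_congr rfl fun a _ =>
    Finset.sum_congr rfl fun r _ => Finset.sum_congr rfl fun s' _ => by ring

lemma MDP.residual_eq_bellman_sub (M : MDP S A R) (θ : EuclideanSpace ℝ (Fin d)) (s : S) :
    residual γ φ (M.meanReward π) (M.nextFeature φ π) θ s
      = M.bellman γ π (linValue φ θ) s - linValue φ θ s := by
  simp only [residual, MDP.bellman, MDP.nextFeature, linValue, inner_sub_left,
    real_inner_smul_left, sum_inner]
  ring

lemma MDP.SolvesBellman.residual_eq {θs : EuclideanSpace ℝ (Fin d)}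
    (hs : M.SolvesBellman γ φ π θs) (θ : EuclideanSpace ℝ (Fin d)) (s : S) :
    residual γ φ (M.meanReward π) (M.nextFeature φ π) θ s
      = γ * ∑ s', M.trans π s s' * (linValue φ θ s' - linValue φ θs s')
        - (linValue φ θ s - linValue φ θs s) := by
  have hdiff := M.bellman_sub γ π (linValue φ θ) (linValue φ θs) s
  rw [← hs s] at hdiff
  rw [M.residual_eq_bellman_sub]
  change _ = γ * (M.trans π *ᵥ (linValue φ θ - linValue φ θs)) s - _
  linarith

variable [DecidableEq S] {κ : Constants} {Adm : Set (S → A → ℝ)}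
  {C : Set (EuclideanSpace ℝ (Fin d))}

namespace Standing

lemma condMean_ratio_mul (h : Standing κ M γ b μb Adm φ C) (hπ : π ∈ Adm) (f : S → S → ℝ)
    (s : S) : M.condMean b (fun z => π z.s z.a / b z.s z.a * f z.s z.s') s
      = ∑ s', M.trans π s s' * f s s' := by
  have hweight : ∀ a (r : R) s', b s a * M.rew s a r * M.P s a s' * (π s a / b s a * f s s')
      = M.rew s a r * (π s a * M.P s a s' * f s s') := fun a r s' => by
    linear_combination M.rew s a r * M.P s a s' * f s s' * h.mul_ratio hπ s a
  simp only [MDP.condMean, hweight, ← Finset.mul_sum, ← Finset.sum_mul, M.rew_sum, one_mul]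
  simp only [MDP.trans, Matrix.of_apply, Finset.sum_mul]
  exact Finset.sum_comm

lemma stateMean_pairing_eq (h : Standing κ M γ b μb Adm φ C) (hπ : π ∈ Adm)
    {m : Method} (hm : m.IsSGD) {θs : EuclideanSpace ℝ (Fin d)} (hs : M.SolvesBellman γ φ π θs)
    (θ : EuclideanSpace ℝ (Fin d)) :
    M.stateMean b μb (M.pairing m γ φ b μb π (linValue φ θs) θ) = 2 * M.loss γ φ μb π θ := by
  set δ := residual γ φ (M.meanReward π) (M.nextFeature φ π) θ
  suffices hcond : ∀ s, M.condMean b (M.pairing m γ φ b μb π (linValue φ θs) θ) s = δ s ^ 2 by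
    rw [MDP.loss, Finset.mul_sum, MDP.stateMean]
    exact Finset.sum_congr rfl fun s _ => by rw [hcond]; ring
  intro s
  cases m with
  | td0 => exact hm.elim
  | directSGD =>
    rw [← M.condMean_const h.behavior (δ s ^ 2) s]
    simp only [MDP.condMean, MDP.pairing, ← hs.residual_eq, sq, δ]
  | tdSGD =>
    set w := fun x => linValue φ θ x - linValue φ θs x
    have hratio : M.condMean b (M.pairing .tdSGD γ φ b μb π (linValue φ θs) θ) s
        = M.condMean b (fun z => π z.s z.a / b z.s z.a * (δ z.s * (γ * w z.s' - w z.s))) s := by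
      simp only [MDP.condMean, MDP.pairing, mul_assoc, δ, w]
    have hsum := (Matrix.mem_rowStochastic_iff_sum.1
      ((h.admissible π hπ).trans_mem_rowStochastic M)).2 s
    rw [hratio, h.condMean_ratio_mul hπ fun x y => δ x * (γ * w y - w x)]
    simp_rw [mul_left_comm _ (δ s), ← Finset.mul_sum, mul_sub, Finset.sum_sub_distrib,
      ← Finset.sum_mul, hsum, one_mul, mul_left_comm _ γ, ← Finset.mul_sum]
    rw [sq]
    exact congrArg (δ s * ·) (hs.residual_eq θ s).symm

lemma norm_sub_le_two_mul (h : Standing κ M γ b μb Adm φ C)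
    {θ θs : EuclideanSpace ℝ (Fin d)} (hθ : θ ∈ C) (hs : θs ∈ C) : ‖θ - θs‖ ≤ 2 * κ.radius := by
  linarith [norm_sub_le θ θs, h.bounded θ hθ, h.bounded θs hs]

end Standing

/-- Lipschitz constant of the pairing in the parameter. -/
def Constants.pairingLip (κ : Constants) : ℝ := κ.dirBound + 2 * κ.radius * κ.dirLip

namespace Standing

variable (h : Standing κ M γ b μb Adm φ C) (h0 : 0 ≤ γ) (h1 : γ ≤ 1) (hπ : π ∈ Adm) (m : Method)
  {θ θ' θs : EuclideanSpace ℝ (Fin d)} (hs : θs ∈ C) (hθ : θ ∈ C) (hθ' : θ' ∈ C)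
  {z : Sample S A R} (hz : |(z.r : ℝ)| ≤ κ.rewardBound)

lemma stateMean_noise (h : Standing κ M γ b μb Adm φ C) (m : Method)
    (π : S → A → ℝ) (v : S → ℝ) (θ : EuclideanSpace ℝ (Fin d)) :
    M.stateMean b μb (M.noise m γ φ b μb π v θ) = 0 := by
  unfold MDP.noise
  rw [M.stateMean_sub, M.stateMean_const h.behavior h.stationary.sum_one, sub_self]

include h h0 h1 hπ hs hθ hz

lemma abs_pairing_le :
    |M.pairing m γ φ b μb π (linValue φ θs) θ z| ≤ 2 * κ.radius * κ.dirBound := by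
  rw [← M.inner_direction_eq_pairing m]
  exact abs_inner_le_mul (h.norm_sub_le_two_mul hθ hs)
    (h.norm_direction_le h0 h1 hπ m (h.bounded θ hθ) hz)

lemma abs_noise_le :
    |M.noise m γ φ b μb π (linValue φ θs) θ z| ≤ 4 * κ.radius * κ.dirBound := by
  have hpairing := h.abs_pairing_le h0 h1 hπ m hs hθ hz
  have hmean := M.abs_stateMean_le h.behavior h.stationary.nonneg h.stationary.sum_one
    (F := M.pairing m γ φ b μb π (linValue φ θs) θ) fun z hz =>
      h.abs_pairing_le h0 h1 hπ m hs hθ (h.reward_bound _ _ _ hz).le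
  exact (abs_sub _ _).trans (by linarith)

include hθ'

lemma abs_pairing_sub_le :
    |M.pairing m γ φ b μb π (linValue φ θs) θ z - M.pairing m γ φ b μb π (linValue φ θs) θ' z|
      ≤ κ.pairingLip * ‖θ - θ'‖ := by
  rw [← M.inner_direction_eq_pairing m, ← M.inner_direction_eq_pairing m]
  set g := direction m γ φ b π (M.meanReward π) (M.nextFeature φ π) μb θ z
  set g' := direction m γ φ b π (M.meanReward π) (M.nextFeature φ π) μb θ' z
  have hsplit : inner ℝ (θ - θs) g - inner ℝ (θ' - θs) g'
      = inner ℝ (θ - θ') g + inner ℝ (θ' - θs) (g - g') := by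
    simp only [inner_sub_left, inner_sub_right]; ring
  rw [hsplit]
  refine (abs_add_le _ _).trans ((add_le_add
    (abs_inner_le_mul le_rfl (h.norm_direction_le h0 h1 hπ m (h.bounded θ hθ) hz))
    (abs_inner_le_mul (h.norm_sub_le_two_mul hθ' hs)
      (h.norm_direction_sub_le h0 h1 hπ m z))).trans_eq ?_)
  rw [Constants.pairingLip]; ring

lemma abs_noise_sub_le :
    |M.noise m γ φ b μb π (linValue φ θs) θ z - M.noise m γ φ b μb π (linValue φ θs) θ' z|
      ≤ 2 * κ.pairingLip * ‖θ - θ'‖ := by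
  have hpairing := h.abs_pairing_sub_le h0 h1 hπ m hs hθ hθ' hz
  have hmean := M.abs_stateMean_le h.behavior h.stationary.nonneg h.stationary.sum_one
    (F := fun z => M.pairing m γ φ b μb π (linValue φ θs) θ z
      - M.pairing m γ φ b μb π (linValue φ θs) θ' z) fun z hz =>
      h.abs_pairing_sub_le h0 h1 hπ m hs hθ hθ' (h.reward_bound _ _ _ hz).le
  rw [M.stateMean_sub] at hmean
  rw [MDP.noise, MDP.noise, sub_sub_sub_comm]
  exact (abs_sub _ _).trans (by linarith)

end Standing

end Pairing

/-! ### Laws of the data -/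

section Samples

variable {S A : Type*} {R : Finset ℝ}

/-- A sample as a tuple, which makes the space of samples a finite type. -/
def Sample.equivProd : Sample S A R ≃ S × A × R × S where
  toFun z := (z.s, z.a, z.r, z.s')
  invFun p := ⟨p.1, p.2.1, p.2.2.1, p.2.2.2⟩
  left_inv _ := rfl
  right_inv _ := rfl

instance [Fintype S] [Fintype A] : Fintype (Sample S A R) :=
  Fintype.ofEquiv _ Sample.equivProd.symm

instance : MeasurableSpace (Sample S A R) := ⊤

instance : DiscreteMeasurableSpace (Sample S A R) := ⟨fun _ => trivial⟩

variable [Fintype S] [Fintype A]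

lemma Sample.sum_eq (F : Sample S A R → ℝ) :
    ∑ z, F z = ∑ s, ∑ a, ∑ r : R, ∑ s', F ⟨s, a, r, s'⟩ := by
  rw [← Equiv.sum_comp Sample.equivProd.symm F]
  simp_rw [Fintype.sum_prod_type]
  rfl

variable (M : MDP S A R) {b : S → A → ℝ}

lemma MDP.condMean_eq_sum [DecidableEq S] (F : Sample S A R → ℝ) (s : S) :
    M.condMean b F s = ∑ z : Sample S A R,
      F z * (if s = z.s then b z.s z.a * M.rew z.s z.a z.r * M.P z.s z.a z.s' else 0) := by
  rw [Sample.sum_eq, Finset.sum_eq_single s, MDP.condMean]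
  · simp only [↓reduceIte, mul_comm]
  · intro x _ hx
    simp only [hx.symm, ↓reduceIte, mul_zero, Finset.sum_const_zero]
  · simp only [Finset.mem_univ, not_true_eq_false, IsEmpty.forall_iff]

lemma MDP.condMean_congr {F G : Sample S A R → ℝ} {s : S}
    (h : ∀ a r s', 0 < M.rew s a r → F ⟨s, a, r, s'⟩ = G ⟨s, a, r, s'⟩) :
    M.condMean b F s = M.condMean b G s := by
  refine Finset.sum_congr rfl fun a _ => Finset.sum_congr rfl fun r _ =>
    Finset.sum_congr rfl fun s' _ => ?_
  rcases (M.rew_nonneg s a r).eq_or_lt' with hzero | hpos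
  · simp only [hzero, mul_zero, zero_mul]
  · rw [h a r s' hpos]

lemma MDP.condMean_nextState (g : S → ℝ) (s : S) :
    M.condMean b (fun z => g z.s') s = (M.trans b *ᵥ g) s := by
  simp only [MDP.condMean, MDP.trans, Matrix.mulVec, dotProduct, Matrix.of_apply, Finset.sum_mul]
  rw [Finset.sum_comm (s := (Finset.univ : Finset S))]
  refine Finset.sum_congr rfl fun a _ => ?_
  rw [Finset.sum_comm]
  refine Finset.sum_congr rfl fun s' _ => ?_
  simp_rw [← Finset.sum_mul, ← Finset.mul_sum, M.rew_sum, mul_one]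

end Samples

section Data

lemma integral_mul_indicator_eq_of_condExp_eq {Ω : Type*} {m mΩ : MeasurableSpace Ω}
    {ρ : Measure Ω} [IsFiniteMeasure ρ] (hm : m ≤ mΩ) {f w : Ω → ℝ} {L : ℝ}
    (hf : Measurable[m] f) (hL : ∀ᵐ ω ∂ρ, |f ω| ≤ L) {E : Set Ω} (hE : MeasurableSet E)
    (hw : ρ⟦E | m⟧ =ᵐ[ρ] w) :
    ∫ ω, f ω * E.indicator (fun _ => (1 : ℝ)) ω ∂ρ = ∫ ω, f ω * w ω ∂ρ := by
  have hindicator : Integrable (E.indicator fun _ => (1 : ℝ)) ρ :=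
    (integrable_const (1 : ℝ)).indicator hE
  have hproduct : Integrable (f * E.indicator fun _ => (1 : ℝ)) ρ :=
    hindicator.bdd_mul (c := L) (hf.mono hm le_rfl).aestronglyMeasurable hL
  calc ∫ ω, f ω * E.indicator (fun _ => (1 : ℝ)) ω ∂ρ
      = ∫ ω, (ρ[f * E.indicator fun _ => (1 : ℝ)|m]) ω ∂ρ := (integral_condExp hm).symm
    _ = ∫ ω, f ω * w ω ∂ρ := by
        refine integral_congr_ae ?_
        filter_upwards
          [condExp_mul_of_stronglyMeasurable_left hf.stronglyMeasurable hproduct hindicator, hw]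
          with ω hpull hlaw
        rw [hpull, Pi.mul_apply, hlaw]

variable {S A : Type*} [Fintype S] [DecidableEq S] [Fintype A] {R : Finset ℝ}
  {Ω : Type*} {mΩ : MeasurableSpace Ω} {ρ : Measure Ω}
  {M : MDP S A R} {b : S → A → ℝ} {T K : ℕ} {ℱ : Filtration ℕ mΩ}
  {z : ℕ → Ω → Sample S A R}

/-- The filtration `ℱ` started at time `n`, which carries the data from the sample `n` on. -/
def shiftFiltration (ℱ : Filtration ℕ mΩ) (n : ℕ) : Filtration ℕ mΩ where
  seq t := ℱ (n + t)
  mono' _ _ h := ℱ.mono (Nat.add_le_add_left h n)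
  le' _ := ℱ.le _

namespace IsOfflineData

omit [Fintype A] in
lemma measurable_sample [Finite A] (h : IsOfflineData M b T K ρ ℱ z) {n : ℕ}
    (hn : n < K * (T + 1)) :
    Measurable[ℱ (n + 1)] (z n) :=
  have := Finite.of_equiv _ (Sample.equivProd (S := S) (A := A) (R := R)).symm
  @measurable_to_countable' _ _ _ _ (ℱ (n + 1)) _ fun y => h.sample_adapted n hn y

omit [Fintype A] in
lemma batch (h : IsOfflineData M b T K ρ ℱ z) {k : ℕ} (hk : k < K) :
    IsOfflineData M b T 1 ρ (shiftFiltration ℱ (k * (T + 1)))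
      (fun t ω => OfflineRL.batch z T k ω t) := by
  have hlt : ∀ n < 1 * (T + 1), k * (T + 1) + n < K * (T + 1) := fun n hn => by nlinarith
  refine ⟨fun n hn x => h.state_adapted _ (hlt n hn) x,
    fun n hn y => h.sample_adapted _ (hlt n hn) y,
    fun n hn x a r y => h.law _ (hlt n hn) x a r y,
    fun n hn hdvd => h.continues _ (hlt (n + 1) hn) ?_⟩
  rwa [Nat.add_eq, add_assoc, Nat.dvd_add_right (Dvd.intro_left k rfl)]

variable [IsProbabilityMeasure ρ]

lemma integral_eq_integral_condMean (h : IsOfflineData M b T K ρ ℱ z) {n : ℕ}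
    (hn : n < K * (T + 1)) {F : Ω → Sample S A R → ℝ} (hF : ∀ y, Measurable[ℱ n] fun ω => F ω y)
    {L : ℝ} (hL : ∀ᵐ ω ∂ρ, ∀ y, |F ω y| ≤ L) :
    ∫ ω, F ω (z n ω) ∂ρ = ∫ ω, M.condMean b (F ω) (z n ω).s ∂ρ := by
  have hmeas : ∀ y, Measurable fun ω => F ω y := fun y => (hF y).mono (ℱ.le n) le_rfl
  have hset : ∀ y, MeasurableSet {ω | z n ω = y} := fun y =>
    ℱ.le _ _ (h.sample_adapted n hn y)
  have hbound : ∀ y, ∀ᵐ ω ∂ρ, |F ω y| ≤ L := fun y => hL.mono fun ω hω => hω y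
  have hsplit : ∀ ω, F ω (z n ω)
      = ∑ y, F ω y * {ω | z n ω = y}.indicator (fun _ => (1 : ℝ)) ω := fun ω => by
    classical
    simp [Set.indicator_apply]
  have hintegrable : ∀ y,
      Integrable (fun ω => F ω y * {ω | z n ω = y}.indicator (fun _ => (1 : ℝ)) ω) ρ :=
    fun y => ((integrable_const (1 : ℝ)).indicator (hset y)).bdd_mul (c := L)
      (hmeas y).aestronglyMeasurable (hbound y)
  have hintegrable_law : ∀ y : Sample S A R, Integrable (fun ω => F ω y *
      (if (z n ω).s = y.s then b y.s y.a * M.rew y.s y.a y.r * M.P y.s y.a y.s' else 0)) ρ := by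
    intro y
    have hlaw := (integrable_const (μ := ρ) (b y.s y.a * M.rew y.s y.a y.r * M.P y.s y.a y.s')
      ).indicator (ℱ.le n _ (h.state_adapted n hn y.s))
    refine (hlaw.congr (ae_of_all _ fun ω => ?_)).bdd_mul (c := L) (hmeas y).aestronglyMeasurable
      (hbound y)
    simp only [Set.indicator_apply, Set.mem_ofPred_eq]
  simp_rw [hsplit, M.condMean_eq_sum]
  rw [integral_finsetSum _ fun y _ => hintegrable y,
    integral_finsetSum _ fun y _ => hintegrable_law y]
  exact Finset.sum_congr rfl fun y _ => integral_mul_indicator_eq_of_condExp_eq (ℱ.le n) (hF y)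
    (hbound y) (hset y) (h.law n hn y.s y.a y.r y.s')

omit [Fintype A] in
lemma ae_rew_pos [Finite A] (h : IsOfflineData M b T K ρ ℱ z) {n : ℕ} (hn : n < K * (T + 1)) :
    ∀ᵐ ω ∂ρ, 0 < M.rew (z n ω).s (z n ω).a (z n ω).r := by
  classical
  cases nonempty_fintype A
  let impossible (y : Sample S A R) : ℝ := if 0 < M.rew y.s y.a y.r then 0 else 1
  have hnonneg : ∀ y, 0 ≤ impossible y := fun y => by
    dsimp only [impossible]; split_ifs <;> norm_num
  have hle : ∀ y, |impossible y| ≤ 1 := fun y => by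
    dsimp only [impossible]; split_ifs <;> norm_num
  have hmean : ∀ s, M.condMean b impossible s = 0 := fun s => by
    rw [M.condMean_congr (G := fun _ => 0) fun a r s' hpos => if_pos hpos]
    simp only [MDP.condMean, mul_zero, Finset.sum_const_zero]
  have hmeas : Measurable fun ω => impossible (z n ω) :=
    (measurable_of_countable impossible).comp ((h.measurable_sample hn).mono (ℱ.le _) le_rfl)
  have hzero : ∫ ω, impossible (z n ω) ∂ρ = 0 := by
    rw [h.integral_eq_integral_condMean hn (F := fun _ => impossible) (fun _ => measurable_const)
      (ae_of_all _ fun _ => hle)]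
    simp only [hmean, integral_zero]
  rw [integral_eq_zero_iff_of_nonneg (fun ω => hnonneg _)
    (.of_bound hmeas.aestronglyMeasurable 1 (ae_of_all _ fun ω => hle _))] at hzero
  filter_upwards [hzero] with ω hω
  by_contra hcontra
  simp [impossible, hcontra] at hω

lemma integral_eq_integral_condMean_of_rew_pos (h : IsOfflineData M b T K ρ ℱ z) {n : ℕ}
    (hn : n < K * (T + 1)) {F : Ω → Sample S A R → ℝ} (hF : ∀ y, Measurable[ℱ n] fun ω => F ω y)
    {L : ℝ} (hL : ∀ᵐ ω ∂ρ, ∀ y, 0 < M.rew y.s y.a y.r → |F ω y| ≤ L) :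
    ∫ ω, F ω (z n ω) ∂ρ = ∫ ω, M.condMean b (F ω) (z n ω).s ∂ρ := by
  classical
  let G (ω : Ω) (y : Sample S A R) : ℝ := if 0 < M.rew y.s y.a y.r then F ω y else 0
  have hG : ∀ y, Measurable[ℱ n] fun ω => G ω y := fun y => by
    dsimp only [G]
    split_ifs
    exacts [hF y, measurable_const]
  have hGL : ∀ᵐ ω ∂ρ, ∀ y, |G ω y| ≤ L := by
    filter_upwards [hL, h.ae_rew_pos hn] with ω hbound hpos y
    dsimp only [G]
    split_ifs with hy
    · exact hbound y hy
    · exact abs_zero.trans_le ((abs_nonneg _).trans (hbound _ hpos))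
  calc ∫ ω, F ω (z n ω) ∂ρ = ∫ ω, G ω (z n ω) ∂ρ := by
        refine integral_congr_ae ?_
        filter_upwards [h.ae_rew_pos hn] with ω hω using (if_pos hω).symm
    _ = ∫ ω, M.condMean b (G ω) (z n ω).s ∂ρ := h.integral_eq_integral_condMean hn hG hGL
    _ = ∫ ω, M.condMean b (F ω) (z n ω).s ∂ρ := by
        congr with ω
        exact M.condMean_congr fun a r s' hpos => if_pos hpos

lemma integral_state_add (hb : IsPolicy b) (h : IsOfflineData M b T 1 ρ ℱ z) {j : ℕ} (i : ℕ)
    (hi : j + i ≤ T) {G : Ω → S → ℝ} (hG : ∀ x, Measurable[ℱ j] fun ω => G ω x) {L : ℝ}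
    (hL : ∀ᵐ ω ∂ρ, ∀ x, |G ω x| ≤ L) :
    ∫ ω, G ω (z (j + i) ω).s ∂ρ = ∫ ω, (M.trans b ^ i *ᵥ G ω) (z j ω).s ∂ρ := by
  induction i generalizing G with
  | zero => simp only [pow_zero, Matrix.one_mulVec, add_zero]
  | succ i ih =>
    have hcontinue : ∀ᵐ ω ∂ρ, (z (j + i + 1) ω).s = (z (j + i) ω).s' :=
      h.continues (j + i) (by omega) (Nat.not_dvd_of_pos_of_lt (by omega) (by omega))
    have hmeas : ∀ x, Measurable[ℱ j] fun ω => (M.trans b *ᵥ G ω) x := fun x =>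
      Finset.measurable_sum _ fun y _ => (hG y).const_mul _
    calc ∫ ω, G ω (z (j + (i + 1)) ω).s ∂ρ = ∫ ω, G ω (z (j + i) ω).s' ∂ρ := by
          refine integral_congr_ae ?_
          filter_upwards [hcontinue] with ω hω
          rw [← add_assoc, hω]
      _ = ∫ ω, (M.trans b *ᵥ G ω) (z (j + i) ω).s ∂ρ := by
          rw [h.integral_eq_integral_condMean (by omega) (F := fun ω y => G ω y.s')
            (fun y => (hG y.s').mono (ℱ.mono (by omega)) le_rfl)
            (hL.mono fun ω hω y => hω y.s')]
          simp only [M.condMean_nextState]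
      _ = ∫ ω, (M.trans b ^ (i + 1) *ᵥ G ω) (z j ω).s ∂ρ := by
          rw [ih (by omega) hmeas (hL.mono fun ω hω x =>
            abs_mulVec_le_of_rowStochastic (hb.trans_mem_rowStochastic M) hω x)]
          simp only [Matrix.mulVec_mulVec, pow_succ]

lemma abs_integral_add_le_of_isMixing (hb : IsPolicy b) (h : IsOfflineData M b T 1 ρ ℱ z)
    {μ : S → ℝ} (hμ : IsStationary (M.trans b) μ) {τ : ℕ} (hmix : M.IsMixing b μ τ) {j i : ℕ}
    (hi : j + i ≤ T) {F : Ω → Sample S A R → ℝ} (hF : ∀ y, Measurable[ℱ j] fun ω => F ω y) {L : ℝ}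
    (hL : ∀ᵐ ω ∂ρ, ∀ y, 0 < M.rew y.s y.a y.r → |F ω y| ≤ L)
    (h0 : ∀ᵐ ω ∂ρ, M.stateMean b μ (F ω) = 0) :
    |∫ ω, F ω (z (j + i) ω) ∂ρ| ≤ 2 * L * (1 / 2) ^ (i / (τ + 1)) := by
  have hmeas : ∀ x, Measurable[ℱ j] fun ω => M.condMean b (F ω) x := fun x =>
    Finset.measurable_sum _ fun a _ => Finset.measurable_sum _ fun r _ =>
      Finset.measurable_sum _ fun s' _ => (hF _).const_mul _
  have hbound : ∀ᵐ ω ∂ρ, ∀ x, |M.condMean b (F ω) x| ≤ L :=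
    hL.mono fun ω hω x => M.abs_condMean_le hb fun a r s' hpos => hω _ hpos
  rw [h.integral_eq_integral_condMean_of_rew_pos (by omega)
      (fun y => (hF y).mono (ℱ.mono (by omega)) le_rfl) hL,
    h.integral_state_add hb i hi hmeas hbound]
  have hdecay := norm_integral_le_of_norm_le_const (μ := ρ)
    (f := fun ω => (M.trans b ^ i *ᵥ fun x => M.condMean b (F ω) x) (z j ω).s)
    (C := 2 * L * (1 / 2) ^ (i / (τ + 1))) (by
      filter_upwards [h0, hbound] with ω hmean hω using
        hμ.abs_pow_mulVec_le (hb.trans_mem_rowStochastic M) hmix.2 hω hmean i _)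
  simpa using hdecay

end IsOfflineData

lemma Standing.ae_reward_lt [IsProbabilityMeasure ρ] {κ : Constants} {γ : ℝ} {μb : S → ℝ}
    {Adm : Set (S → A → ℝ)} {d : ℕ} {φ : S → EuclideanSpace ℝ (Fin d)}
    {C : Set (EuclideanSpace ℝ (Fin d))} (hst : Standing κ M γ b μb Adm φ C)
    (h : IsOfflineData M b T K ρ ℱ z) :
    ∀ᵐ ω ∂ρ, ∀ n < K * (T + 1), |((z n ω).r : ℝ)| < κ.rewardBound := by
  refine ae_all_iff.2 fun n => ?_
  by_cases hn : n < K * (T + 1)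
  · filter_upwards [h.ae_rew_pos hn] with ω hω _ using hst.reward_bound _ _ _ hω
  · exact ae_of_all _ fun ω hlt => absurd hlt hn

end Data

/-! ### Measurability -/

section Measurability

variable {S A : Type*} {R : Finset ℝ} {d : ℕ} {Ω : Type*} [MeasurableSpace Ω]
  {π : Ω → S → A → ℝ} (hπ : ∀ s a, Measurable fun ω => π ω s a)
  {θ : Ω → EuclideanSpace ℝ (Fin d)} (hθ : Measurable θ)
  (m : Method) (γ : ℝ) (φ : S → EuclideanSpace ℝ (Fin d)) (b : S → A → ℝ) (μ : S → ℝ)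

include hθ in
lemma measurable_linValue (s : S) : Measurable fun ω => linValue φ (θ ω) s :=
  measurable_const.inner hθ

include hθ in
lemma measurable_residual {ξ : Ω → S → ℝ} (hξ : ∀ s, Measurable fun ω => ξ ω s)
    {ψ : Ω → S → EuclideanSpace ℝ (Fin d)} (hψ : ∀ s, Measurable fun ω => ψ ω s) (s : S) :
    Measurable fun ω => residual γ φ (ξ ω) (ψ ω) (θ ω) s :=
  (hξ s).add ((((hψ s).const_smul γ).sub_const (φ s)).inner hθ)

include hθ hπ in
lemma measurable_direction {ξ : Ω → S → ℝ} (hξ : ∀ s, Measurable fun ω => ξ ω s)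
    {ψ : Ω → S → EuclideanSpace ℝ (Fin d)} (hψ : ∀ s, Measurable fun ω => ψ ω s) {μ : Ω → S → ℝ}
    (hμ : ∀ s, Measurable fun ω => μ ω s) (y : Sample S A R) :
    Measurable fun ω => direction m γ φ b (π ω) (ξ ω) (ψ ω) (μ ω) (θ ω) y := by
  have hres := measurable_residual hθ γ φ hξ hψ y.s
  cases m with
  | directSGD => exact hres.smul (((hψ y.s).const_smul γ).sub_const (φ y.s))
  | tdSGD => exact (((hπ y.s y.a).div_const _).mul hres).smul_const _
  | td0 =>
    exact (((((hμ y.s).const_div 1).mul ((hπ y.s y.a).div_const _)).mul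
      ((((measurable_linValue hθ φ y.s').const_mul γ).const_add _).sub
        (measurable_linValue hθ φ y.s))).smul_const _).neg

section Estimators

variable [Fintype S] [DecidableEq S] [Fintype A] [DecidableEq A] {z : ℕ → Ω → Sample S A R}

omit [Fintype S] [DecidableEq S] [Fintype A] [DecidableEq A] in
lemma measurable_comp_sample [Finite S] [Finite A] {E : Type*} [MeasurableSpace E]
    {F : Ω → Sample S A R → E} (hF : ∀ y, Measurable fun ω => F ω y) {y : Ω → Sample S A R}
    (hy : Measurable y) : Measurable fun ω => F ω (y ω) := by
  have := Finite.of_equiv _ (Sample.equivProd (S := S) (A := A) (R := R)).symm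
  exact (measurable_from_prod_countable_left (f := fun p : Ω × Sample S A R => F p.1 p.2) hF).comp
    (measurable_id.prodMk hy)

omit [Fintype S] [DecidableEq S] [Fintype A] [DecidableEq A] in
lemma measurable_ite_sample {y : Ω → Sample S A R} (hy : Measurable y)
    (p : Sample S A R → Prop) [DecidablePred p] :
    Measurable fun ω => if p (y ω) then (1 : ℝ) else 0 :=
  (Measurable.of_discrete (f := fun y => if p y then (1 : ℝ) else 0)).comp hy

omit [Fintype S] [Fintype A] in
lemma measurable_visits {t : ℕ} (hz : ∀ l ≤ t, Measurable (z l)) (s : S) (a : A) :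
    Measurable fun ω => visits (fun l => z l ω) t s a :=
  Finset.measurable_sum _ fun l hl =>
    measurable_ite_sample (hz l (Finset.mem_range_succ_iff.1 hl)) fun y => y.s = s ∧ y.a = a

omit [Fintype S] [Fintype A] [DecidableEq A] in
lemma measurable_estStat {t : ℕ} (hz : ∀ l ≤ t, Measurable (z l)) (s : S) :
    Measurable fun ω => estStat (fun l => z l ω) t s :=
  (Finset.measurable_sum _ fun l hl =>
    measurable_ite_sample (hz l (Finset.mem_Icc.1 hl).2) fun y => y.s = s).const_mul _

include hπ

omit [Fintype S] in
lemma measurable_estTrans {t : ℕ} (hz : ∀ l ≤ t, Measurable (z l)) (s s' : S) :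
    Measurable fun ω => estTrans (fun l => z l ω) (π ω) t s s' :=
  Finset.measurable_sum _ fun a _ => (hπ s a).mul ((Finset.measurable_sum _ fun l hl =>
    measurable_ite_sample (hz l (Finset.mem_range_succ_iff.1 hl))
      fun y => y.s = s ∧ y.a = a ∧ y.s' = s').div (measurable_visits hz s a))

omit [Fintype S] in
lemma measurable_estRew {t : ℕ} (hz : ∀ l ≤ t, Measurable (z l)) (s : S) (r : R) :
    Measurable fun ω => estRew (fun l => z l ω) (π ω) t s r :=
  Finset.measurable_sum _ fun a _ => (hπ s a).mul ((Finset.measurable_sum _ fun l hl =>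
    measurable_ite_sample (hz l (Finset.mem_range_succ_iff.1 hl))
      fun y => y.s = s ∧ y.a = a ∧ y.r = r).div (measurable_visits hz s a))

include hθ in
lemma measurable_estDirection {t : ℕ} (hz : ∀ l ≤ t, Measurable (z l)) :
    Measurable fun ω => estDirection m γ φ b (π ω) (fun l => z l ω) t (θ ω) :=
  measurable_comp_sample (measurable_direction hπ hθ m γ φ b
    (fun s => Finset.measurable_sum _ fun r _ => (measurable_estRew hπ hz s r).const_mul _)
    (fun s => Finset.measurable_sum _ fun s' _ => (measurable_estTrans hπ hz s s').smul_const _)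
    (measurable_estStat hz)) (hz t le_rfl)

variable {C : Set (EuclideanSpace ℝ (Fin d))} (hC : IsCompact C) (hconv : Convex ℝ C)
  (η : ℕ → ℝ) {θ₀ : EuclideanSpace ℝ (Fin d)} (hθ₀ : θ₀ ∈ C)
include hC hconv hθ₀

lemma measurable_evalIterate {t : ℕ} (hz : ∀ l < t, Measurable (z l)) :
    Measurable fun ω => evalIterate m γ φ b (π ω) C η θ₀ (fun l => z l ω) t := by
  induction t using Nat.twoStepInduction with
  | zero => exact measurable_const
  | one => exact measurable_const
  | more t _ ih =>
    have hiterate := ih fun l hl => hz l (by omega)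
    have hz' : ∀ l ≤ t + 1, Measurable (z l) := fun l hl => hz l (by omega)
    exact (lipschitzWith_proj hC hconv ⟨_, hθ₀⟩).continuous.measurable.comp
      (hiterate.sub ((measurable_estDirection hπ hiterate m γ φ b hz').const_smul (η (t + 1))))

end Estimators

variable [Fintype S] [Fintype A] (M : MDP S A R)

lemma MDP.measurable_stateMean {F : Ω → Sample S A R → ℝ}
    (hF : ∀ y, Measurable fun ω => F ω y) : Measurable fun ω => M.stateMean b μ (F ω) :=
  Finset.measurable_sum _ fun s _ => (Finset.measurable_sum _ fun a _ =>
    Finset.measurable_sum _ fun r _ => Finset.measurable_sum _ fun s' _ =>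
      (hF ⟨s, a, r, s'⟩).const_mul _).const_mul _

include hπ

lemma MDP.measurable_trans (s s' : S) : Measurable fun ω => M.trans (π ω) s s' :=
  Finset.measurable_sum _ fun a _ => (hπ s a).mul_const _

lemma MDP.measurable_trans_pow [DecidableEq S] (n : ℕ) (s s' : S) :
    Measurable fun ω => (M.trans (π ω) ^ n) s s' := by
  induction n generalizing s' with
  | zero => simp only [pow_zero]; exact measurable_const
  | succ n ih =>
    simp_rw [pow_succ, Matrix.mul_apply]
    exact Finset.measurable_sum _ fun x _ => (ih x).mul (M.measurable_trans hπ x s')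

lemma MDP.measurable_meanReward (s : S) : Measurable fun ω => M.meanReward (π ω) s :=
  Finset.measurable_sum _ fun a _ => Finset.measurable_sum _ fun _ _ =>
    ((hπ s a).mul_const _).mul_const _

lemma MDP.measurable_value [DecidableEq S] (s : S) : Measurable fun ω => M.value γ (π ω) s :=
  Measurable.tsum fun t => (Finset.measurable_sum _ fun x _ =>
    (M.measurable_trans_pow hπ t s x).mul (M.measurable_meanReward hπ x)).const_mul _

lemma MDP.measurable_nextFeature (s : S) : Measurable fun ω => M.nextFeature φ (π ω) s :=
  Finset.measurable_sum _ fun s' _ => (M.measurable_trans hπ s s').smul_const _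

include hθ

lemma MDP.measurable_loss : Measurable fun ω => M.loss γ φ μ (π ω) (θ ω) :=
  Finset.measurable_sum _ fun s _ => (((measurable_residual hθ γ φ (M.measurable_meanReward hπ)
    (M.measurable_nextFeature hπ φ) s).pow_const 2).const_mul _).const_mul _

variable {v : Ω → S → ℝ} (hv : ∀ s, Measurable fun ω => v ω s)
include hv

lemma MDP.measurable_pairing (y : Sample S A R) :
    Measurable fun ω => M.pairing m γ φ b μ (π ω) (v ω) (θ ω) y := by
  have hres := measurable_residual hθ γ φ (M.measurable_meanReward hπ)
    (M.measurable_nextFeature hπ φ) y.s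
  have herr : ∀ s, Measurable fun ω => linValue φ (θ ω) s - v ω s := fun s =>
    (measurable_linValue hθ φ s).sub (hv s)
  cases m with
  | directSGD =>
    exact hres.mul (((Finset.measurable_sum _ fun s' _ =>
      (M.measurable_trans hπ y.s s').mul (herr s')).const_mul _).sub (herr _))
  | tdSGD =>
    exact (((hπ y.s y.a).div_const _).mul hres).mul (((herr _).const_mul _).sub (herr _))
  | td0 =>
    exact (((((hπ y.s y.a).div_const _).const_mul _).mul
      ((((measurable_linValue hθ φ y.s').const_mul γ).const_add _).sub
        (measurable_linValue hθ φ y.s))).mul (herr _)).neg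

lemma MDP.measurable_noise (y : Sample S A R) :
    Measurable fun ω => M.noise m γ φ b μ (π ω) (v ω) (θ ω) y :=
  (M.measurable_pairing hπ hθ m γ φ b μ hv y).sub
    (M.measurable_stateMean b μ (M.measurable_pairing hπ hθ m γ φ b μ hv))

end Measurability

/-! ### One policy evaluation -/

section Evaluation

variable {S A : Type*} [Fintype S] [DecidableEq S] [Fintype A] [DecidableEq A] {R : Finset ℝ}
  {d : ℕ} {Ω : Type*} {mΩ : MeasurableSpace Ω}

/-- One run of policy evaluation with the update rule `m`, producing the iterates `θ`:
`z₀, …, z_T` is a trajectory under `b`, the policy `π` is determined before it starts, and `e t`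
bounds the estimation errors at time `t`. -/
structure IsEvaluation (κ : Constants) (M : MDP S A R) (γ : ℝ) (b : S → A → ℝ) (μb : S → ℝ)
    (Adm : Set (S → A → ℝ)) (φ : S → EuclideanSpace ℝ (Fin d))
    (C : Set (EuclideanSpace ℝ (Fin d))) (m : Method) (η : ℕ → ℝ) (T : ℕ) (ρ : Measure Ω)
    (ℱ : Filtration ℕ mΩ) (z : ℕ → Ω → Sample S A R) (π : Ω → S → A → ℝ)
    (θ : ℕ → Ω → EuclideanSpace ℝ (Fin d)) (e : ℕ → Ω → ℝ) : Prop where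
  standing : Standing κ M γ b μb Adm φ C
  discount_nonneg : 0 ≤ γ
  discount_lt : γ < 1
  data : IsOfflineData M b T 1 ρ ℱ z
  policy_measurable : ∀ s a, Measurable[ℱ 0] fun ω => π ω s a
  policy_mem : ∀ᵐ ω ∂ρ, π ω ∈ Adm
  step_nonneg : ∀ t, 1 ≤ t → 0 ≤ η t
  iterate_eq : ∃ θ₀ ∈ C, ∀ t ω, θ t ω = evalIterate m γ φ b (π ω) C η θ₀ (fun l => z l ω) t
  error_memLp : ∀ t, 1 ≤ t → t ≤ T → MemLp (e t) 2 ρ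
  error_sq : ∀ t, 1 ≤ t → t ≤ T → ∫ ω, e t ω ^ 2 ∂ρ ≤ κ.estError / t
  error_bound : ∀ t, 1 ≤ t → t ≤ T → ∀ᵐ ω ∂ρ,
    (∀ s', |estTrans (fun l => z l ω) (π ω) t (z t ω).s s' - M.trans (π ω) (z t ω).s s'| ≤ e t ω) ∧
    (∀ r : R, |estRew (fun l => z l ω) (π ω) t (z t ω).s r
      - ∑ a, π ω (z t ω).s a * M.rew (z t ω).s a r| ≤ e t ω) ∧
    |1 / estStat (fun l => z l ω) t (z t ω).s - 1 / μb (z t ω).s| ≤ e t ω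

/-- The number of steps after which the data have forgotten the past up to an error `1 / T`. -/
def Constants.lag (κ : Constants) (T : ℕ) : ℕ := (κ.mixingTime + 1) * (Nat.log 2 T + 1)

/-- Bound on the mean length of the update directions. -/
def Constants.meanDirBound (κ : Constants) : ℝ := κ.dirBound + κ.dirErr * ((1 + κ.estError) / 2)

/-- Constant in the bound on the mean of the noise, for step sizes at most `H` times the rate. -/
def Constants.noiseConst (κ : Constants) (H : ℝ) : ℝ :=
  2 * κ.pairingLip * H * κ.meanDirBound + 8 * κ.radius * κ.dirBound

lemma Constants.one_le_lag (κ : Constants) (T : ℕ) : (1 : ℝ) ≤ κ.lag T :=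
  mod_cast Nat.mul_pos (Nat.succ_pos _) (Nat.succ_pos _)

lemma Constants.half_pow_lag_div_le (κ : Constants) {t T : ℕ} (h1 : 1 ≤ t) (hT : t ≤ T) :
    (1 / 2 : ℝ) ^ (κ.lag T / (κ.mixingTime + 1)) ≤ 1 / t := by
  rw [lag, Nat.mul_div_cancel_left _ (Nat.succ_pos _), one_div_pow]
  refine one_div_le_one_div_of_le (by exact_mod_cast h1) ?_
  exact_mod_cast hT.trans (Nat.lt_pow_succ_log_self one_lt_two T).le

section Iterate

variable {m : Method} {γ : ℝ} {φ : S → EuclideanSpace ℝ (Fin d)} {b : S → A → ℝ}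
  {C : Set (EuclideanSpace ℝ (Fin d))} {η : ℕ → ℝ} {θ₀ : EuclideanSpace ℝ (Fin d)}

lemma evalIterate_mem (hC : IsCompact C) (h0 : θ₀ ∈ C) (π : S → A → ℝ) (z : ℕ → Sample S A R)
    (t : ℕ) : evalIterate m γ φ b π C η θ₀ z t ∈ C := by
  match t with
  | 0 => exact h0
  | 1 => exact h0
  | t + 2 => exact (proj_mem_and_le hC ⟨_, h0⟩ _).1

lemma evalIterate_succ (π : S → A → ℝ) (z : ℕ → Sample S A R) {t : ℕ} (ht : 1 ≤ t) :
    evalIterate m γ φ b π C η θ₀ z (t + 1) = proj C (evalIterate m γ φ b π C η θ₀ z t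
      - η t • estDirection m γ φ b π z t (evalIterate m γ φ b π C η θ₀ z t)) := by
  obtain ⟨t, rfl⟩ := Nat.exists_eq_add_of_le' ht
  rfl

end Iterate

variable {κ : Constants} {M : MDP S A R} {γ : ℝ} {b : S → A → ℝ} {μb : S → ℝ}
  {Adm : Set (S → A → ℝ)} {φ : S → EuclideanSpace ℝ (Fin d)}
  {C : Set (EuclideanSpace ℝ (Fin d))} {m : Method} {η : ℕ → ℝ} {T : ℕ} {ρ : Measure Ω}
  {ℱ : Filtration ℕ mΩ} {z : ℕ → Ω → Sample S A R} {π : Ω → S → A → ℝ}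
  {θ : ℕ → Ω → EuclideanSpace ℝ (Fin d)} {e : ℕ → Ω → ℝ} {j t : ℕ}

namespace IsEvaluation

variable (h : IsEvaluation κ M γ b μb Adm φ C m η T ρ ℱ z π θ e)

include h

lemma iterate_mem (t : ℕ) (ω : Ω) : θ t ω ∈ C := by
  obtain ⟨θ₀, h0, hθ⟩ := h.iterate_eq
  rw [hθ]
  exact evalIterate_mem h.standing.compact h0 _ _ _

lemma iterate_zero (ω : Ω) : θ 0 ω = θ 1 ω := by
  obtain ⟨θ₀, -, hθ⟩ := h.iterate_eq
  rw [hθ, hθ]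
  rfl

lemma iterate_succ (h1 : 1 ≤ t) (ω : Ω) : θ (t + 1) ω = proj C
    (θ t ω - η t • estDirection m γ φ b (π ω) (fun l => z l ω) t (θ t ω)) := by
  obtain ⟨θ₀, -, hθ⟩ := h.iterate_eq
  rw [hθ, hθ, evalIterate_succ _ _ h1]

lemma norm_iterate_succ_sub_le (h1 : 1 ≤ t) (ω : Ω) {θs : EuclideanSpace ℝ (Fin d)}
    (hs : θs ∈ C) : ‖θ (t + 1) ω - θs‖
      ≤ ‖θ t ω - η t • estDirection m γ φ b (π ω) (fun l => z l ω) t (θ t ω) - θs‖ := by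
  rw [h.iterate_succ h1]
  exact norm_proj_sub_le h.standing.compact h.standing.convex hs _

lemma ae_exists_solution : ∀ᵐ ω ∂ρ, π ω ∈ Adm ∧
    ∃ θs ∈ C, M.SolvesBellman γ φ (π ω) θs ∧ M.value γ (π ω) = linValue φ θs := by
  filter_upwards [h.policy_mem] with ω hπ
  obtain ⟨θs, hs, hB⟩ := h.standing.realizable _ hπ
  exact ⟨hπ, θs, hs, hB,
    hB.value_eq_linValue h.discount_nonneg h.discount_lt (h.standing.admissible _ hπ)⟩

lemma ae_noise_le : ∀ᵐ ω ∂ρ, ∀ j, ∀ y : Sample S A R, |(y.r : ℝ)| ≤ κ.rewardBound →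
    |M.noise m γ φ b μb (π ω) (M.value γ (π ω)) (θ j ω) y| ≤ 4 * κ.radius * κ.dirBound := by
  filter_upwards [h.ae_exists_solution] with ω ⟨hπ, θs, hs, _, hv⟩ j y hy
  rw [hv]
  exact h.standing.abs_noise_le h.discount_nonneg h.discount_lt.le hπ m hs (h.iterate_mem j ω) hy

lemma measurable_iterate (hT : t ≤ T + 1) : Measurable[ℱ t] (θ t) := by
  obtain ⟨θ₀, h0, hθ⟩ := h.iterate_eq
  rw [funext (hθ t)]
  exact @measurable_evalIterate _ _ _ _ _ (ℱ t) _
    (fun s a => (h.policy_measurable s a).mono (ℱ.mono (Nat.zero_le t)) le_rfl) m γ φ b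
    _ _ _ _ _ _ h.standing.compact h.standing.convex η _ h0 _ fun l hl =>
      (h.data.measurable_sample (by omega)).mono (ℱ.mono hl) le_rfl

lemma measurable_noise (hT : j ≤ T + 1) (y : Sample S A R) : Measurable[ℱ j] fun ω =>
    M.noise m γ φ b μb (π ω) (M.value γ (π ω)) (θ j ω) y := by
  have hπ : ∀ s a, Measurable[ℱ j] fun ω => π ω s a := fun s a =>
    (h.policy_measurable s a).mono (ℱ.mono (Nat.zero_le j)) le_rfl
  exact @MDP.measurable_noise _ _ _ _ _ (ℱ j) _ hπ _ (h.measurable_iterate hT) m γ φ b μb _ _ M _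
    (@MDP.measurable_value _ _ _ _ (ℱ j) _ hπ γ _ _ M _) y

variable [IsProbabilityMeasure ρ]

lemma dirBound_pos : 0 < κ.dirBound :=
  haveI : Nonempty S := (nonempty_of_isProbabilityMeasure ρ).map fun ω => (z 0 ω).s
  h.standing.dirBound_pos

lemma dirErr_pos : 0 < κ.dirErr :=
  haveI : Nonempty S := (nonempty_of_isProbabilityMeasure ρ).map fun ω => (z 0 ω).s
  h.standing.dirErr_pos

lemma pairingLip_pos : 0 < κ.pairingLip := by
  have := h.dirBound_pos
  have := κ.dirLip_pos
  have := κ.radius_pos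
  rw [Constants.pairingLip]
  positivity

lemma meanDirBound_pos : 0 < κ.meanDirBound := by
  have := h.dirBound_pos
  have := h.dirErr_pos
  have := κ.estError_pos
  rw [Constants.meanDirBound]
  positivity

lemma ae_reward_lt : ∀ᵐ ω ∂ρ, ∀ t ≤ T, |((z t ω).r : ℝ)| < κ.rewardBound := by
  filter_upwards [h.standing.ae_reward_lt h.data] with ω hω t ht
  exact hω t (by omega)

lemma ae_norm_estDirection_sub_le (h1 : 1 ≤ t) (hT : t ≤ T) : ∀ᵐ ω ∂ρ,
    ‖estDirection m γ φ b (π ω) (fun l => z l ω) t (θ t ω) - direction m γ φ b (π ω)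
        (M.meanReward (π ω)) (M.nextFeature φ (π ω)) μb (θ t ω) (z t ω)‖
      ≤ κ.dirErr * e t ω := by
  filter_upwards [h.ae_reward_lt, h.policy_mem, h.error_bound t h1 hT] with ω hr hπ ⟨he, he', he''⟩
  exact h.standing.norm_estDirection_sub_le h.discount_nonneg h.discount_lt.le hπ m
    (h.standing.bounded _ (h.iterate_mem t ω)) (z := fun l => z l ω)
    (fun l hl => hr l (hl.trans hT)) he he' he''

lemma ae_norm_estDirection_le (h1 : 1 ≤ t) (hT : t ≤ T) : ∀ᵐ ω ∂ρ,
    ‖estDirection m γ φ b (π ω) (fun l => z l ω) t (θ t ω)‖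
      ≤ κ.dirBound + κ.dirErr * e t ω := by
  filter_upwards [h.ae_reward_lt, h.policy_mem, h.ae_norm_estDirection_sub_le h1 hT]
    with ω hr hπ herr
  have hexact := h.standing.norm_direction_le h.discount_nonneg h.discount_lt.le hπ m
    (h.standing.bounded _ (h.iterate_mem t ω)) (hr t hT).le
  linarith [norm_le_norm_add_norm_sub' (estDirection m γ φ b (π ω) (fun l => z l ω) t (θ t ω))
    (direction m γ φ b (π ω) (M.meanReward (π ω)) (M.nextFeature φ (π ω)) μb (θ t ω) (z t ω))]

omit [IsProbabilityMeasure ρ] in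
lemma ae_error_nonneg (h1 : 1 ≤ t) (hT : t ≤ T) : ∀ᵐ ω ∂ρ, 0 ≤ e t ω := by
  filter_upwards [h.error_bound t h1 hT] with ω he
  exact (abs_nonneg _).trans he.2.2

lemma ae_dist_sq_succ_le (h1 : 1 ≤ t) (hT : t ≤ T) : ∀ᵐ ω ∂ρ, ∀ θs ∈ C,
    M.SolvesBellman γ φ (π ω) θs →
      ‖θ (t + 1) ω - θs‖ ^ 2 ≤ ‖θ t ω - θs‖ ^ 2
        - 2 * η t * (M.stateMean b μb (M.pairing m γ φ b μb (π ω) (M.value γ (π ω)) (θ t ω))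
            + M.noise m γ φ b μb (π ω) (M.value γ (π ω)) (θ t ω) (z t ω))
        + 2 * η t * (‖θ t ω - θs‖ * (κ.dirErr * e t ω))
        + η t ^ 2 * (2 * κ.dirBound ^ 2 + 2 * κ.dirErr ^ 2 * e t ω ^ 2) := by
  filter_upwards [h.ae_norm_estDirection_sub_le h1 hT, h.ae_norm_estDirection_le h1 hT,
    h.policy_mem] with ω herr hbound hπ θs hs hB
  have hproj := pow_le_pow_left₀ (norm_nonneg _) (h.norm_iterate_succ_sub_le h1 ω hs) 2
  rw [hB.value_eq_linValue h.discount_nonneg h.discount_lt (h.standing.admissible _ hπ)]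
  set x := θ t ω
  set g := direction m γ φ b (π ω) (M.meanReward (π ω)) (M.nextFeature φ (π ω)) μb x (z t ω)
    with hg
  set ĝ := estDirection m γ φ b (π ω) (fun l => z l ω) t x with hĝ
  have hexpand : ‖x - η t • ĝ - θs‖ ^ 2 = ‖x - θs‖ ^ 2
      - 2 * η t * (inner ℝ (x - θs) g + inner ℝ (x - θs) (ĝ - g)) + η t ^ 2 * ‖ĝ‖ ^ 2 := by
    rw [sub_right_comm, norm_sub_sq_real, inner_smul_right, norm_smul, Real.norm_eq_abs, mul_pow,
      sq_abs, inner_sub_right _ ĝ g]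
    ring
  have hsplit : M.stateMean b μb (M.pairing m γ φ b μb (π ω) (linValue φ θs) x)
      + M.noise m γ φ b μb (π ω) (linValue φ θs) x (z t ω) = inner ℝ (x - θs) g := by
    rw [hg, MDP.inner_direction_eq_pairing, MDP.noise]
    ring
  have herr' : -(‖x - θs‖ * (κ.dirErr * e t ω)) ≤ inner ℝ (x - θs) (ĝ - g) :=
    (abs_le.1 (abs_inner_le_mul le_rfl herr)).1
  have hsq : ‖ĝ‖ ^ 2 ≤ 2 * κ.dirBound ^ 2 + 2 * κ.dirErr ^ 2 * e t ω ^ 2 := by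
    have := pow_le_pow_left₀ (norm_nonneg _) hbound 2
    linarith [sq_nonneg (κ.dirBound - κ.dirErr * e t ω)]
  rw [hexpand] at hproj
  rw [hsplit]
  linarith [mul_le_mul_of_nonneg_left hsq (sq_nonneg (η t)),
    mul_le_mul_of_nonneg_left herr' (h.step_nonneg t h1)]

lemma integrable_error (h1 : 1 ≤ t) (hT : t ≤ T) : Integrable (e t) ρ :=
  (h.error_memLp t h1 hT).integrable one_le_two

omit [IsProbabilityMeasure ρ] in
lemma integrable_error_sq (h1 : 1 ≤ t) (hT : t ≤ T) : Integrable (fun ω => e t ω ^ 2) ρ :=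
  (h.error_memLp t h1 hT).integrable_sq

lemma integral_error_le (h1 : 1 ≤ t) (hT : t ≤ T) :
    ∫ ω, e t ω ∂ρ ≤ (1 + κ.estError) / 2 / Real.sqrt t := by
  have ht : (0 : ℝ) < t := by exact_mod_cast h1
  set q := Real.sqrt t
  have hq0 : 0 < q := Real.sqrt_pos.2 ht
  have hint := (h.integrable_error_sq h1 hT).const_mul (q / 2)
  have amgm : ∀ x : ℝ, x ≤ q / 2 * x ^ 2 + 1 / (2 * q) := fun x => by
    have : q / 2 * x ^ 2 + 1 / (2 * q) - x = (q * x - 1) ^ 2 / (2 * q) := by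
      field_simp; ring
    linarith [div_nonneg (sq_nonneg (q * x - 1)) (by positivity : 0 ≤ 2 * q)]
  calc ∫ ω, e t ω ∂ρ ≤ ∫ ω, (q / 2 * e t ω ^ 2 + 1 / (2 * q)) ∂ρ :=
        integral_mono (h.integrable_error h1 hT) (hint.add (integrable_const _)) fun ω => amgm _
    _ = q / 2 * ∫ ω, e t ω ^ 2 ∂ρ + 1 / (2 * q) := by
        rw [integral_add hint (integrable_const _), integral_const_mul]; simp
    _ ≤ q / 2 * (κ.estError / q ^ 2) + 1 / (2 * q) := by
        rw [Real.sq_sqrt ht.le]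
        gcongr
        exact h.error_sq t h1 hT
    _ = (1 + κ.estError) / 2 / q := by field_simp; ring

lemma integrable_dirBound_add_error (h1 : 1 ≤ t) (hT : t ≤ T) :
    Integrable (fun ω => κ.dirBound + κ.dirErr * e t ω) ρ :=
  (integrable_const _).add ((h.integrable_error h1 hT).const_mul _)

lemma integral_dirBound_add_error_le (h1 : 1 ≤ t) (hT : t ≤ T) :
    ∫ ω, (κ.dirBound + κ.dirErr * e t ω) ∂ρ ≤ κ.meanDirBound := by
  have herr : ∫ ω, e t ω ∂ρ ≤ (1 + κ.estError) / 2 :=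
    (h.integral_error_le h1 hT).trans (div_le_self (by linarith [κ.estError_pos])
      (Real.one_le_sqrt.2 (by exact_mod_cast h1)))
  rw [integral_add (integrable_const _) ((h.integrable_error h1 hT).const_mul _),
    integral_const_mul, Constants.meanDirBound]
  simpa using mul_le_mul_of_nonneg_left herr h.dirErr_pos.le

lemma ae_norm_iterate_sub_le_sum (h1 : 1 ≤ j) (hj : j ≤ t) (hT : t ≤ T) : ∀ᵐ ω ∂ρ,
    ‖θ t ω - θ j ω‖ ≤ ∑ l ∈ Finset.Ico j t, η l * (κ.dirBound + κ.dirErr * e l ω) := by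
  induction t, hj using Nat.le_induction with
  | base => simp
  | succ t hj ih =>
    filter_upwards [ih (by omega), h.ae_norm_estDirection_le (h1.trans hj) (by omega)]
      with ω hsum hdir
    have hstep := h.norm_iterate_succ_sub_le (h1.trans hj) ω (h.iterate_mem t ω)
    rw [sub_sub_cancel_left, norm_neg, norm_smul,
      Real.norm_of_nonneg (h.step_nonneg t (h1.trans hj))] at hstep
    rw [Finset.sum_Ico_succ_top hj]
    linarith [norm_sub_le_norm_sub_add_norm_sub (θ (t + 1) ω) (θ t ω) (θ j ω),
      mul_le_mul_of_nonneg_left hdir (h.step_nonneg t (h1.trans hj))]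

lemma integrable_noise (hj : j ≤ T) (ht : t ≤ T) : Integrable (fun ω =>
    M.noise m γ φ b μb (π ω) (M.value γ (π ω)) (θ j ω) (z t ω)) ρ := by
  refine Integrable.of_bound (measurable_comp_sample (fun y =>
    (h.measurable_noise (hj.trans (Nat.le_succ T)) y).mono (ℱ.le j) le_rfl)
    ((h.data.measurable_sample (by omega)).mono (ℱ.le _) le_rfl)).aestronglyMeasurable
    (4 * κ.radius * κ.dirBound) ?_
  filter_upwards [h.ae_noise_le, h.ae_reward_lt] with ω hnoise hr
  exact hnoise j _ (hr t ht).le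

lemma abs_integral_noise_le_const (hT : t ≤ T) :
    |∫ ω, M.noise m γ φ b μb (π ω) (M.value γ (π ω)) (θ t ω) (z t ω) ∂ρ|
      ≤ 4 * κ.radius * κ.dirBound := by
  have hae : ∀ᵐ ω ∂ρ, ‖M.noise m γ φ b μb (π ω) (M.value γ (π ω)) (θ t ω) (z t ω)‖
      ≤ 4 * κ.radius * κ.dirBound := by
    filter_upwards [h.ae_noise_le, h.ae_reward_lt] with ω hnoise hr
    exact hnoise t _ (hr t hT).le
  simpa using norm_integral_le_of_norm_le_const hae

lemma abs_integral_noise_add_le {i : ℕ} (hT : j + i ≤ T) :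
    |∫ ω, M.noise m γ φ b μb (π ω) (M.value γ (π ω)) (θ j ω) (z (j + i) ω) ∂ρ|
      ≤ 8 * κ.radius * κ.dirBound * (1 / 2) ^ (i / (κ.mixingTime + 1)) := by
  have hst := h.standing
  refine (h.data.abs_integral_add_le_of_isMixing hst.behavior hst.stationary hst.mixing hT
    (h.measurable_noise (by omega)) (L := 4 * κ.radius * κ.dirBound) ?_
    (ae_of_all _ fun ω => hst.stateMean_noise m _ _ _)).trans_eq (by ring)
  filter_upwards [h.ae_noise_le] with ω hnoise y hy
  exact hnoise j y (hst.reward_bound _ _ _ hy).le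

lemma abs_integral_noise_sub_le (h1 : 1 ≤ j) (hj : j ≤ t) (hT : t ≤ T) :
    |∫ ω, M.noise m γ φ b μb (π ω) (M.value γ (π ω)) (θ t ω) (z t ω) ∂ρ
        - ∫ ω, M.noise m γ φ b μb (π ω) (M.value γ (π ω)) (θ j ω) (z t ω) ∂ρ|
      ≤ 2 * κ.pairingLip * ∑ l ∈ Finset.Ico j t, η l * κ.meanDirBound := by
  have hst := h.standing
  have hL := h.pairingLip_pos
  have hrange : ∀ l ∈ Finset.Ico j t, 1 ≤ l ∧ l ≤ T := fun l hl => by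
    rw [Finset.mem_Ico] at hl
    omega
  have hint : ∀ l ∈ Finset.Ico j t,
      Integrable (fun ω => η l * (κ.dirBound + κ.dirErr * e l ω)) ρ := fun l hl =>
    (h.integrable_dirBound_add_error (hrange l hl).1 (hrange l hl).2).const_mul _
  rw [← integral_sub (h.integrable_noise hT hT) (h.integrable_noise (hj.trans hT) hT),
    ← Real.norm_eq_abs]
  calc _ ≤ ∫ ω, 2 * κ.pairingLip
          * ∑ l ∈ Finset.Ico j t, η l * (κ.dirBound + κ.dirErr * e l ω) ∂ρ := by
        refine norm_integral_le_of_norm_le ((integrable_finsetSum _ hint).const_mul _) ?_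
        filter_upwards [h.ae_exists_solution, h.ae_reward_lt, h.ae_norm_iterate_sub_le_sum h1 hj hT]
          with ω ⟨hπ, θs, hs, _, hv⟩ hr hn
        rw [hv, Real.norm_eq_abs]
        refine (hst.abs_noise_sub_le h.discount_nonneg h.discount_lt.le hπ m hs
          (h.iterate_mem t ω) (h.iterate_mem j ω) (hr t hT).le).trans ?_
        gcongr
    _ = 2 * κ.pairingLip
          * ∑ l ∈ Finset.Ico j t, η l * ∫ ω, (κ.dirBound + κ.dirErr * e l ω) ∂ρ := by
        rw [integral_const_mul, integral_finsetSum _ hint]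
        simp only [integral_const_mul]
    _ ≤ _ := by
        gcongr with l hl
        · exact h.step_nonneg l (hrange l hl).1
        · exact h.integral_dirBound_add_error_le (hrange l hl).1 (hrange l hl).2

lemma abs_integral_noise_le {H : ℝ} {β : ℕ → ℝ} (hH : 0 ≤ H)
    (hβ : ∀ t : ℕ, 1 ≤ t → 1 / (t : ℝ) ≤ β t)
    (hη : ∀ l t : ℕ, 1 ≤ l → l ≤ t → t ≤ 2 * l → η l ≤ H * β t) (h1 : 1 ≤ t) (hT : t ≤ T) :
    |∫ ω, M.noise m γ φ b μb (π ω) (M.value γ (π ω)) (θ t ω) (z t ω) ∂ρ|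
      ≤ κ.noiseConst H * κ.lag T * β t := by
  have hG := h.dirBound_pos
  have hr := κ.radius_pos
  have hL := h.pairingLip_pos
  have hD := h.meanDirBound_pos
  have hlag := κ.one_le_lag T
  have ht : (0 : ℝ) < t := by exact_mod_cast h1
  have hβ0 : 0 < β t := lt_of_lt_of_le (by positivity) (hβ t h1)
  rw [Constants.noiseConst]
  rcases lt_or_ge t (2 * κ.lag T) with hlt | hge
  · have hone : 1 ≤ 2 * (κ.lag T * β t) := by
      have htβ : 1 ≤ (t : ℝ) * β t := (div_le_iff₀' ht).1 (hβ t h1)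
      have htlag : (t : ℝ) ≤ 2 * κ.lag T := by exact_mod_cast hlt.le
      linarith [mul_le_mul_of_nonneg_right htlag hβ0.le]
    have hrest : 0 ≤ 2 * κ.pairingLip * H * κ.meanDirBound * (κ.lag T * β t) := by positivity
    linarith [h.abs_integral_noise_le_const hT,
      mul_le_mul_of_nonneg_left hone (by positivity : 0 ≤ 4 * κ.radius * κ.dirBound)]
  · obtain ⟨j, rfl⟩ : ∃ j, t = j + κ.lag T := ⟨t - κ.lag T, by omega⟩
    have hpast := (h.abs_integral_noise_add_le hT).trans (mul_le_mul_of_nonneg_left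
      ((κ.half_pow_lag_div_le h1 hT).trans (hβ _ h1)) (by positivity))
    have hsub := h.abs_integral_noise_sub_le (j := j) (by omega) (by omega) hT
    have hsum : ∑ l ∈ Finset.Ico j (j + κ.lag T), η l * κ.meanDirBound
        ≤ κ.lag T * (H * β (j + κ.lag T) * κ.meanDirBound) := by
      refine (Finset.sum_le_card_nsmul _ _ _ fun l hl => ?_).trans_eq
        (by rw [Nat.card_Ico, Nat.add_sub_cancel_left, nsmul_eq_mul])
      rw [Finset.mem_Ico] at hl
      exact mul_le_mul_of_nonneg_right (hη l _ (by omega) (by omega) (by omega)) hD.le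
    linarith [abs_sub_abs_le_abs_sub _ _ |>.trans hsub,
      mul_le_mul_of_nonneg_left hsum (by positivity : 0 ≤ 2 * κ.pairingLip),
      le_mul_of_one_le_right (by positivity : 0 ≤ 8 * κ.radius * κ.dirBound * β (j + κ.lag T)) hlag]

end IsEvaluation

end Evaluation

/-! ### Step sizes -/

section Steps

lemma IsContractionStep.mul_div_two_mem_Icc {c : ℝ} {η : ℕ → ℝ} (h : IsContractionStep c η)
    (hc : 0 < c) {t : ℕ} (ht : 1 ≤ t) : c * η t / 2 ∈ Set.Icc (1 / (2 * t) : ℝ) (1 / t) := by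
  obtain ⟨hlower, hupper, hstep⟩ := h
  induction t, ht using Nat.le_induction with
  | base =>
    rw [div_le_iff₀' hc] at hlower
    rw [le_div_iff₀' hc] at hupper
    constructor <;> norm_num <;> linarith
  | succ t ht ih =>
    obtain ⟨hge, hle⟩ := ih
    have ht' : (1 : ℝ) ≤ t := by exact_mod_cast ht
    set x := c * η t / 2 with hx
    have hx0 : 0 < x := lt_of_lt_of_le (by positivity) hge
    have hx1 : x ≤ 1 := hle.trans ((div_le_one (by positivity)).2 ht')
    have hsucc : c * η (t + 1) / 2 = x / Real.exp x := by
      rw [hstep t ht, show -(1 / 2) * c * η t = -x by rw [hx]; ring, Real.exp_neg, hx]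
      ring
    rw [div_le_iff₀ (by positivity)] at hge
    rw [le_div_iff₀ (by positivity)] at hle
    rw [hsucc]
    push_cast
    constructor
    · have hexp : Real.exp x - 1 - x ≤ x ^ 2 :=
        (abs_le.1 (Real.abs_exp_sub_one_sub_id_le (abs_le.2 ⟨by linarith, hx1⟩))).2
      rw [div_le_div_iff₀ (by positivity) (Real.exp_pos x)]
      nlinarith
    · rw [div_le_div_iff₀ (Real.exp_pos x) (by positivity)]
      linarith [Real.add_one_le_exp x]

lemma sum_one_div_sqrt_le (T : ℕ) :
    ∑ t ∈ Finset.Icc 1 T, 1 / Real.sqrt t ≤ 2 * Real.sqrt T := by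
  induction T with
  | zero => simp
  | succ T ih =>
    rw [Finset.sum_Icc_succ_top (by omega)]
    push_cast
    set p := Real.sqrt T
    set q := Real.sqrt ((T : ℝ) + 1)
    have hq0 : 0 < q := Real.sqrt_pos.2 (by positivity)
    have hpp : p ^ 2 = T := Real.sq_sqrt (by positivity)
    have hqq : q ^ 2 = T + 1 := Real.sq_sqrt (by positivity)
    have hterm : 1 / q ≤ 2 * (q - p) := by
      rw [div_le_iff₀ hq0]
      linarith [sq_nonneg (q - p)]
    linarith

lemma sum_one_div_le_one_add_log (T : ℕ) :
    ∑ t ∈ Finset.Icc 1 T, 1 / (t : ℝ) ≤ 1 + Real.log T := by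
  simpa [harmonic_eq_sum_Icc] using harmonic_le_one_add_log T

lemma sum_mul_sub_succ_le_of_monotone {w D : ℕ → ℝ} {L : ℝ} (hw : Monotone w) (hw0 : 0 ≤ w 0)
    (h0 : ∀ t, 0 ≤ D t) (hL : ∀ t, D t ≤ L) (T : ℕ) :
    ∑ t ∈ Finset.Icc 1 T, w t * (D t - D (t + 1)) ≤ w T * L := by
  suffices h : ∑ t ∈ Finset.Icc 1 T, w t * (D t - D (t + 1)) + w T * D (T + 1) ≤ w T * L by
    linarith [mul_nonneg (hw0.trans (hw T.zero_le)) (h0 (T + 1))]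
  induction T with
  | zero => simpa using mul_le_mul_of_nonneg_left (hL 1) hw0
  | succ T ih =>
    rw [Finset.sum_Icc_succ_top (by omega)]
    linarith [mul_le_mul_of_nonneg_left (hL (T + 1)) (sub_nonneg.2 (hw T.le_succ))]

end Steps

/-! ### The loss -/

section Loss

lemma add_le_of_strongConvexOn_of_forall_le {E : Type*} [NormedAddCommGroup E] [NormedSpace ℝ E]
    {f : E → ℝ} {c : ℝ} (hf : StrongConvexOn Set.univ c f) {x₀ : E} (hmin : ∀ x, f x₀ ≤ f x)
    (x : E) : f x₀ + c / 2 * ‖x - x₀‖ ^ 2 ≤ f x := by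
  suffices h : ∀ p : ℝ, 0 < p → p < 1 → (1 - p) * (c / 2 * ‖x - x₀‖ ^ 2) ≤ f x - f x₀ by
    have hlim : Filter.Tendsto (fun p : ℝ => (1 - p) * (c / 2 * ‖x - x₀‖ ^ 2))
        (nhdsWithin 0 (Set.Ioi 0)) (nhds ((1 - 0) * (c / 2 * ‖x - x₀‖ ^ 2))) :=
      Filter.Tendsto.mono_left (Continuous.tendsto (by fun_prop) 0) nhdsWithin_le_nhds
    have := le_of_tendsto hlim (Filter.eventually_of_mem (Ioo_mem_nhdsGT one_pos)
      fun p hp => h p hp.1 hp.2)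
    linarith
  intro p hp0 hp1
  have hconv := hf.2 (Set.mem_univ x) (Set.mem_univ x₀) hp0.le (sub_nonneg.2 hp1.le)
    (add_sub_cancel p 1)
  have hle := (hmin _).trans hconv
  simp only [smul_eq_mul] at hle
  refine le_of_mul_le_mul_left ?_ hp0
  linarith

variable {S A : Type*} [Fintype S] [Fintype A] {R : Finset ℝ} {d : ℕ} {M : MDP S A R} {γ : ℝ}
  {φ : S → EuclideanSpace ℝ (Fin d)} {μ : S → ℝ} {π : S → A → ℝ}

lemma MDP.loss_nonneg (hμ : ∀ s, 0 ≤ μ s) (θ : EuclideanSpace ℝ (Fin d)) :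
    0 ≤ M.loss γ φ μ π θ :=
  Finset.sum_nonneg fun s _ => mul_nonneg (hμ s) (by positivity)

lemma MDP.loss_le_of_abs_residual_le {θ : EuclideanSpace ℝ (Fin d)} {L : ℝ}
    (hμ : ∀ s, 0 ≤ μ s) (hsum : ∑ s, μ s = 1)
    (hL : ∀ s, |residual γ φ (M.meanReward π) (M.nextFeature φ π) θ s| ≤ L) :
    M.loss γ φ μ π θ ≤ 1 / 2 * L ^ 2 := by
  calc M.loss γ φ μ π θ ≤ ∑ s, μ s * (1 / 2 * L ^ 2) :=
        Finset.sum_le_sum fun s _ => mul_le_mul_of_nonneg_left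
          (by linarith [sq_le_sq.2 ((hL s).trans (le_abs_self L))]) (hμ s)
    _ = 1 / 2 * L ^ 2 := by rw [← Finset.sum_mul, hsum, one_mul]

lemma MDP.convexOn_loss (hμ : ∀ s, 0 ≤ μ s) : ConvexOn ℝ Set.univ (M.loss γ φ μ π) := by
  refine ⟨convex_univ, fun x _ y _ p q hp hq hpq => ?_⟩
  simp only [MDP.loss, smul_eq_mul]
  rw [Finset.mul_sum, Finset.mul_sum, ← Finset.sum_add_distrib]
  refine Finset.sum_le_sum fun s _ => ?_
  set res := fun θ => residual γ φ (M.meanReward π) (M.nextFeature φ π) θ s with hres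
  have haff : res (p • x + q • y) = p * res x + q * res y := by
    simp only [hres, residual, inner_add_right, inner_smul_right]
    linear_combination -(M.meanReward π s) * hpq
  have hsq : (p * res x + q * res y) ^ 2 ≤ p * res x ^ 2 + q * res y ^ 2 :=
    even_two.convexOn_pow.2 (Set.mem_univ _) (Set.mem_univ _) hp hq hpq
  change μ s * (1 / 2 * res (p • x + q • y) ^ 2)
    ≤ p * (μ s * (1 / 2 * res x ^ 2)) + q * (μ s * (1 / 2 * res y ^ 2))
  rw [haff]
  linarith [mul_le_mul_of_nonneg_left hsq (hμ s)]

lemma MDP.SolvesBellman.loss_eq_zero {θs : EuclideanSpace ℝ (Fin d)}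
    (hs : M.SolvesBellman γ φ π θs) : M.loss γ φ μ π θs = 0 :=
  Finset.sum_eq_zero fun s _ => by rw [hs.residual_eq]; simp

lemma MDP.SolvesBellman.mul_dist_sq_le_loss {c : ℝ} {θs : EuclideanSpace ℝ (Fin d)}
    (hs : M.SolvesBellman γ φ π θs) (hμ : ∀ s, 0 ≤ μ s)
    (hc : StrongConvexOn Set.univ c (M.loss γ φ μ π)) (θ : EuclideanSpace ℝ (Fin d)) :
    c * ‖θ - θs‖ ^ 2 ≤ 2 * M.loss γ φ μ π θ := by
  have := add_le_of_strongConvexOn_of_forall_le hc (x₀ := θs)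
    (fun x => hs.loss_eq_zero.trans_le (MDP.loss_nonneg hμ x)) θ
  rw [hs.loss_eq_zero] at this
  linarith

variable [DecidableEq S] {κ : Constants} {b : S → A → ℝ} {μb : S → ℝ} {Adm : Set (S → A → ℝ)}
  {C : Set (EuclideanSpace ℝ (Fin d))}

namespace Standing

variable (h : Standing κ M γ b μb Adm φ C)

include h

lemma loss_le (h0 : 0 ≤ γ) (h1 : γ ≤ 1) (hπ : π ∈ Adm) {θ : EuclideanSpace ℝ (Fin d)}
    (hθ : θ ∈ C) : M.loss γ φ μb π θ ≤ 1 / 2 * κ.residualBound ^ 2 :=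
  MDP.loss_le_of_abs_residual_le h.stationary.nonneg h.stationary.sum_one
    (h.abs_residual_le h0 h1 hπ (h.bounded θ hθ))

lemma loss_le_dist_sq (h0 : 0 ≤ γ) (h1 : γ ≤ 1) (hπ : π ∈ Adm) {θs : EuclideanSpace ℝ (Fin d)}
    (hs : M.SolvesBellman γ φ π θs) (θ : EuclideanSpace ℝ (Fin d)) :
    M.loss γ φ μb π θ ≤ 2 * κ.featureBound ^ 2 * ‖θ - θs‖ ^ 2 := by
  refine (MDP.loss_le_of_abs_residual_le h.stationary.nonneg h.stationary.sum_one (L :=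
    (κ.featureBound + κ.featureBound) * ‖θ - θs‖) fun s => ?_).trans_eq (by ring)
  rw [hs.residual_eq, ← inner_sub_feature, ← MDP.inner_sub_nextFeature, ← inner_smul_right,
    ← inner_sub_right, real_inner_comm]
  exact abs_inner_le_mul (norm_smul_sub_le h0 h1 (h.norm_nextFeature_le hπ s)
    (h.feature_bound s)) le_rfl

lemma sq_residual_le (hπ : π ∈ Adm) (θ : EuclideanSpace ℝ (Fin d)) (s : S) :
    residual γ φ (M.meanReward π) (M.nextFeature φ π) θ s ^ 2
      ≤ 2 * κ.shift * M.loss γ φ μb π θ := by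
  have hterm : μb s * (1 / 2 * residual γ φ (M.meanReward π) (M.nextFeature φ π) θ s ^ 2)
      ≤ M.loss γ φ μb π θ :=
    Finset.single_le_sum (f := fun s => μb s *
      ((1 / 2) * residual γ φ (M.meanReward π) (M.nextFeature φ π) θ s ^ 2))
      (fun s _ => mul_nonneg (h.stationary.nonneg s) (by positivity)) (Finset.mem_univ s)
  linarith [mul_le_mul_of_nonneg_left hterm κ.shift_pos.le,
    mul_le_mul_of_nonneg_right (h.one_le_shift_mul hπ s)
      (sq_nonneg (residual γ φ (M.meanReward π) (M.nextFeature φ π) θ s))]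

end Standing

end Loss

/-! ### Accuracy of policy evaluation -/

section Accuracy

variable {S A : Type*} [Fintype S] [DecidableEq S] [Fintype A] [DecidableEq A] {R : Finset ℝ}
  {d : ℕ} {Ω : Type*} {mΩ : MeasurableSpace Ω}

lemma integrable_linear_combination {ρ : Measure Ω} [IsFiniteMeasure ρ] {f g k : Ω → ℝ}
    (hf : Integrable f ρ) (hg : Integrable g ρ) (hk : Integrable k ρ) (a₁ a₂ a₃ a₄ : ℝ) :
    Integrable (fun ω => a₁ * f ω + a₂ * g ω + a₃ * k ω + a₄) ρ := by
  fun_prop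

lemma integral_linear_combination {ρ : Measure Ω} [IsProbabilityMeasure ρ] {f g k : Ω → ℝ}
    (hf : Integrable f ρ) (hg : Integrable g ρ) (hk : Integrable k ρ) (a₁ a₂ a₃ a₄ : ℝ) :
    ∫ ω, (a₁ * f ω + a₂ * g ω + a₃ * k ω + a₄) ∂ρ
      = a₁ * ∫ ω, f ω ∂ρ + a₂ * ∫ ω, g ω ∂ρ + a₃ * ∫ ω, k ω ∂ρ + a₄ := by
  rw [integral_add (by fun_prop) (by fun_prop), integral_add (by fun_prop) (by fun_prop),
    integral_add (by fun_prop) (by fun_prop)]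
  simp [integral_const_mul]

/-- Constant in the accuracy of the evaluation in general. -/
def Constants.sqrtRate (κ : Constants) (η₀ : ℝ) : ℝ :=
  2 * κ.radius ^ 2 / η₀ + 2 * κ.noiseConst (2 * η₀) + 2 * κ.radius * κ.dirErr * (1 + κ.estError)
    + 2 * η₀ * (κ.dirBound ^ 2 + κ.dirErr ^ 2 * κ.estError)

variable {κ : Constants} {M : MDP S A R} {γ : ℝ} {b : S → A → ℝ} {μb : S → ℝ}
  {Adm : Set (S → A → ℝ)} {φ : S → EuclideanSpace ℝ (Fin d)}
  {C : Set (EuclideanSpace ℝ (Fin d))} {m : Method} {η : ℕ → ℝ} {T : ℕ} {ρ : Measure Ω}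
  [IsProbabilityMeasure ρ] {ℱ : Filtration ℕ mΩ} {z : ℕ → Ω → Sample S A R} {π : Ω → S → A → ℝ}
  {θ : ℕ → Ω → EuclideanSpace ℝ (Fin d)} {e : ℕ → Ω → ℝ} {t : ℕ} {η₀ : ℝ}

omit [DecidableEq S] [DecidableEq A] in
lemma MDP.loss_average_le {π : S → A → ℝ} (hμ : ∀ s, 0 ≤ μb s) (T : ℕ)
    (θ : ℕ → EuclideanSpace ℝ (Fin d)) :
    M.loss γ φ μb π ((1 / ((T : ℝ) + 1)) • ∑ t ∈ Finset.range (T + 1), θ t)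
      ≤ 1 / ((T : ℝ) + 1) * ∑ t ∈ Finset.range (T + 1), M.loss γ φ μb π (θ t) := by
  have hjensen := (MDP.convexOn_loss (M := M) (γ := γ) (φ := φ) (π := π) hμ).map_sum_le
    (t := Finset.range (T + 1)) (w := fun _ => 1 / ((T : ℝ) + 1)) (p := θ)
    (fun _ _ => by positivity) (by simp; field_simp) (fun _ _ => Set.mem_univ _)
  rwa [← Finset.smul_sum, ← Finset.smul_sum] at hjensen

namespace IsEvaluation

lemma noiseConst_nonneg (h : IsEvaluation κ M γ b μb Adm φ C m η T ρ ℱ z π θ e) {H : ℝ}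
    (hH : 0 ≤ H) : 0 ≤ κ.noiseConst H := by
  have := h.dirBound_pos
  have := h.pairingLip_pos
  have := h.meanDirBound_pos
  have := κ.radius_pos
  rw [Constants.noiseConst]
  positivity

omit [IsProbabilityMeasure ρ] in
lemma measurable_loss (h : IsEvaluation κ M γ b μb Adm φ C m η T ρ ℱ z π θ e)
    {x : Ω → EuclideanSpace ℝ (Fin d)} (hx : Measurable x) :
    Measurable fun ω => M.loss γ φ μb (π ω) (x ω) :=
  MDP.measurable_loss (fun s a => (h.policy_measurable s a).mono (ℱ.le 0) le_rfl) hx _ _ _ _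

lemma integrable_loss_iterate (h : IsEvaluation κ M γ b μb Adm φ C m η T ρ ℱ z π θ e)
    (hT : t ≤ T) : Integrable (fun ω => M.loss γ φ μb (π ω) (θ t ω)) ρ := by
  refine Integrable.of_bound (h.measurable_loss ((h.measurable_iterate
    (hT.trans T.le_succ)).mono (ℱ.le t) le_rfl)).aestronglyMeasurable
    (1 / 2 * κ.residualBound ^ 2) ?_
  filter_upwards [h.policy_mem] with ω hπ
  rw [Real.norm_of_nonneg (MDP.loss_nonneg h.standing.stationary.nonneg _)]
  exact h.standing.loss_le h.discount_nonneg h.discount_lt.le hπ (h.iterate_mem t ω)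

lemma integrable_loss_output (h : IsEvaluation κ M γ b μb Adm φ C m η T ρ ℱ z π θ e) :
    Integrable (fun ω => M.loss γ φ μb (π ω)
      ((1 / ((T : ℝ) + 1)) • ∑ t ∈ Finset.range (T + 1), θ t ω)) ρ := by
  have hmeas : Measurable fun ω => (1 / ((T : ℝ) + 1)) • ∑ t ∈ Finset.range (T + 1), θ t ω :=
    (Finset.measurable_sum _ fun t ht => (h.measurable_iterate
      (Finset.mem_range.1 ht).le).mono (ℱ.le t) le_rfl).const_smul (1 / ((T : ℝ) + 1))
  refine ((integrable_finsetSum (Finset.range (T + 1)) fun t ht => h.integrable_loss_iterate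
    (Finset.mem_range_succ_iff.1 ht)).const_mul (1 / ((T : ℝ) + 1))).mono'
    (h.measurable_loss hmeas).aestronglyMeasurable (ae_of_all _ fun ω => ?_)
  rw [Real.norm_of_nonneg (MDP.loss_nonneg h.standing.stationary.nonneg _)]
  exact MDP.loss_average_le h.standing.stationary.nonneg T fun t => θ t ω

omit [IsProbabilityMeasure ρ] in
lemma sum_range_integral_loss_le (h : IsEvaluation κ M γ b μb Adm φ C m η T ρ ℱ z π θ e)
    (hT : 1 ≤ T) : ∑ t ∈ Finset.range (T + 1), ∫ ω, M.loss γ φ μb (π ω) (θ t ω) ∂ρ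
      ≤ 2 * ∑ t ∈ Finset.Icc 1 T, ∫ ω, M.loss γ φ μb (π ω) (θ t ω) ∂ρ := by
  have hzero : ∫ ω, M.loss γ φ μb (π ω) (θ 0 ω) ∂ρ = ∫ ω, M.loss γ φ μb (π ω) (θ 1 ω) ∂ρ := by
    simp only [h.iterate_zero]
  have hfirst := Finset.single_le_sum (f := fun t => ∫ ω, M.loss γ φ μb (π ω) (θ t ω) ∂ρ)
    (fun t _ => integral_nonneg fun ω => MDP.loss_nonneg h.standing.stationary.nonneg _)
    (Finset.mem_Icc.2 ⟨le_rfl, hT⟩)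
  rw [Finset.range_eq_Ico, Finset.sum_eq_sum_Ico_succ_bot (by omega : 0 < T + 1), hzero, zero_add,
    Finset.Ico_add_one_right_eq_Icc]
  linarith

lemma integral_loss_output_le (h : IsEvaluation κ M γ b μb Adm φ C m η T ρ ℱ z π θ e)
    (hT : 1 ≤ T) {L : ℝ} (hL : ∑ t ∈ Finset.Icc 1 T, ∫ ω, M.loss γ φ μb (π ω) (θ t ω) ∂ρ ≤ L) :
    ∫ ω, M.loss γ φ μb (π ω) ((1 / ((T : ℝ) + 1)) • ∑ t ∈ Finset.range (T + 1), θ t ω) ∂ρ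
      ≤ 2 * L / T := by
  have : (0 : ℝ) < T := by exact_mod_cast hT
  have hL0 : 0 ≤ L := (Finset.sum_nonneg fun t _ =>
    integral_nonneg fun ω => MDP.loss_nonneg h.standing.stationary.nonneg _).trans hL
  have hint : ∀ t ∈ Finset.range (T + 1),
      Integrable (fun ω => M.loss γ φ μb (π ω) (θ t ω)) ρ := fun t ht =>
    h.integrable_loss_iterate (Finset.mem_range_succ_iff.1 ht)
  calc _ ≤ ∫ ω, 1 / ((T : ℝ) + 1)
          * ∑ t ∈ Finset.range (T + 1), M.loss γ φ μb (π ω) (θ t ω) ∂ρ :=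
        integral_mono h.integrable_loss_output ((integrable_finsetSum _ hint).const_mul _)
          fun ω => MDP.loss_average_le h.standing.stationary.nonneg T fun t => θ t ω
    _ = 1 / ((T : ℝ) + 1)
          * ∑ t ∈ Finset.range (T + 1), ∫ ω, M.loss γ φ μb (π ω) (θ t ω) ∂ρ := by
        rw [integral_const_mul, integral_finsetSum _ hint]
    _ ≤ 1 / ((T : ℝ) + 1) * (2 * L) := by
        gcongr
        exact (h.sum_range_integral_loss_le hT).trans (by linarith)
    _ ≤ 1 / T * (2 * L) := by
        gcongr
        linarith
    _ = 2 * L / T := by ring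

lemma ae_four_mul_loss_le (h : IsEvaluation κ M γ b μb Adm φ C m η T ρ ℱ z π θ e) (hm : m.IsSGD)
    (h1 : 1 ≤ t) (hT : t ≤ T) {w : ℝ} (hw : w * η t = 1) : ∀ᵐ ω ∂ρ, ∀ θs ∈ C,
      M.SolvesBellman γ φ (π ω) θs → 4 * M.loss γ φ μb (π ω) (θ t ω)
        ≤ w * (‖θ t ω - θs‖ ^ 2 - ‖θ (t + 1) ω - θs‖ ^ 2)
          + (-2 * M.noise m γ φ b μb (π ω) (M.value γ (π ω)) (θ t ω) (z t ω)
            + 4 * κ.radius * κ.dirErr * e t ω + 2 * η t * κ.dirErr ^ 2 * e t ω ^ 2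
            + 2 * η t * κ.dirBound ^ 2) := by
  have hη0 : 0 < η t := lt_of_le_of_ne (h.step_nonneg t h1) fun h0 => by simp [← h0] at hw
  have hw0 : 0 ≤ w := (pos_of_mul_pos_left (hw ▸ one_pos) hη0.le).le
  filter_upwards [h.ae_dist_sq_succ_le h1 hT, h.policy_mem, h.ae_error_nonneg h1 hT]
    with ω hstep hπ he θs hs hB
  have hmean := h.standing.stateMean_pairing_eq hπ hm hB (θ t ω)
  rw [← hB.value_eq_linValue h.discount_nonneg h.discount_lt (h.standing.admissible _ hπ)] at hmean
  have hdist := mul_le_mul_of_nonneg_right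
    (h.standing.norm_sub_le_two_mul (h.iterate_mem t ω) hs) (mul_nonneg h.dirErr_pos.le he)
  have hstep := mul_le_mul_of_nonneg_left (hstep θs hs hB) hw0
  rw [hmean] at hstep
  have hexpand : ∀ D F p E₁ E₂ : ℝ, w * (D - 2 * η t * (2 * p + F) + 2 * η t * E₁ + η t ^ 2 * E₂)
      = w * D - 4 * p - 2 * F + 2 * E₁ + η t * E₂ := fun D F p E₁ E₂ => by
    linear_combination (-(2 * (2 * p + F)) + 2 * E₁ + η t * E₂) * hw
  rw [hexpand] at hstep
  linarith

lemma ae_sum_loss_le (h : IsEvaluation κ M γ b μb Adm φ C m η T ρ ℱ z π θ e) (hm : m.IsSGD)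
    {w : ℕ → ℝ} (hmono : Monotone w) (hw0 : 0 ≤ w 0) (hw : ∀ t, 1 ≤ t → w t * η t = 1) :
    ∀ᵐ ω ∂ρ, ∑ t ∈ Finset.Icc 1 T, 4 * M.loss γ φ μb (π ω) (θ t ω)
      ≤ w T * (4 * κ.radius ^ 2) + ∑ t ∈ Finset.Icc 1 T,
        (-2 * M.noise m γ φ b μb (π ω) (M.value γ (π ω)) (θ t ω) (z t ω)
          + 4 * κ.radius * κ.dirErr * e t ω + 2 * η t * κ.dirErr ^ 2 * e t ω ^ 2
          + 2 * η t * κ.dirBound ^ 2) := by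
  have hall := (Finset.eventually_all (Finset.Icc 1 T)).2 fun t ht =>
    h.ae_four_mul_loss_le hm (Finset.mem_Icc.1 ht).1 (Finset.mem_Icc.1 ht).2
      (hw t (Finset.mem_Icc.1 ht).1)
  filter_upwards [hall, h.ae_exists_solution] with ω hloss ⟨_, θs, hs, hB, _⟩
  have hdist : ∀ t, ‖θ t ω - θs‖ ^ 2 ≤ 4 * κ.radius ^ 2 := fun t => by
    have := pow_le_pow_left₀ (norm_nonneg _)
      (h.standing.norm_sub_le_two_mul (h.iterate_mem t ω) hs) 2
    linarith
  refine (Finset.sum_le_sum fun t ht => hloss t ht θs hs hB).trans ?_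
  rw [Finset.sum_add_distrib]
  gcongr
  exact sum_mul_sub_succ_le_of_monotone hmono hw0 (fun t => sq_nonneg _) hdist T

lemma four_mul_sum_integral_loss_le (h : IsEvaluation κ M γ b μb Adm φ C m η T ρ ℱ z π θ e)
    (hm : m.IsSGD) {w : ℕ → ℝ} (hmono : Monotone w) (hw0 : 0 ≤ w 0)
    (hw : ∀ t, 1 ≤ t → w t * η t = 1) :
    4 * ∑ t ∈ Finset.Icc 1 T, ∫ ω, M.loss γ φ μb (π ω) (θ t ω) ∂ρ
      ≤ w T * (4 * κ.radius ^ 2) + ∑ t ∈ Finset.Icc 1 T, ∫ ω,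
        (-2 * M.noise m γ φ b μb (π ω) (M.value γ (π ω)) (θ t ω) (z t ω)
          + 4 * κ.radius * κ.dirErr * e t ω + 2 * η t * κ.dirErr ^ 2 * e t ω ^ 2
          + 2 * η t * κ.dirBound ^ 2) ∂ρ := by
  have hloss : ∀ t ∈ Finset.Icc 1 T,
      Integrable (fun ω => 4 * M.loss γ φ μb (π ω) (θ t ω)) ρ := fun t ht =>
    (h.integrable_loss_iterate (Finset.mem_Icc.1 ht).2).const_mul _
  have herr := fun t (ht : t ∈ Finset.Icc 1 T) => integrable_linear_combination
    (h.integrable_noise (Finset.mem_Icc.1 ht).2 (Finset.mem_Icc.1 ht).2)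
    (h.integrable_error (Finset.mem_Icc.1 ht).1 (Finset.mem_Icc.1 ht).2)
    (h.integrable_error_sq (Finset.mem_Icc.1 ht).1 (Finset.mem_Icc.1 ht).2)
    (-2) (4 * κ.radius * κ.dirErr) (2 * η t * κ.dirErr ^ 2) (2 * η t * κ.dirBound ^ 2)
  have hmean := integral_mono_ae (integrable_finsetSum _ hloss)
    ((integrable_const _).add (integrable_finsetSum _ herr)) (h.ae_sum_loss_le hm hmono hw0 hw)
  rw [integral_finsetSum _ hloss, integral_add' (integrable_const _)
    (integrable_finsetSum _ herr), integral_finsetSum _ herr] at hmean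
  simpa only [integral_const_mul, integral_const, probReal_univ, one_smul, ← Finset.mul_sum]
    using hmean

lemma abs_integral_noise_le_sqrt (hη₀ : 0 < η₀)
    (h : IsEvaluation κ M γ b μb Adm φ C m (fun t => η₀ / Real.sqrt t) T ρ ℱ z π θ e)
    (h1 : 1 ≤ t) (hT : t ≤ T) :
    |∫ ω, M.noise m γ φ b μb (π ω) (M.value γ (π ω)) (θ t ω) (z t ω) ∂ρ|
      ≤ κ.noiseConst (2 * η₀) * κ.lag T * (1 / Real.sqrt t) := by
  refine h.abs_integral_noise_le (β := fun t => 1 / Real.sqrt t) (by positivity)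
    (fun t ht => ?_) (fun l t hl hlt htl => ?_) h1 hT
  · have ht' : (1 : ℝ) ≤ t := by exact_mod_cast ht
    exact one_div_le_one_div_of_le (Real.sqrt_pos.2 (by linarith))
      ((Real.sqrt_le_left (by linarith)).2 (by nlinarith))
  · have hl0 : (0 : ℝ) < l := by exact_mod_cast hl
    have ht0 : (0 : ℝ) < t := by exact_mod_cast hl.trans hlt
    have hsqrt : Real.sqrt t ≤ 2 * Real.sqrt l := by
      have htl' : (t : ℝ) ≤ 2 * l := by exact_mod_cast htl
      rw [Real.sqrt_le_left (by positivity), mul_pow, Real.sq_sqrt hl0.le]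
      linarith
    rw [mul_one_div, div_le_div_iff₀ (Real.sqrt_pos.2 hl0) (Real.sqrt_pos.2 ht0)]
    linarith [mul_le_mul_of_nonneg_left hsqrt hη₀.le]

lemma integral_error_terms_le_sqrt (hη₀ : 0 < η₀)
    (h : IsEvaluation κ M γ b μb Adm φ C m (fun t => η₀ / Real.sqrt t) T ρ ℱ z π θ e)
    (h1 : 1 ≤ t) (hT : t ≤ T) :
    ∫ ω, (-2 * M.noise m γ φ b μb (π ω) (M.value γ (π ω)) (θ t ω) (z t ω)
        + 4 * κ.radius * κ.dirErr * e t ω + 2 * (η₀ / Real.sqrt t) * κ.dirErr ^ 2 * e t ω ^ 2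
        + 2 * (η₀ / Real.sqrt t) * κ.dirBound ^ 2) ∂ρ
      ≤ (κ.sqrtRate η₀ - 2 * κ.radius ^ 2 / η₀) * κ.lag T * (1 / Real.sqrt t) := by
  have ht : (1 : ℝ) ≤ t := by exact_mod_cast h1
  have hE := h.dirErr_pos
  have hr := κ.radius_pos
  have hB := κ.estError_pos
  set q := Real.sqrt t
  have : 0 < q := Real.sqrt_pos.2 (by linarith)
  have hnoise := (abs_le.1 (h.abs_integral_noise_le_sqrt hη₀ h1 hT)).1
  have hsq : ∫ ω, e t ω ^ 2 ∂ρ ≤ κ.estError := (h.error_sq t h1 hT).trans (div_le_self hB.le ht)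
  rw [integral_linear_combination (h.integrable_noise hT hT) (h.integrable_error h1 hT)
    (h.integrable_error_sq h1 hT)]
  calc _ ≤ 2 * (κ.noiseConst (2 * η₀) * κ.lag T * (1 / q))
        + 4 * κ.radius * κ.dirErr * ((1 + κ.estError) / 2 / q)
        + 2 * (η₀ / q) * κ.dirErr ^ 2 * κ.estError + 2 * (η₀ / q) * κ.dirBound ^ 2 := by
        refine add_le_add (add_le_add (add_le_add (by linarith) ?_) ?_) le_rfl
        · exact mul_le_mul_of_nonneg_left (h.integral_error_le h1 hT) (by positivity)
        · exact mul_le_mul_of_nonneg_left hsq (by positivity)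
    _ = 2 * κ.noiseConst (2 * η₀) * κ.lag T * (1 / q)
        + (2 * κ.radius * κ.dirErr * (1 + κ.estError)
          + 2 * η₀ * (κ.dirBound ^ 2 + κ.dirErr ^ 2 * κ.estError)) * (1 / q) := by ring
    _ ≤ 2 * κ.noiseConst (2 * η₀) * κ.lag T * (1 / q)
        + (2 * κ.radius * κ.dirErr * (1 + κ.estError)
          + 2 * η₀ * (κ.dirBound ^ 2 + κ.dirErr ^ 2 * κ.estError)) * (1 / q) * κ.lag T := by
        exact add_le_add_right (le_mul_of_one_le_right (by positivity) (κ.one_le_lag T)) _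
    _ = _ := by rw [Constants.sqrtRate]; ring

lemma two_mul_radius_sq_div_le_sqrtRate (h : IsEvaluation κ M γ b μb Adm φ C m η T ρ ℱ z π θ e)
    (hη₀ : 0 < η₀) : 2 * κ.radius ^ 2 / η₀ ≤ κ.sqrtRate η₀ := by
  have hN : 0 ≤ κ.noiseConst (2 * η₀) := h.noiseConst_nonneg (by positivity)
  have := h.dirErr_pos
  have := κ.radius_pos
  have := κ.estError_pos
  rw [Constants.sqrtRate, add_assoc, add_assoc]
  exact le_add_of_nonneg_right (by positivity)

lemma sum_integral_loss_le_sqrt (hη₀ : 0 < η₀)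
    (h : IsEvaluation κ M γ b μb Adm φ C m (fun t => η₀ / Real.sqrt t) T ρ ℱ z π θ e)
    (hm : m.IsSGD) : ∑ t ∈ Finset.Icc 1 T, ∫ ω, M.loss γ φ μb (π ω) (θ t ω) ∂ρ
      ≤ κ.sqrtRate η₀ * κ.lag T * Real.sqrt T := by
  have hmean := h.four_mul_sum_integral_loss_le hm (w := fun t => Real.sqrt t / η₀)
    (fun a b hab => by dsimp only; gcongr) (by simp) fun t ht => by
      have : (0 : ℝ) < Real.sqrt t := Real.sqrt_pos.2 (by exact_mod_cast ht)
      field_simp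
  have hterms := Finset.sum_le_sum fun t (ht : t ∈ Finset.Icc 1 T) =>
    h.integral_error_terms_le_sqrt hη₀ (Finset.mem_Icc.1 ht).1 (Finset.mem_Icc.1 ht).2
  rw [← Finset.mul_sum] at hterms
  have hrate := sub_nonneg.2 (h.two_mul_radius_sq_div_le_sqrtRate hη₀)
  have hinit : κ.radius ^ 2 / η₀ * Real.sqrt T
      ≤ κ.radius ^ 2 / η₀ * Real.sqrt T * κ.lag T :=
    le_mul_of_one_le_right (by positivity) (κ.one_le_lag T)
  refine le_of_mul_le_mul_left (hmean.trans ?_) (zero_lt_four' ℝ)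
  calc _ ≤ Real.sqrt T / η₀ * (4 * κ.radius ^ 2)
        + (κ.sqrtRate η₀ - 2 * κ.radius ^ 2 / η₀) * κ.lag T * (2 * Real.sqrt T) := by
        gcongr
        exact hterms.trans (mul_le_mul_of_nonneg_left (sum_one_div_sqrt_le T) (by positivity))
    _ = 4 * (κ.radius ^ 2 / η₀ * Real.sqrt T)
        + 2 * (κ.sqrtRate η₀ * κ.lag T * Real.sqrt T)
        - 4 * (κ.radius ^ 2 / η₀ * Real.sqrt T * κ.lag T) := by ring
    _ ≤ 4 * (κ.sqrtRate η₀ * κ.lag T * Real.sqrt T) := by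
        have hnonneg : 0 ≤ κ.sqrtRate η₀ * κ.lag T * Real.sqrt T :=
          mul_nonneg (mul_nonneg ((by positivity : 0 ≤ 2 * κ.radius ^ 2 / η₀).trans
            (sub_nonneg.1 hrate)) (by positivity)) (Real.sqrt_nonneg _)
        linarith

lemma integral_loss_le_sqrt (hη₀ : 0 < η₀)
    (h : IsEvaluation κ M γ b μb Adm φ C m (fun t => η₀ / Real.sqrt t) T ρ ℱ z π θ e)
    (hm : m.IsSGD) (hT : 1 ≤ T) :
    ∫ ω, M.loss γ φ μb (π ω) ((1 / ((T : ℝ) + 1)) • ∑ t ∈ Finset.range (T + 1), θ t ω) ∂ρ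
      ≤ 2 * κ.sqrtRate η₀ * κ.lag T / Real.sqrt T := by
  have hT0 : (0 : ℝ) < T := by exact_mod_cast hT
  refine (h.integral_loss_output_le hT (h.sum_integral_loss_le_sqrt hη₀ hm)).trans_eq ?_
  rw [div_eq_div_iff hT0.ne' (Real.sqrt_pos.2 hT0).ne', ← mul_assoc, mul_assoc _ (Real.sqrt T),
    Real.mul_self_sqrt hT0.le, ← mul_assoc]

end IsEvaluation

end Accuracy

/-! ### Accuracy under a contraction -/

section Contraction

lemma IsContractionStep.mem_Icc {c : ℝ} {η : ℕ → ℝ} (h : IsContractionStep c η) (hc : 0 < c)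
    {t : ℕ} (ht : 1 ≤ t) : η t ∈ Set.Icc (1 / (c * t)) (2 / (c * t)) := by
  have ht0 : (0 : ℝ) < t := by exact_mod_cast ht
  obtain ⟨hlower, hupper⟩ := h.mul_div_two_mem_Icc hc ht
  rw [div_le_div_iff₀ (by positivity) two_pos] at hlower
  rw [div_le_div_iff₀ two_pos ht0] at hupper
  constructor
  · rw [div_le_iff₀ (by positivity)]
    linarith
  · rw [le_div_iff₀ (by positivity)]
    linarith

lemma le_sq_mul_of_le_sq_div_mul_add {D Y x : ℕ → ℝ} (hx : ∀ t, 1 ≤ t → 0 < x t) {T : ℕ}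
    (hD : ∀ t, 1 ≤ t → t < T → D (t + 1) ≤ (x (t + 1) / x t) ^ 2 * D t + Y t) (hT : 1 ≤ T) :
    D T ≤ x T ^ 2 * (D 1 / x 1 ^ 2 + ∑ t ∈ Finset.Ico 1 T, Y t / x (t + 1) ^ 2) := by
  induction T, hT using Nat.le_induction with
  | base => simp [mul_div_cancel₀, (hx 1 le_rfl).ne']
  | succ T hT ih =>
    have hx0 := hx T hT
    have hx1 := hx (T + 1) (by omega)
    have hprev := ih fun t ht htT => hD t ht (by omega)
    rw [Finset.sum_Ico_succ_top hT]
    calc _ ≤ (x (T + 1) / x T) ^ 2 * D T + Y T := hD T hT (by omega)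
      _ ≤ (x (T + 1) / x T) ^ 2
          * (x T ^ 2 * (D 1 / x 1 ^ 2 + ∑ t ∈ Finset.Ico 1 T, Y t / x (t + 1) ^ 2)) + Y T := by
          gcongr
      _ = _ := by
          field_simp
          ring

/-- Constant in the mean square growth of the distance to the solution in one step of the
evaluation under a contraction. -/
def Constants.contractionDrift (κ : Constants) (c : ℝ) : ℝ :=
  4 * κ.noiseConst (4 / c) / c + 10 * κ.dirErr ^ 2 * κ.estError / c ^ 2
    + 8 * κ.dirBound ^ 2 / c ^ 2

/-- Constant in the mean square accuracy of the iterates under a contraction. -/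
def Constants.contractionRate (κ : Constants) (c : ℝ) : ℝ :=
  16 * (κ.radius ^ 2 + κ.contractionDrift c)

/-- The error in one step of size `η` of the evaluation under a `c`-contraction, when the samples
contribute the noise `ν` and the estimators the error `e`. -/
def Constants.contractionError (κ : Constants) (c η ν e : ℝ) : ℝ :=
  -2 * η * ν + (η * κ.dirErr ^ 2 / c + 2 * η ^ 2 * κ.dirErr ^ 2) * e ^ 2
    + 2 * η ^ 2 * κ.dirBound ^ 2

variable {S A : Type*} [Fintype S] [DecidableEq S] [Fintype A] [DecidableEq A] {R : Finset ℝ}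
  {d : ℕ} {Ω : Type*} {mΩ : MeasurableSpace Ω}
  {κ : Constants} {M : MDP S A R} {γ : ℝ} {b : S → A → ℝ} {μb : S → ℝ}
  {Adm : Set (S → A → ℝ)} {φ : S → EuclideanSpace ℝ (Fin d)}
  {C : Set (EuclideanSpace ℝ (Fin d))} {m : Method} {η : ℕ → ℝ} {T : ℕ} {ρ : Measure Ω}
  [IsProbabilityMeasure ρ] {ℱ : Filtration ℕ mΩ} {z : ℕ → Ω → Sample S A R} {π : Ω → S → A → ℝ}
  {θ : ℕ → Ω → EuclideanSpace ℝ (Fin d)} {e : ℕ → Ω → ℝ} {t : ℕ} {c : ℝ}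

namespace IsEvaluation

lemma contractionDrift_nonneg (h : IsEvaluation κ M γ b μb Adm φ C m η T ρ ℱ z π θ e)
    (hc : 0 < c) : 0 ≤ κ.contractionDrift c := by
  have hN : 0 ≤ κ.noiseConst (4 / c) := h.noiseConst_nonneg (by positivity)
  have := κ.estError_pos
  rw [Constants.contractionDrift]
  positivity

lemma contractionRate_nonneg (h : IsEvaluation κ M γ b μb Adm φ C m η T ρ ℱ z π θ e)
    (hc : 0 < c) : 0 ≤ κ.contractionRate c := by
  have := h.contractionDrift_nonneg hc
  rw [Constants.contractionRate]
  positivity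

lemma ae_dist_sq_succ_le_of_contraction
    (h : IsEvaluation κ M γ b μb Adm φ C m η T ρ ℱ z π θ e) (hc : 0 < c)
    (hη : IsContractionStep c η) (h1 : 1 ≤ t) (hT : t ≤ T) : ∀ᵐ ω ∂ρ, ∀ θs ∈ C,
      M.SolvesBellman γ φ (π ω) θs →
      (∀ x, c * ‖x - θs‖ ^ 2
        ≤ M.stateMean b μb (M.pairing m γ φ b μb (π ω) (M.value γ (π ω)) x)) →
      ‖θ (t + 1) ω - θs‖ ^ 2 ≤ (η (t + 1) / η t) ^ 2 * ‖θ t ω - θs‖ ^ 2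
        + κ.contractionError c (η t)
          (M.noise m γ φ b μb (π ω) (M.value γ (π ω)) (θ t ω) (z t ω)) (e t ω) := by
  have : (0 : ℝ) < t := by exact_mod_cast h1
  have hη0 : 0 < η t := lt_of_lt_of_le (by positivity) (hη.mem_Icc hc h1).1
  have hratio : 1 - c * η t ≤ (η (t + 1) / η t) ^ 2 := by
    rw [hη.2.2 t h1, mul_div_cancel_right₀ _ hη0.ne', ← Real.exp_nat_mul]
    refine le_trans (by linarith) (Real.add_one_le_exp (-(c * η t)) |>.trans_eq ?_)
    congr 1
    push_cast
    ring
  filter_upwards [h.ae_dist_sq_succ_le h1 hT] with ω hstep θs hs hB hcontr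
  set D := ‖θ t ω - θs‖
  have hmean := mul_le_mul_of_nonneg_left (hcontr (θ t ω)) hη0.le
  -- AM-GM: `2 D E ≤ c D² + E² / c`
  have hcross : 2 * (D * (κ.dirErr * e t ω)) ≤ c * D ^ 2 + (κ.dirErr * e t ω) ^ 2 / c := by
    have hsq := div_nonneg (sq_nonneg (c * D - κ.dirErr * e t ω)) hc.le
    have hexpand : (c * D - κ.dirErr * e t ω) ^ 2 / c
        = c * D ^ 2 - 2 * (D * (κ.dirErr * e t ω)) + (κ.dirErr * e t ω) ^ 2 / c := by
      field_simp
      ring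
    linarith
  have hcross := mul_le_mul_of_nonneg_left hcross hη0.le
  refine (hstep θs hs hB).trans ?_
  rw [Constants.contractionError]
  refine le_trans ?_ (add_le_add_left (mul_le_mul_of_nonneg_right hratio (sq_nonneg D)) _)
  linarith [show η t * ((κ.dirErr * e t ω) ^ 2 / c) = η t * κ.dirErr ^ 2 / c * e t ω ^ 2 by ring]

lemma abs_integral_noise_le_of_contraction
    (h : IsEvaluation κ M γ b μb Adm φ C m η T ρ ℱ z π θ e) (hc : 0 < c)
    (hη : IsContractionStep c η) (h1 : 1 ≤ t) (hT : t ≤ T) :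
    |∫ ω, M.noise m γ φ b μb (π ω) (M.value γ (π ω)) (θ t ω) (z t ω) ∂ρ|
      ≤ κ.noiseConst (4 / c) * κ.lag T * (1 / t) := by
  refine h.abs_integral_noise_le (β := fun t => 1 / (t : ℝ)) (by positivity)
    (fun _ _ => le_rfl) (fun l t hl hlt htl => (hη.mem_Icc hc hl).2.trans ?_) h1 hT
  have : (0 : ℝ) < l := by exact_mod_cast hl
  have : (0 : ℝ) < t := by exact_mod_cast hl.trans hlt
  have htl' : (t : ℝ) ≤ 2 * l := by exact_mod_cast htl
  rw [div_mul_div_comm, div_le_div_iff₀ (by positivity) (by positivity)]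
  linarith [mul_le_mul_of_nonneg_left htl' hc.le]

lemma integrable_contractionError (h : IsEvaluation κ M γ b μb Adm φ C m η T ρ ℱ z π θ e)
    (h1 : 1 ≤ t) (hT : t ≤ T) : Integrable (fun ω => κ.contractionError c (η t)
      (M.noise m γ φ b μb (π ω) (M.value γ (π ω)) (θ t ω) (z t ω)) (e t ω)) ρ := by
  have hnoise := h.integrable_noise hT hT
  have hsq := h.integrable_error_sq h1 hT
  simp only [Constants.contractionError]
  fun_prop

lemma integral_contractionError_le (h : IsEvaluation κ M γ b μb Adm φ C m η T ρ ℱ z π θ e)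
    (hc : 0 < c) (hη : IsContractionStep c η) (h1 : 1 ≤ t) (hT : t ≤ T) :
    ∫ ω, κ.contractionError c (η t)
        (M.noise m γ φ b μb (π ω) (M.value γ (π ω)) (θ t ω) (z t ω)) (e t ω) ∂ρ
      ≤ κ.contractionDrift c * κ.lag T / t ^ 2 := by
  have ht : (1 : ℝ) ≤ t := by exact_mod_cast h1
  obtain ⟨hlower, hupper⟩ := hη.mem_Icc hc h1
  have hη0 : 0 ≤ η t := le_trans (by positivity) hlower
  have hB := κ.estError_pos
  have hN : 0 ≤ κ.noiseConst (4 / c) := h.noiseConst_nonneg (by positivity)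
  have hlag := κ.one_le_lag T
  have hnoise := (abs_le.1 (h.abs_integral_noise_le_of_contraction hc hη h1 hT)).1
  have hnoise := mul_le_mul_of_nonneg_left hnoise hη0
  have hint := h.integrable_noise hT hT
  have hintsq := h.integrable_error_sq h1 hT
  simp only [Constants.contractionError]
  rw [integral_add (by fun_prop) (by fun_prop), integral_add (by fun_prop) (by fun_prop),
    integral_const_mul, integral_const_mul, integral_const, probReal_univ, one_smul]
  calc _ ≤ 2 * η t * (κ.noiseConst (4 / c) * κ.lag T * (1 / t))
        + (η t * κ.dirErr ^ 2 / c + 2 * η t ^ 2 * κ.dirErr ^ 2) * (κ.estError / t)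
        + 2 * η t ^ 2 * κ.dirBound ^ 2 := by
        refine add_le_add (add_le_add (by linarith) ?_) le_rfl
        exact mul_le_mul_of_nonneg_left (h.error_sq t h1 hT) (by positivity)
    _ ≤ 2 * (2 / (c * t)) * (κ.noiseConst (4 / c) * κ.lag T * (1 / t))
        + (2 / (c * t) * κ.dirErr ^ 2 / c + 2 * (2 / (c * t)) ^ 2 * κ.dirErr ^ 2)
          * (κ.estError / t) + 2 * (2 / (c * t)) ^ 2 * κ.dirBound ^ 2 := by
        gcongr
    _ = 4 * κ.noiseConst (4 / c) / c / t ^ 2 * κ.lag T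
        + (κ.dirErr ^ 2 * κ.estError / c ^ 2 * (2 + 8 / t) + 8 * κ.dirBound ^ 2 / c ^ 2)
          / t ^ 2 := by
        field_simp
        ring
    _ ≤ 4 * κ.noiseConst (4 / c) / c / t ^ 2 * κ.lag T
        + (κ.dirErr ^ 2 * κ.estError / c ^ 2 * (2 + 8) + 8 * κ.dirBound ^ 2 / c ^ 2)
          / t ^ 2 * κ.lag T := by
        refine add_le_add le_rfl (le_trans ?_ (le_mul_of_one_le_right (by positivity) hlag))
        gcongr
        exact div_le_self (by norm_num) ht
    _ = κ.contractionDrift c * κ.lag T / t ^ 2 := by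
        rw [Constants.contractionDrift]
        ring

lemma integral_contractionError_div_le (h : IsEvaluation κ M γ b μb Adm φ C m η T ρ ℱ z π θ e)
    (hc : 0 < c) (hη : IsContractionStep c η) (h1 : 1 ≤ t) (hT : t ≤ T) :
    ∫ ω, κ.contractionError c (η t) (M.noise m γ φ b μb (π ω) (M.value γ (π ω)) (θ t ω) (z t ω))
        (e t ω) / η (t + 1) ^ 2 ∂ρ ≤ 4 * c ^ 2 * (κ.contractionDrift c * κ.lag T) := by
  have ht : (1 : ℝ) ≤ t := by exact_mod_cast h1
  have hdrift := h.contractionDrift_nonneg hc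
  have hstep : 1 / (2 * c * t) ≤ η (t + 1) := by
    refine le_trans ?_ (hη.mem_Icc hc (by omega : 1 ≤ t + 1)).1
    push_cast
    gcongr 1 / ?_
    nlinarith
  have : 0 < η (t + 1) := lt_of_lt_of_le (by positivity) hstep
  rw [integral_div]
  calc _ ≤ κ.contractionDrift c * κ.lag T / t ^ 2 / (1 / (2 * c * t)) ^ 2 := by
        refine div_le_div₀ (by positivity) (h.integral_contractionError_le hc hη h1 hT)
          (by positivity) (by gcongr)
    _ = 4 * c ^ 2 * (κ.contractionDrift c * κ.lag T) := by
        field_simp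
        ring

lemma ae_loss_le_of_contraction (h : IsEvaluation κ M γ b μb Adm φ C m η T ρ ℱ z π θ e)
    (hc : 0 < c) (hη : IsContractionStep c η)
    (hcontr : ∀ σ ∈ Adm, ∃ θs ∈ C, M.SolvesBellman γ φ σ θs ∧ ∀ x, c * ‖x - θs‖ ^ 2
      ≤ M.stateMean b μb (M.pairing m γ φ b μb σ (M.value γ σ) x)) (h1 : 1 ≤ t) (hT : t ≤ T) :
    ∀ᵐ ω ∂ρ, M.loss γ φ μb (π ω) (θ t ω) ≤ 2 * κ.featureBound ^ 2 * (η t ^ 2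
      * (4 * κ.radius ^ 2 / η 1 ^ 2 + ∑ l ∈ Finset.Ico 1 t, κ.contractionError c (η l)
        (M.noise m γ φ b μb (π ω) (M.value γ (π ω)) (θ l ω) (z l ω)) (e l ω)
          / η (l + 1) ^ 2)) := by
  have hpos : ∀ l, 1 ≤ l → 0 < η l := fun l hl => by
    have : (0 : ℝ) < l := by exact_mod_cast hl
    exact lt_of_lt_of_le (by positivity) (hη.mem_Icc hc hl).1
  have hall := (Finset.eventually_all (Finset.Ico 1 t)).2 fun l hl =>
    h.ae_dist_sq_succ_le_of_contraction hc hη (Finset.mem_Ico.1 hl).1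
      ((Finset.mem_Ico.1 hl).2.le.trans hT)
  filter_upwards [hall, h.policy_mem] with ω hstep hπ
  obtain ⟨θs, hs, hB, hθs⟩ := hcontr _ hπ
  have hdist := le_sq_mul_of_le_sq_div_mul_add (D := fun t => ‖θ t ω - θs‖ ^ 2) hpos
    (fun l hl hlt => hstep l (Finset.mem_Ico.2 ⟨hl, hlt⟩) θs hs hB hθs) h1
  have hfirst : ‖θ 1 ω - θs‖ ^ 2 ≤ 4 * κ.radius ^ 2 := by
    have := pow_le_pow_left₀ (norm_nonneg _)
      (h.standing.norm_sub_le_two_mul (h.iterate_mem 1 ω) hs) 2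
    linarith
  refine (h.standing.loss_le_dist_sq h.discount_nonneg h.discount_lt.le hπ hB _).trans ?_
  gcongr
  refine hdist.trans ?_
  gcongr

lemma radius_div_add_sum_integral_contractionError_le
    (h : IsEvaluation κ M γ b μb Adm φ C m η T ρ ℱ z π θ e) (hc : 0 < c)
    (hη : IsContractionStep c η) (h1 : 1 ≤ t) (hT : t ≤ T) :
    4 * κ.radius ^ 2 / η 1 ^ 2 + ∑ l ∈ Finset.Ico 1 t, ∫ ω, κ.contractionError c (η l)
        (M.noise m γ φ b μb (π ω) (M.value γ (π ω)) (θ l ω) (z l ω)) (e l ω) / η (l + 1) ^ 2 ∂ρ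
      ≤ c ^ 2 * κ.contractionRate c * κ.lag T * t / 4 := by
  have ht : (1 : ℝ) ≤ t := by exact_mod_cast h1
  have hlag := κ.one_le_lag T
  have hdrift := h.contractionDrift_nonneg hc
  have hη1 : 1 / c ≤ η 1 := hη.1
  have herror := Finset.sum_le_card_nsmul _ _ _ fun l (hl : l ∈ Finset.Ico 1 t) =>
    h.integral_contractionError_div_le hc hη (Finset.mem_Ico.1 hl).1
      ((Finset.mem_Ico.1 hl).2.le.trans hT)
  rw [nsmul_eq_mul, Nat.card_Ico, Nat.cast_sub h1, Nat.cast_one] at herror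
  have hradius : κ.radius ^ 2 ≤ κ.radius ^ 2 * (κ.lag T * t) :=
    le_mul_of_one_le_right (by positivity) (one_le_mul_of_one_le_of_one_le hlag ht)
  calc _ ≤ 4 * κ.radius ^ 2 / (1 / c) ^ 2
        + (t - 1) * (4 * c ^ 2 * (κ.contractionDrift c * κ.lag T)) := by gcongr
    _ = 4 * c ^ 2 * (κ.radius ^ 2 + (t - 1) * (κ.contractionDrift c * κ.lag T)) := by
        field_simp
    _ ≤ 4 * c ^ 2 * (κ.radius ^ 2 * (κ.lag T * t) + t * (κ.contractionDrift c * κ.lag T)) := by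
        gcongr
        linarith
    _ = _ := by
        rw [Constants.contractionRate]
        ring

lemma integral_loss_iterate_le_of_contraction
    (h : IsEvaluation κ M γ b μb Adm φ C m η T ρ ℱ z π θ e) (hc : 0 < c)
    (hη : IsContractionStep c η)
    (hcontr : ∀ σ ∈ Adm, ∃ θs ∈ C, M.SolvesBellman γ φ σ θs ∧ ∀ x, c * ‖x - θs‖ ^ 2
      ≤ M.stateMean b μb (M.pairing m γ φ b μb σ (M.value γ σ) x)) (h1 : 1 ≤ t) (hT : t ≤ T) :
    ∫ ω, M.loss γ φ μb (π ω) (θ t ω) ∂ρ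
      ≤ 2 * κ.featureBound ^ 2 * κ.contractionRate c * κ.lag T * (1 / t) := by
  have : (0 : ℝ) < t := by exact_mod_cast h1
  have hlag := κ.one_le_lag T
  obtain ⟨hlower, hupper⟩ := hη.mem_Icc hc h1
  have hη0 : 0 ≤ η t := le_trans (by positivity) hlower
  have hrate := h.contractionRate_nonneg hc
  have hint := fun l (hl : l ∈ Finset.Ico 1 t) => (h.integrable_contractionError (c := c)
    (Finset.mem_Ico.1 hl).1 ((Finset.mem_Ico.1 hl).2.le.trans hT)).div_const (η (l + 1) ^ 2)
  have hsum := integrable_finsetSum _ hint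
  have hmean := integral_mono_ae (h.integrable_loss_iterate hT) (by fun_prop)
    (h.ae_loss_le_of_contraction hc hη hcontr h1 hT)
  rw [integral_const_mul, integral_const_mul, integral_add (integrable_const _) hsum,
    integral_const, probReal_univ, one_smul, integral_finsetSum _ hint] at hmean
  calc _ ≤ 2 * κ.featureBound ^ 2
        * (η t ^ 2 * (c ^ 2 * κ.contractionRate c * κ.lag T * t / 4)) := by
        refine hmean.trans ?_
        gcongr
        exact h.radius_div_add_sum_integral_contractionError_le hc hη h1 hT
    _ ≤ 2 * κ.featureBound ^ 2
        * ((2 / (c * t)) ^ 2 * (c ^ 2 * κ.contractionRate c * κ.lag T * t / 4)) := by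
        gcongr
    _ = _ := by
        field_simp
        ring

lemma integral_loss_le_contraction (h : IsEvaluation κ M γ b μb Adm φ C m η T ρ ℱ z π θ e)
    (hc : 0 < c) (hη : IsContractionStep c η)
    (hcontr : ∀ σ ∈ Adm, ∃ θs ∈ C, M.SolvesBellman γ φ σ θs ∧ ∀ x, c * ‖x - θs‖ ^ 2
      ≤ M.stateMean b μb (M.pairing m γ φ b μb σ (M.value γ σ) x)) (hT : 1 ≤ T) :
    ∫ ω, M.loss γ φ μb (π ω) ((1 / ((T : ℝ) + 1)) • ∑ t ∈ Finset.range (T + 1), θ t ω) ∂ρ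
      ≤ 4 * κ.featureBound ^ 2 * κ.contractionRate c * κ.lag T * (1 + Real.log T) / T := by
  have := h.contractionRate_nonneg hc
  have := zero_le_one.trans (κ.one_le_lag T)
  refine (h.integral_loss_output_le hT (L := 2 * κ.featureBound ^ 2 * κ.contractionRate c
    * κ.lag T * (1 + Real.log T)) ?_).trans_eq (by ring)
  refine (Finset.sum_le_sum fun t ht => h.integral_loss_iterate_le_of_contraction hc hη hcontr
    (Finset.mem_Icc.1 ht).1 (Finset.mem_Icc.1 ht).2).trans ?_
  rw [← Finset.mul_sum]
  gcongr
  exact sum_one_div_le_one_add_log T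

end IsEvaluation

end Contraction

/-! ### Policy iteration -/

section PolicyIteration

lemma le_pow_mul_add_div_of_le_mul_add {a : ℕ → ℝ} {γ β : ℝ} (h0 : 0 ≤ γ) (h1 : γ < 1)
    (hβ : 0 ≤ β) {K : ℕ} (ha : ∀ k < K, a (k + 1) ≤ γ * a k + β) :
    a K ≤ γ ^ K * a 0 + β / (1 - γ) := by
  have hγ : 0 < 1 - γ := sub_pos.2 h1
  induction K with
  | zero => simpa using div_nonneg hβ hγ.le
  | succ K ih =>
    calc a (K + 1) ≤ γ * a K + β := ha K K.lt_succ_self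
      _ ≤ γ * (γ ^ K * a 0 + β / (1 - γ)) + β := by
          gcongr
          exact ih fun k hk => ha k (hk.trans K.lt_succ_self)
      _ = γ ^ (K + 1) * a 0 + β / (1 - γ) := by
          field_simp
          ring

variable {S A : Type*} [Fintype S] [DecidableEq S] [Fintype A] {R : Finset ℝ} {d : ℕ}
  {κ : Constants} {M : MDP S A R} {γ : ℝ} {b : S → A → ℝ} {μb : S → ℝ}
  {Adm : Set (S → A → ℝ)} {φ : S → EuclideanSpace ℝ (Fin d)}
  {C : Set (EuclideanSpace ℝ (Fin d))} {πs : S → A → ℝ} {μs : S → ℝ}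

namespace Standing

lemma value_eq_bellman (h : Standing κ M γ b μb Adm φ C) (h0 : 0 ≤ γ) (h1 : γ < 1)
    {σ : S → A → ℝ} (hσ : σ ∈ Adm) (s : S) :
    M.value γ σ s = M.bellman γ σ (M.value γ σ) s := by
  obtain ⟨θ, _, hB⟩ := h.realizable σ hσ
  rw [hB.value_eq_linValue h0 h1 (h.admissible σ hσ)]
  exact hB s

lemma abs_value_le (h : Standing κ M γ b μb Adm φ C) (h0 : 0 ≤ γ) (h1 : γ < 1)
    {σ : S → A → ℝ} (hσ : σ ∈ Adm) (s : S) :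
    |M.value γ σ s| ≤ κ.featureBound * κ.radius := by
  obtain ⟨θ, hθ, hB⟩ := h.realizable σ hσ
  rw [hB.value_eq_linValue h0 h1 (h.admissible σ hσ)]
  exact abs_inner_le_mul (h.feature_bound s) (h.bounded θ hθ)

lemma abs_sum_value_gap_le (h : Standing κ M γ b μb Adm φ C) (h0 : 0 ≤ γ) (h1 : γ < 1)
    {σ : S → A → ℝ} (hπs : πs ∈ Adm) (hσ : σ ∈ Adm) (hμ : IsStationary (M.trans πs) μs) :
    |∑ s, μs s * (M.value γ πs s - M.value γ σ s)| ≤ 2 * κ.featureBound * κ.radius :=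
  calc _ ≤ ∑ s, |μs s * (M.value γ πs s - M.value γ σ s)| := Finset.abs_sum_le_sum_abs _ _
    _ ≤ ∑ s, μs s * (2 * κ.featureBound * κ.radius) := Finset.sum_le_sum fun s _ => by
        rw [abs_mul, abs_of_nonneg (hμ.nonneg s)]
        refine mul_le_mul_of_nonneg_left ?_ (hμ.nonneg s)
        linarith [abs_sub (M.value γ πs s) (M.value γ σ s), h.abs_value_le h0 h1 hπs s,
          h.abs_value_le h0 h1 hσ s]
    _ = _ := by rw [← Finset.sum_mul, hμ.sum_one, one_mul]

lemma abs_bellman_linValue_sub_le (h : Standing κ M γ b μb Adm φ C) {σ : S → A → ℝ} (hσ : σ ∈ Adm)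
    (θ : EuclideanSpace ℝ (Fin d)) {q : ℝ} (hq : 0 < q) (s : S) :
    |M.bellman γ σ (linValue φ θ) s - linValue φ θ s|
      ≤ κ.shift / q * M.loss γ φ μb σ θ + q / 2 := by
  have hsq := h.sq_residual_le hσ θ s
  rw [MDP.residual_eq_bellman_sub, ← sq_abs] at hsq
  set y := |M.bellman γ σ (linValue φ θ) s - linValue φ θ s|
  have hamgm : y * (2 * q) ≤ 2 * κ.shift * M.loss γ φ μb σ θ + q * q := by
    linarith [sq_nonneg (y - q)]
  calc y ≤ (2 * κ.shift * M.loss γ φ μb σ θ + q * q) / (2 * q) :=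
        (le_div_iff₀ (by positivity)).2 hamgm
    _ = _ := by field_simp

end Standing

variable [DecidableEq A] {Ω : Type*} {mΩ : MeasurableSpace Ω} {m : Method} {η : ℕ → ℝ}
  {θ₀ : ℕ → EuclideanSpace ℝ (Fin d)} {T K : ℕ} {ρ : Measure Ω} {ℱ : Filtration ℕ mΩ}
  {z : ℕ → Ω → Sample S A R} {π : ℕ → Ω → S → A → ℝ} {k : ℕ}

namespace IsPolicyIteration

lemma ae_mem (h : IsPolicyIteration M γ b Adm φ C m η θ₀ T K ρ ℱ z π) (hk : k ≤ K) :
    ∀ᵐ ω ∂ρ, π k ω ∈ Adm := by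
  cases k with
  | zero => exact h.initial
  | succ k => exact (h.improve k (by omega)).mono fun ω hω => hω.1

lemma exists_isEvaluation (h : IsPolicyIteration M γ b Adm φ C m η θ₀ T K ρ ℱ z π)
    (hst : Standing κ M γ b μb Adm φ C) (h0 : 0 ≤ γ) (h1 : γ < 1)
    (hdata : IsOfflineData M b T K ρ ℱ z) (hest : AccurateEstimates M μb T K ρ z π κ.estError)
    (hη : ∀ t, 1 ≤ t → 0 ≤ η t) (hk : k < K) :
    ∃ e : ℕ → Ω → ℝ, IsEvaluation κ M γ b μb Adm φ C m η T ρ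
      (shiftFiltration ℱ (k * (T + 1))) (fun t ω => batch z T k ω t) (π k)
      (fun t ω => evalIterate m γ φ b (π k ω) C η (θ₀ k) (batch z T k ω) t) e := by
  choose! e hmem hsq hbound using hest k hk
  exact ⟨e, hst, h0, h1, hdata.batch hk, h.adapted k hk.le, h.ae_mem hk.le, hη,
    ⟨θ₀ k, h.initial_param k, fun _ _ => rfl⟩, hmem, hsq, hbound⟩

lemma ae_value_gap_succ_le (h : IsPolicyIteration M γ b Adm φ C m η θ₀ T K ρ ℱ z π)
    (hst : Standing κ M γ b μb Adm φ C) (h0 : 0 ≤ γ) (h1 : γ < 1) (hπs : πs ∈ Adm)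
    (hμ : IsStationary (M.trans πs) μs) {q : ℝ} (hq : 0 < q) (hk : k < K) : ∀ᵐ ω ∂ρ,
      ∑ s, μs s * (M.value γ πs s - M.value γ (π (k + 1) ω) s)
        ≤ γ * ∑ s, μs s * (M.value γ πs s - M.value γ (π k ω) s)
          + 2 * ((κ.shift / q * M.loss γ φ μb (π k ω)
            (evalOutput m γ φ b (π k ω) C η (θ₀ k) (batch z T k ω) T) + q / 2) / (1 - γ)) := by
  filter_upwards [h.ae_mem hk.le, h.ae_mem hk, h.improve k hk] with ω hπ hπ' hgreedy
  exact hgreedy.sum_stationary_value_gap_le h0 h1 hst.admissible hπ hπs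
    (hst.value_eq_bellman h0 h1 hπ) (hst.value_eq_bellman h0 h1 hπs)
    (hst.value_eq_bellman h0 h1 hπ') (hst.abs_bellman_linValue_sub_le hπ _ hq) hμ

variable [IsProbabilityMeasure ρ]

lemma integrable_value_gap (h : IsPolicyIteration M γ b Adm φ C m η θ₀ T K ρ ℱ z π)
    (hst : Standing κ M γ b μb Adm φ C) (h0 : 0 ≤ γ) (h1 : γ < 1) (hπs : πs ∈ Adm)
    (hμ : IsStationary (M.trans πs) μs) (hk : k ≤ K) :
    Integrable (fun ω => ∑ s, μs s * (M.value γ πs s - M.value γ (π k ω) s)) ρ := by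
  have hmeas : Measurable fun ω => ∑ s, μs s * (M.value γ πs s - M.value γ (π k ω) s) :=
    Finset.measurable_sum _ fun s _ => ((MDP.measurable_value
      (fun s a => (h.adapted k hk s a).mono (ℱ.le _) le_rfl) γ M s).const_sub _).const_mul _
  refine Integrable.of_bound hmeas.aestronglyMeasurable (2 * κ.featureBound * κ.radius) ?_
  filter_upwards [h.ae_mem hk] with ω hω
  exact hst.abs_sum_value_gap_le h0 h1 hπs hω hμ

lemma integral_value_gap_le (h : IsPolicyIteration M γ b Adm φ C m η θ₀ T K ρ ℱ z π)
    (hst : Standing κ M γ b μb Adm φ C) (h0 : 0 ≤ γ) (h1 : γ < 1) (hπs : πs ∈ Adm)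
    (hμ : IsStationary (M.trans πs) μs) (hk : k ≤ K) :
    ∫ ω, ∑ s, μs s * (M.value γ πs s - M.value γ (π k ω) s) ∂ρ
      ≤ 2 * κ.featureBound * κ.radius := by
  have hmean := integral_mono_ae (h.integrable_value_gap hst h0 h1 hπs hμ hk)
    (integrable_const (2 * κ.featureBound * κ.radius)) (by
      filter_upwards [h.ae_mem hk] with ω hω
      exact (le_abs_self _).trans (hst.abs_sum_value_gap_le h0 h1 hπs hω hμ))
  simpa using hmean

lemma integral_value_gap_succ_le (h : IsPolicyIteration M γ b Adm φ C m η θ₀ T K ρ ℱ z π)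
    (hst : Standing κ M γ b μb Adm φ C) (h0 : 0 ≤ γ) (h1 : γ < 1) (hπs : πs ∈ Adm)
    (hμ : IsStationary (M.trans πs) μs) {q : ℝ} (hq : 0 < q) (hk : k < K)
    (hint : Integrable (fun ω => M.loss γ φ μb (π k ω)
      (evalOutput m γ φ b (π k ω) C η (θ₀ k) (batch z T k ω) T)) ρ)
    (hloss : 2 * κ.shift * ∫ ω, M.loss γ φ μb (π k ω)
      (evalOutput m γ φ b (π k ω) C η (θ₀ k) (batch z T k ω) T) ∂ρ ≤ q ^ 2) :
    ∫ ω, ∑ s, μs s * (M.value γ πs s - M.value γ (π (k + 1) ω) s) ∂ρ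
      ≤ γ * ∫ ω, ∑ s, μs s * (M.value γ πs s - M.value γ (π k ω) s) ∂ρ + 2 * q / (1 - γ) := by
  have : 0 < 1 - γ := sub_pos.2 h1
  have hgap := (h.integrable_value_gap hst h0 h1 hπs hμ hk.le).const_mul γ
  have herr := ((((hint.const_mul (κ.shift / q)).add (integrable_const (q / 2))).div_const
    (1 - γ)).const_mul 2)
  refine (integral_mono_ae (h.integrable_value_gap hst h0 h1 hπs hμ hk) (hgap.add herr)
    (h.ae_value_gap_succ_le hst h0 h1 hπs hμ hq hk)).trans ?_
  rw [integral_add' hgap herr, integral_const_mul, integral_const_mul, integral_div,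
    integral_add' (hint.const_mul _) (integrable_const _), integral_const_mul, integral_const,
    probReal_univ, one_smul]
  refine add_le_add le_rfl ?_
  rw [mul_div_assoc]
  gcongr
  have hscaled := div_le_div_of_nonneg_right hloss (by positivity : 0 ≤ 2 * q)
  set L := ∫ ω, M.loss γ φ μb (π k ω)
    (evalOutput m γ φ b (π k ω) C η (θ₀ k) (batch z T k ω) T) ∂ρ
  calc κ.shift / q * L + q / 2 = 2 * κ.shift * L / (2 * q) + q / 2 := by field_simp
    _ ≤ q ^ 2 / (2 * q) + q / 2 := by gcongr
    _ = q := by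
        field_simp
        ring

lemma isAccurate_of_integral_loss_le
    (h : IsPolicyIteration M γ b Adm φ C m η θ₀ T K ρ ℱ z π)
    (hst : Standing κ M γ b μb Adm φ C) (h0 : 0 ≤ γ) (h1 : γ < 1) (hπs : πs ∈ Adm)
    (hμ : IsStationary (M.trans πs) μs) {q ε : ℝ} (hq : 0 < q)
    (hint : ∀ k < K, Integrable (fun ω => M.loss γ φ μb (π k ω)
      (evalOutput m γ φ b (π k ω) C η (θ₀ k) (batch z T k ω) T)) ρ)
    (hloss : ∀ k < K, 2 * κ.shift * ∫ ω, M.loss γ φ μb (π k ω)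
      (evalOutput m γ φ b (π k ω) C η (θ₀ k) (batch z T k ω) T) ∂ρ ≤ q ^ 2)
    (hε : γ ^ K * (2 * κ.featureBound * κ.radius) + 2 * q / (1 - γ) ^ 2 ≤ ε) :
    M.IsAccurate γ πs μs ρ (π K) ε := by
  have : 0 < 1 - γ := sub_pos.2 h1
  refine ⟨h.integrable_value_gap hst h0 h1 hπs hμ le_rfl, le_trans ?_ hε⟩
  refine (le_pow_mul_add_div_of_le_mul_add (a := fun k => ∫ ω, ∑ s, μs s
    * (M.value γ πs s - M.value γ (π k ω) s) ∂ρ) h0 h1 (by positivity) fun k hk =>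
    h.integral_value_gap_succ_le hst h0 h1 hπs hμ hq hk (hint k hk) (hloss k hk)).trans ?_
  rw [div_div, ← sq]
  gcongr
  exact h.integral_value_gap_le hst h0 h1 hπs hμ K.zero_le

lemma isAccurate_zero (h : IsPolicyIteration M γ b Adm φ C m η θ₀ T 0 ρ ℱ z π)
    (hst : Standing κ M γ b μb Adm φ C) (h0 : 0 ≤ γ) (h1 : γ < 1) (hπs : πs ∈ Adm)
    (hμ : IsStationary (M.trans πs) μs) {ε : ℝ} (hε : 2 * κ.featureBound * κ.radius ≤ ε) :
    M.IsAccurate γ πs μs ρ (π 0) ε :=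
  ⟨h.integrable_value_gap hst h0 h1 hπs hμ le_rfl,
    (h.integral_value_gap_le hst h0 h1 hπs hμ le_rfl).trans hε⟩

end IsPolicyIteration

end PolicyIteration

/-! ### Batch size and number of batches -/

section Sizes

lemma Constants.lag_le (κ : Constants) {T : ℕ} (hT : 1 ≤ T) :
    (κ.lag T : ℝ) ≤ 2 * (κ.mixingTime + 1) * (1 + Real.log T) := by
  have hpow : ((2 : ℝ) ^ Nat.log 2 T) ≤ T := by
    exact_mod_cast Nat.pow_log_le_self 2 (by omega)
  have hlog : Nat.log 2 T * Real.log 2 ≤ Real.log T := by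
    rw [← Real.log_pow]
    exact Real.log_le_log (by positivity) hpow
  have hfactor : (Nat.log 2 T : ℝ) + 1 ≤ 2 * (1 + Real.log T) := by
    nlinarith [Real.log_two_gt_d9, (Nat.log 2 T).cast_nonneg (α := ℝ)]
  calc (κ.lag T : ℝ) = (κ.mixingTime + 1) * (Nat.log 2 T + 1) := by
        rw [Constants.lag]
        push_cast
        rfl
    _ ≤ (κ.mixingTime + 1) * (2 * (1 + Real.log T)) := by gcongr
    _ = 2 * (κ.mixingTime + 1) * (1 + Real.log T) := by ring

variable {γ ε : ℝ}

lemma log_one_div_one_sub_nonneg (h0 : 0 ≤ γ) (h1 : γ < 1) : 0 ≤ Real.log (1 / (1 - γ)) :=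
  Real.log_nonneg (by rw [le_div_iff₀ (sub_pos.2 h1)]; linarith)

lemma log_one_add_one_div_nonneg (hε : 0 < ε) : 0 ≤ Real.log (1 + 1 / ε) :=
  Real.log_nonneg (le_add_of_nonneg_right (by positivity))

lemma one_le_logFactor (h0 : 0 ≤ γ) (h1 : γ < 1) (hε : 0 < ε) : 1 ≤ logFactor γ ε :=
  one_le_mul_of_one_le_of_one_le (le_add_of_nonneg_right (log_one_add_one_div_nonneg hε))
    (le_add_of_nonneg_right (log_one_div_one_sub_nonneg h0 h1))

lemma log_one_div_one_sub_le_logFactor (h0 : 0 ≤ γ) (h1 : γ < 1) (hε : 0 < ε) :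
    Real.log (1 / (1 - γ)) ≤ logFactor γ ε := by
  have hγ := log_one_div_one_sub_nonneg h0 h1
  rw [logFactor]
  nlinarith [mul_nonneg (log_one_add_one_div_nonneg hε) hγ, log_one_add_one_div_nonneg hε]

lemma log_one_div_le_logFactor (h0 : 0 ≤ γ) (h1 : γ < 1) (hε : 0 < ε) :
    Real.log (1 / ε) ≤ logFactor γ ε := by
  have hmono : Real.log (1 / ε) ≤ Real.log (1 + 1 / ε) :=
    Real.log_le_log (by positivity) (by linarith)
  have hγ := log_one_div_one_sub_nonneg h0 h1
  rw [logFactor]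
  nlinarith [mul_nonneg (log_one_add_one_div_nonneg hε) hγ]

lemma pow_le_exp_neg {x : ℝ} {K : ℕ} (h0 : 0 ≤ γ) (hK : x ≤ K * (1 - γ)) :
    γ ^ K ≤ Real.exp (-x) := by
  calc γ ^ K ≤ Real.exp (-(1 - γ)) ^ K :=
        pow_le_pow_left₀ h0 (by linarith [Real.one_sub_le_exp_neg (1 - γ)]) K
    _ = Real.exp (K * -(1 - γ)) := (Real.exp_nat_mul _ _).symm
    _ ≤ Real.exp (-x) := Real.exp_le_exp.2 (by linarith)

lemma exists_pow_mul_le_half {V : ℝ} (hV : 0 < V) (h0 : 0 ≤ γ) (h1 : γ < 1) (hε : 0 < ε)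
    (hεV : ε ≤ V) : ∃ K : ℕ, (K : ℝ) ≤ (|Real.log (2 * V)| + 2) * logFactor γ ε / (1 - γ) ∧
      γ ^ K * V ≤ ε / 2 := by
  have hγ : 0 < 1 - γ := sub_pos.2 h1
  set x := Real.log (2 * V / ε) with hx
  have hx0 : 0 ≤ x := Real.log_nonneg (by rw [le_div_iff₀ hε]; linarith)
  have hxΛ : x ≤ |Real.log (2 * V)| + logFactor γ ε := by
    rw [hx, ← mul_one_div, Real.log_mul (by positivity) (by positivity)]
    exact add_le_add (le_abs_self _) (log_one_div_le_logFactor h0 h1 hε)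
  refine ⟨⌈x / (1 - γ)⌉₊, (Nat.ceil_lt_add_one (by positivity)).le.trans ?_, ?_⟩
  · have hΛ := one_le_logFactor h0 h1 hε
    rw [div_add_one hγ.ne']
    gcongr
    nlinarith [le_mul_of_one_le_right (abs_nonneg (Real.log (2 * V))) hΛ]
  · calc γ ^ ⌈x / (1 - γ)⌉₊ * V ≤ Real.exp (-x) * V := by
          gcongr
          exact pow_le_exp_neg h0 ((div_le_iff₀ hγ).1 (Nat.le_ceil _))
      _ = ε / 2 := by
          rw [Real.exp_neg, hx, Real.exp_log (by positivity)]
          field_simp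

lemma exists_log_sq_le (q a : ℝ) : ∃ x : ℝ, 1 ≤ x ∧ a ≤ x ∧ q * (18 + 2 * Real.log x) ^ 2 ≤ x := by
  set u := max 1 (max a (676 * |q|))
  have hu : 1 ≤ u := le_max_left _ _
  have hau : a ≤ u := (le_max_left _ _).trans (le_max_right _ _)
  have hqu : 676 * |q| ≤ u := (le_max_right _ _).trans (le_max_right _ _)
  have hpow : u ≤ u ^ 4 := le_self_pow₀ hu (by norm_num)
  refine ⟨u ^ 4, hu.trans hpow, hau.trans hpow, ?_⟩
  have hlog : Real.log u ≤ u := Real.log_le_self (by linarith)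
  have : 0 ≤ Real.log u := Real.log_nonneg hu
  rw [Real.log_pow]
  push_cast
  calc q * (18 + 2 * (4 * Real.log u)) ^ 2 ≤ |q| * (18 + 2 * (4 * Real.log u)) ^ 2 := by
        gcongr
        exact le_abs_self q
    _ ≤ |q| * (26 * u) ^ 2 := by gcongr; linarith
    _ = 676 * |q| * u ^ 2 := by ring
    _ ≤ u * u ^ 2 := by gcongr
    _ = u ^ 3 := by ring
    _ ≤ u ^ 4 := pow_le_pow_right₀ hu (by norm_num)

/-- The base of the batch sizes: `T` is its square for the square root steps, where the mean loss
decays like `1 / √T`, and `T` is the base itself under a contraction, where it decays like `1 / T`.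
The exponents of `1 - γ` and `ε` make it proportional to the inverse square of the admissible
error of one policy evaluation. -/
def batchScale (a γ ε : ℝ) : ℝ := a * logFactor γ ε ^ 2 / ((1 - γ) ^ 4 * ε ^ 2)

lemma one_le_batchScale {a : ℝ} (h0 : 0 ≤ γ) (h1 : γ < 1) (hε : 0 < ε) (ha : ε ^ 2 ≤ a) :
    1 ≤ batchScale a γ ε := by
  have hγ : 0 < 1 - γ := sub_pos.2 h1
  rw [batchScale, one_le_div (by positivity)]
  calc (1 - γ) ^ 4 * ε ^ 2 ≤ 1 * a :=
        mul_le_mul (pow_le_one₀ hγ.le (by linarith)) ha (sq_nonneg ε) zero_le_one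
    _ = a * 1 := by ring
    _ ≤ a * logFactor γ ε ^ 2 :=
        mul_le_mul_of_nonneg_left (one_le_pow₀ (one_le_logFactor h0 h1 hε))
          ((sq_nonneg ε).trans ha)

lemma log_batchScale_le {a : ℝ} (h0 : 0 ≤ γ) (h1 : γ < 1) (hε : 0 < ε) (ha : 0 < a) :
    Real.log (batchScale a γ ε) ≤ Real.log a + 8 * logFactor γ ε := by
  have : 0 < 1 - γ := sub_pos.2 h1
  have hΛ : 0 < logFactor γ ε := zero_lt_one.trans_le (one_le_logFactor h0 h1 hε)
  have hexpand : Real.log (batchScale a γ ε) = Real.log a + 2 * Real.log (logFactor γ ε)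
      + 4 * Real.log (1 / (1 - γ)) + 2 * Real.log (1 / ε) := by
    rw [batchScale, Real.log_div (by positivity) (by positivity),
      Real.log_mul (by positivity) (by positivity), Real.log_mul (by positivity) (by positivity),
      one_div, one_div, Real.log_inv, Real.log_inv, Real.log_pow, Real.log_pow, Real.log_pow]
    push_cast
    ring
  linarith [Real.log_le_self hΛ.le, log_one_div_one_sub_le_logFactor h0 h1 hε,
    log_one_div_le_logFactor h0 h1 hε]

lemma log_natCeil_pow_le {x : ℝ} (hx : 1 ≤ x) {i : ℕ} (hi : i ≤ 2) :
    Real.log ⌈x ^ i⌉₊ ≤ 1 + 2 * Real.log x := by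
  have hx0 : 0 < x := by linarith
  have hceil : (⌈x ^ i⌉₊ : ℝ) ≤ 2 * x ^ 2 := by
    linarith [Nat.ceil_lt_add_one (pow_nonneg hx0.le i), one_le_pow₀ hx (n := 2),
      pow_le_pow_right₀ hx hi]
  calc Real.log ⌈x ^ i⌉₊ ≤ Real.log (2 * x ^ 2) :=
        Real.log_le_log (Nat.cast_pos.2 (Nat.ceil_pos.2 (by positivity))) hceil
    _ = Real.log 2 + 2 * Real.log x := by
        rw [Real.log_mul two_ne_zero (by positivity), Real.log_pow]
        norm_cast
    _ ≤ 1 + 2 * Real.log x := by linarith [Real.log_two_lt_d9]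

lemma mul_log_sq_div_batchScale_le {Q a : ℝ} {i : ℕ} (h0 : 0 ≤ γ) (h1 : γ < 1) (hε : 0 < ε)
    (ha : 1 ≤ a) (hεa : ε ^ 2 ≤ a) (hQ : 16 * |Q| * (18 + 2 * Real.log a) ^ 2 ≤ a) (hi : i ≤ 2) :
    Q * (1 + Real.log ⌈batchScale a γ ε ^ i⌉₊) ^ 2 / batchScale a γ ε
      ≤ ((1 - γ) ^ 2 * ε / 4) ^ 2 := by
  have hγ : 0 < 1 - γ := sub_pos.2 h1
  have hΛ := one_le_logFactor h0 h1 hε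
  have hX := one_le_batchScale h0 h1 hε hεa
  have : 0 ≤ Real.log ⌈batchScale a γ ε ^ i⌉₊ := Real.log_natCast_nonneg _
  have hlog : 1 + Real.log ⌈batchScale a γ ε ^ i⌉₊ ≤ (18 + 2 * Real.log a) * logFactor γ ε := by
    nlinarith [log_natCeil_pow_le hX hi, log_batchScale_le h0 h1 hε (by linarith : 0 < a),
      mul_le_mul_of_nonneg_left hΛ (Real.log_nonneg ha)]
  rw [div_le_iff₀ (by linarith)]
  calc Q * (1 + Real.log ⌈batchScale a γ ε ^ i⌉₊) ^ 2
      ≤ |Q| * ((18 + 2 * Real.log a) * logFactor γ ε) ^ 2 := by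
        gcongr
        exact le_abs_self Q
    _ = 16 * |Q| * (18 + 2 * Real.log a) ^ 2 / 16 * logFactor γ ε ^ 2 := by ring
    _ ≤ a / 16 * logFactor γ ε ^ 2 := by gcongr
    _ = ((1 - γ) ^ 2 * ε / 4) ^ 2 * batchScale a γ ε := by
        rw [batchScale]
        field_simp
        norm_num

lemma mul_natCeil_batchScale_pow_le {a B : ℝ} {i K : ℕ} (h0 : 0 ≤ γ) (h1 : γ < 1) (hε : 0 < ε)
    (ha : 1 ≤ a) (hεa : ε ^ 2 ≤ a) (hi : i ≤ 2) (hB : 0 ≤ B)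
    (hK : (K : ℝ) ≤ B * logFactor γ ε / (1 - γ)) :
    ((K * (⌈batchScale a γ ε ^ i⌉₊ + 1) : ℕ) : ℝ)
      ≤ 3 * B * a ^ 2 * logFactor γ ε ^ 5 / ((1 - γ) ^ (4 * i + 1) * ε ^ (2 * i)) := by
  have hγ : 0 < 1 - γ := sub_pos.2 h1
  have hΛ := one_le_logFactor h0 h1 hε
  have hX := one_le_pow₀ (one_le_batchScale h0 h1 hε hεa) (n := i)
  have hceil : (⌈batchScale a γ ε ^ i⌉₊ : ℝ) + 1 ≤ 3 * batchScale a γ ε ^ i := by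
    linarith [Nat.ceil_lt_add_one (zero_le_one.trans hX)]
  push_cast
  calc (K : ℝ) * (⌈batchScale a γ ε ^ i⌉₊ + 1)
      ≤ B * logFactor γ ε / (1 - γ) * (3 * batchScale a γ ε ^ i) := by gcongr
    _ = 3 * B * a ^ i * logFactor γ ε ^ (2 * i + 1) / ((1 - γ) ^ (4 * i + 1) * ε ^ (2 * i)) := by
        rw [batchScale, div_pow, mul_pow, mul_pow, ← pow_mul, ← pow_mul, ← pow_mul]
        field_simp
        ring
    _ ≤ _ := by
        gcongr
        omega

lemma exists_batchSize_batchCount (Q : ℝ) {V : ℝ} (hV : 0 < V) :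
    ∃ K₀ : ℝ, 0 ≤ K₀ ∧ ∀ γ ε : ℝ, 0 ≤ γ → γ < 1 → 0 < ε → ε ≤ V → ∀ i ≤ 2, ∃ T K : ℕ, 1 ≤ T ∧
      ((K * (T + 1) : ℕ) : ℝ) ≤ K₀ * logFactor γ ε ^ 5 / ((1 - γ) ^ (4 * i + 1) * ε ^ (2 * i)) ∧
      γ ^ K * V ≤ ε / 2 ∧
      ∃ r : ℝ, 0 < r ∧ r ^ i ≤ T ∧ Q * (1 + Real.log T) ^ 2 / r ≤ ((1 - γ) ^ 2 * ε / 4) ^ 2 := by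
  obtain ⟨a, ha, haV, haQ⟩ := exists_log_sq_le (16 * |Q|) (V ^ 2)
  refine ⟨3 * (|Real.log (2 * V)| + 2) * a ^ 2, by positivity, fun γ ε h0 h1 hε hεV i hi => ?_⟩
  have hεa : ε ^ 2 ≤ a := (pow_le_pow_left₀ hε.le hεV 2).trans haV
  have hX : 0 < batchScale a γ ε := zero_lt_one.trans_le (one_le_batchScale h0 h1 hε hεa)
  obtain ⟨K, hK, hKV⟩ := exists_pow_mul_le_half hV h0 h1 hε hεV
  exact ⟨⌈batchScale a γ ε ^ i⌉₊, K, Nat.ceil_pos.2 (pow_pos hX i),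
    mul_natCeil_batchScale_pow_le h0 h1 hε ha hεa hi (by positivity) hK, hKV,
    batchScale a γ ε, hX, Nat.le_ceil _, mul_log_sq_div_batchScale_le h0 h1 hε ha hεa haQ hi⟩

end Sizes

/-! ### Sample complexity -/

section Complexity

/-- Twice the density constant `κ.shift` times the mean loss of a policy evaluation is at most this
constant times `(1 + log T) ^ 2 / √T` for the square root steps with factor `η₀`, and at most this
constant times `(1 + log T) ^ 2 / T` under a `c`-contraction. The absolute values make it
nonnegative for every `η₀` and `c`. -/
def Constants.lossRate (κ : Constants) (η₀ c : ℝ) : ℝ :=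
  8 * κ.shift * (κ.mixingTime + 1) * |κ.sqrtRate η₀|
    + 16 * κ.shift * (κ.mixingTime + 1) * κ.featureBound ^ 2 * |κ.contractionRate c|

lemma Constants.mul_sqrt_loss_le (κ : Constants) (η₀ c : ℝ) {T : ℕ} (hT : 1 ≤ T) {r q : ℝ}
    (hr : 0 < r) (hrT : r ^ 2 ≤ T) (hq : κ.lossRate η₀ c * (1 + Real.log T) ^ 2 / r ≤ q) :
    2 * κ.shift * (2 * κ.sqrtRate η₀ * κ.lag T / √T) ≤ q := by
  have := κ.shift_pos
  have hlog : 0 ≤ Real.log T := Real.log_natCast_nonneg T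
  refine le_trans ?_ hq
  calc 2 * κ.shift * (2 * κ.sqrtRate η₀ * κ.lag T / √T)
      ≤ 2 * κ.shift * (2 * |κ.sqrtRate η₀| * (2 * (κ.mixingTime + 1) * (1 + Real.log T)) / r) := by
        gcongr
        · exact le_abs_self _
        · exact κ.lag_le hT
        · exact Real.le_sqrt_of_sq_le hrT
    _ = 8 * κ.shift * (κ.mixingTime + 1) * |κ.sqrtRate η₀| * (1 + Real.log T) / r := by ring
    _ ≤ κ.lossRate η₀ c * (1 + Real.log T) ^ 2 / r := by
        gcongr
        · rw [Constants.lossRate]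
          positivity
        · exact le_add_of_nonneg_right (by positivity)
        · exact le_self_pow₀ (by linarith) two_ne_zero

lemma Constants.mul_contraction_loss_le (κ : Constants) (η₀ c : ℝ) {T : ℕ} (hT : 1 ≤ T) {r q : ℝ}
    (hr : 0 < r) (hrT : r ≤ T) (hq : κ.lossRate η₀ c * (1 + Real.log T) ^ 2 / r ≤ q) :
    2 * κ.shift * (4 * κ.featureBound ^ 2 * κ.contractionRate c * κ.lag T
      * (1 + Real.log T) / T) ≤ q := by
  have := κ.shift_pos
  have : 0 ≤ Real.log T := Real.log_natCast_nonneg T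
  refine le_trans ?_ hq
  calc 2 * κ.shift * (4 * κ.featureBound ^ 2 * κ.contractionRate c * κ.lag T
        * (1 + Real.log T) / T)
      ≤ 2 * κ.shift * (4 * κ.featureBound ^ 2 * |κ.contractionRate c|
          * (2 * (κ.mixingTime + 1) * (1 + Real.log T)) * (1 + Real.log T) / r) := by
        gcongr
        · exact le_abs_self _
        · exact κ.lag_le hT
    _ = 16 * κ.shift * (κ.mixingTime + 1) * κ.featureBound ^ 2 * |κ.contractionRate c|
          * (1 + Real.log T) ^ 2 / r := by ring
    _ ≤ κ.lossRate η₀ c * (1 + Real.log T) ^ 2 / r := by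
        gcongr
        exact le_add_of_nonneg_left (by positivity)

variable {S A : Type*} [Fintype S] [DecidableEq S] [Fintype A] {R : Finset ℝ} {d : ℕ}
  {κ : Constants} {M : MDP S A R} {γ : ℝ} {b : S → A → ℝ} {μb : S → ℝ}
  {Adm : Set (S → A → ℝ)} {φ : S → EuclideanSpace ℝ (Fin d)}
  {C : Set (EuclideanSpace ℝ (Fin d))} {m : Method}

lemma Standing.exists_mul_dist_sq_le (h : Standing κ M γ b μb Adm φ C) (h0 : 0 ≤ γ) (h1 : γ < 1)
    {c : ℝ}
    (hm : (m.IsSGD ∧ ∀ σ ∈ Adm, StrongConvexOn Set.univ c (M.loss γ φ μb σ)) ∨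
      (m = Method.td0 ∧ ∀ σ ∈ Adm, ∃ θs ∈ C, M.SolvesBellman γ φ σ θs ∧
        IsContraction c (M.meanDirection m γ φ b μb σ) θs)) {σ : S → A → ℝ} (hσ : σ ∈ Adm) :
    ∃ θs ∈ C, M.SolvesBellman γ φ σ θs ∧ ∀ θ, c * ‖θ - θs‖ ^ 2
      ≤ M.stateMean b μb (M.pairing m γ φ b μb σ (M.value γ σ) θ) := by
  have hpolicy := h.admissible σ hσ
  rcases hm with ⟨hsgd, hconvex⟩ | ⟨-, hcontr⟩
  · obtain ⟨θs, hθs, hB⟩ := h.realizable σ hσ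
    refine ⟨θs, hθs, hB, fun θ => ?_⟩
    rw [hB.value_eq_linValue h0 h1 hpolicy, h.stateMean_pairing_eq hσ hsgd hB]
    exact hB.mul_dist_sq_le_loss h.stationary.nonneg (hconvex σ hσ) θ
  · obtain ⟨θs, hθs, hB, hdrift, -⟩ := hcontr σ hσ
    refine ⟨θs, hθs, hB, fun θ => ?_⟩
    rw [hB.value_eq_linValue h0 h1 hpolicy, ← M.inner_meanDirection_eq_stateMean m]
    exact hdrift θ

variable [DecidableEq A] {πs : S → A → ℝ} {μs : S → ℝ} {Ω : Type*} {mΩ : MeasurableSpace Ω}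
  {θ₀ : ℕ → EuclideanSpace ℝ (Fin d)} {T K : ℕ} {ρ : Measure Ω} [IsProbabilityMeasure ρ]
  {ℱ : Filtration ℕ mΩ} {z : ℕ → Ω → Sample S A R} {π : ℕ → Ω → S → A → ℝ} {η : ℕ → ℝ}

namespace IsPolicyIteration

lemma isAccurate_of_isEvaluation (h : IsPolicyIteration M γ b Adm φ C m η θ₀ T K ρ ℱ z π)
    (hst : Standing κ M γ b μb Adm φ C) (h0 : 0 ≤ γ) (h1 : γ < 1)
    (hdata : IsOfflineData M b T K ρ ℱ z) (hest : AccurateEstimates M μb T K ρ z π κ.estError)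
    (hη : ∀ t, 1 ≤ t → 0 ≤ η t) (hπs : πs ∈ Adm) (hμ : IsStationary (M.trans πs) μs) {ε L : ℝ}
    (hε : 0 < ε) (hK : γ ^ K * (2 * κ.featureBound * κ.radius) ≤ ε / 2)
    (hL : 2 * κ.shift * L ≤ ((1 - γ) ^ 2 * ε / 4) ^ 2)
    (hloss : ∀ (k : ℕ) (e : ℕ → Ω → ℝ), IsEvaluation κ M γ b μb Adm φ C m η T ρ
      (shiftFiltration ℱ (k * (T + 1))) (fun t ω => batch z T k ω t) (π k)
      (fun t ω => evalIterate m γ φ b (π k ω) C η (θ₀ k) (batch z T k ω) t) e →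
        ∫ ω, M.loss γ φ μb (π k ω)
          (evalOutput m γ φ b (π k ω) C η (θ₀ k) (batch z T k ω) T) ∂ρ ≤ L) :
    M.IsAccurate γ πs μs ρ (π K) ε := by
  have hγ : 0 < 1 - γ := sub_pos.2 h1
  have hshift := κ.shift_pos
  refine h.isAccurate_of_integral_loss_le hst h0 h1 hπs hμ (q := (1 - γ) ^ 2 * ε / 4)
    (by positivity) (fun k hk => ?_) (fun k hk => ?_) ?_
  · obtain ⟨e, he⟩ := h.exists_isEvaluation hst h0 h1 hdata hest hη hk
    exact he.integrable_loss_output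
  · obtain ⟨e, he⟩ := h.exists_isEvaluation hst h0 h1 hdata hest hη hk
    exact (mul_le_mul_of_nonneg_left (hloss k e he) (by positivity)).trans hL
  · have herror : 2 * ((1 - γ) ^ 2 * ε / 4) / (1 - γ) ^ 2 = ε / 2 := by
      field_simp
      norm_num
    linarith

lemma isAccurate_sqrt {η₀ c : ℝ}
    (h : IsPolicyIteration M γ b Adm φ C m (fun t => η₀ / √t) θ₀ T K ρ ℱ z π)
    (hst : Standing κ M γ b μb Adm φ C) (h0 : 0 ≤ γ) (h1 : γ < 1)
    (hdata : IsOfflineData M b T K ρ ℱ z) (hest : AccurateEstimates M μb T K ρ z π κ.estError)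
    (hπs : πs ∈ Adm) (hμ : IsStationary (M.trans πs) μs) (hη₀ : 0 < η₀) (hm : m.IsSGD)
    {ε r : ℝ} (hε : 0 < ε) (hK : γ ^ K * (2 * κ.featureBound * κ.radius) ≤ ε / 2) (hT : 1 ≤ T)
    (hr : 0 < r) (hrT : r ^ 2 ≤ T)
    (hrate : κ.lossRate η₀ c * (1 + Real.log T) ^ 2 / r ≤ ((1 - γ) ^ 2 * ε / 4) ^ 2) :
    M.IsAccurate γ πs μs ρ (π K) ε :=
  h.isAccurate_of_isEvaluation hst h0 h1 hdata hest (fun t _ => by positivity) hπs hμ hε hK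
    (κ.mul_sqrt_loss_le η₀ c hT hr hrT hrate)
    fun _ _ he => he.integral_loss_le_sqrt hη₀ hm hT

lemma isAccurate_contraction {η₀ c : ℝ}
    (h : IsPolicyIteration M γ b Adm φ C m η θ₀ T K ρ ℱ z π)
    (hst : Standing κ M γ b μb Adm φ C) (h0 : 0 ≤ γ) (h1 : γ < 1)
    (hdata : IsOfflineData M b T K ρ ℱ z) (hest : AccurateEstimates M μb T K ρ z π κ.estError)
    (hπs : πs ∈ Adm) (hμ : IsStationary (M.trans πs) μs) (hc : 0 < c)
    (hη : IsContractionStep c η)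
    (hm : (m.IsSGD ∧ ∀ σ ∈ Adm, StrongConvexOn Set.univ c (M.loss γ φ μb σ)) ∨
      (m = Method.td0 ∧ ∀ σ ∈ Adm, ∃ θs ∈ C, M.SolvesBellman γ φ σ θs ∧
        IsContraction c (M.meanDirection m γ φ b μb σ) θs))
    {ε r : ℝ} (hε : 0 < ε) (hK : γ ^ K * (2 * κ.featureBound * κ.radius) ≤ ε / 2) (hT : 1 ≤ T)
    (hr : 0 < r) (hrT : r ≤ T)
    (hrate : κ.lossRate η₀ c * (1 + Real.log T) ^ 2 / r ≤ ((1 - γ) ^ 2 * ε / 4) ^ 2) :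
    M.IsAccurate γ πs μs ρ (π K) ε :=
  h.isAccurate_of_isEvaluation hst h0 h1 hdata hest
    (fun t ht => (by positivity : 0 ≤ 1 / (c * t)).trans (hη.mem_Icc hc ht).1) hπs hμ hε hK
    (κ.mul_contraction_loss_le η₀ c hT hr hrT hrate)
    fun _ _ he => he.integral_loss_le_contraction hc hη
      (fun _ hσ => hst.exists_mul_dist_sq_le h0 h1 hm hσ) hT

end IsPolicyIteration

end Complexity

end OfflineRL

end

theorem mainTheorem5_general :
    ∃ p : ℕ, ∀ (κ : OfflineRL.Constants) (η₀ c : ℝ), 0 < η₀ → 0 < c →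
    ∃ K₀ : ℝ, ∀ γ ε : ℝ, 0 < γ → γ < 1 → 0 < ε →
      (∃ T K : ℕ,
        ((K * (T + 1) : ℕ) : ℝ) ≤ K₀ * OfflineRL.logFactor γ ε ^ p / ((1 - γ) ^ 9 * ε ^ 4) ∧
        ∀ (S : Type u) (A : Type v) [Fintype S] [DecidableEq S] [Fintype A] [DecidableEq A]
          (R : Finset ℝ) (d : ℕ) (M : OfflineRL.MDP S A R) (b : S → A → ℝ) (μb : S → ℝ)
          (Adm : Set (S → A → ℝ)) (φ : S → EuclideanSpace ℝ (Fin d))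
          (C : Set (EuclideanSpace ℝ (Fin d))) (πs : S → A → ℝ) (μs : S → ℝ)
          (m : OfflineRL.Method) (θ₀ : ℕ → EuclideanSpace ℝ (Fin d))
          (Ω : Type w) (mΩ : MeasurableSpace Ω) (ρ : MeasureTheory.Measure Ω)
          [MeasureTheory.IsProbabilityMeasure ρ] (ℱ : MeasureTheory.Filtration ℕ mΩ)
          (z : ℕ → Ω → OfflineRL.Sample S A R) (π : ℕ → Ω → S → A → ℝ),
          OfflineRL.Standing κ M γ b μb Adm φ C →
          πs ∈ Adm → OfflineRL.IsStationary (M.trans πs) μs →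
          m.IsSGD →
          OfflineRL.IsOfflineData M b T K ρ ℱ z →
          OfflineRL.IsPolicyIteration M γ b Adm φ C m (fun t => η₀ / Real.sqrt t) θ₀ T K ρ ℱ z π →
          OfflineRL.AccurateEstimates M μb T K ρ z π κ.estError →
          M.IsAccurate γ πs μs ρ (π K) ε) ∧
      (∃ T K : ℕ,
        ((K * (T + 1) : ℕ) : ℝ) ≤ K₀ * OfflineRL.logFactor γ ε ^ p / ((1 - γ) ^ 5 * ε ^ 2) ∧
        ∀ (S : Type u) (A : Type v) [Fintype S] [DecidableEq S] [Fintype A] [DecidableEq A]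
          (R : Finset ℝ) (d : ℕ) (M : OfflineRL.MDP S A R) (b : S → A → ℝ) (μb : S → ℝ)
          (Adm : Set (S → A → ℝ)) (φ : S → EuclideanSpace ℝ (Fin d))
          (C : Set (EuclideanSpace ℝ (Fin d))) (πs : S → A → ℝ) (μs : S → ℝ)
          (m : OfflineRL.Method) (η : ℕ → ℝ) (θ₀ : ℕ → EuclideanSpace ℝ (Fin d))
          (Ω : Type w) (mΩ : MeasurableSpace Ω) (ρ : MeasureTheory.Measure Ω)
          [MeasureTheory.IsProbabilityMeasure ρ] (ℱ : MeasureTheory.Filtration ℕ mΩ)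
          (z : ℕ → Ω → OfflineRL.Sample S A R) (π : ℕ → Ω → S → A → ℝ),
          OfflineRL.Standing κ M γ b μb Adm φ C →
          πs ∈ Adm → OfflineRL.IsStationary (M.trans πs) μs →
          ((m.IsSGD ∧ ∀ σ ∈ Adm, StrongConvexOn Set.univ c (M.loss γ φ μb σ)) ∨
            (m = OfflineRL.Method.td0 ∧ ∀ σ ∈ Adm, ∃ θs ∈ C, M.SolvesBellman γ φ σ θs ∧
              OfflineRL.IsContraction c (M.meanDirection m γ φ b μb σ) θs)) →
          OfflineRL.IsContractionStep c η →
          OfflineRL.IsOfflineData M b T K ρ ℱ z →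
          OfflineRL.IsPolicyIteration M γ b Adm φ C m η θ₀ T K ρ ℱ z π →
          OfflineRL.AccurateEstimates M μb T K ρ z π κ.estError →
          M.IsAccurate γ πs μs ρ (π K) ε) := by
  refine ⟨5, fun κ η₀ c hη₀ hc => ?_⟩
  obtain ⟨K₀, hK₀, hsizes⟩ := OfflineRL.exists_batchSize_batchCount (κ.lossRate η₀ c)
    (mul_pos (mul_pos two_pos κ.featureBound_pos) κ.radius_pos)
  refine ⟨K₀, fun γ ε h0 h1 hε => ?_⟩
  rcases le_total ε (2 * κ.featureBound * κ.radius) with hsmall | hlarge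
  · constructor
    · obtain ⟨T, K, hT, hN, hK, r, hr, hrT, hrate⟩ := hsizes γ ε h0.le h1 hε hsmall 2 le_rfl
      refine ⟨T, K, by simpa using hN, ?_⟩
      intro S A _ _ _ _ R d M b μb Adm φ C πs μs m θ₀ Ω mΩ ρ _ ℱ z π hst hπs hμ hm hdata hPI hest
      exact hPI.isAccurate_sqrt hst h0.le h1 hdata hest hπs hμ hη₀ hm hε hK hT hr hrT hrate
    · obtain ⟨T, K, hT, hN, hK, r, hr, hrT, hrate⟩ := hsizes γ ε h0.le h1 hε hsmall 1 one_le_two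
      refine ⟨T, K, by simpa using hN, ?_⟩
      intro S A _ _ _ _ R d M b μb Adm φ C πs μs m η θ₀ Ω mΩ ρ _ ℱ z π hst hπs hμ hm hη hdata hPI
        hest
      exact hPI.isAccurate_contraction hst h0.le h1 hdata hest hπs hμ hc hη hm hε hK hT hr
        (by simpa using hrT) hrate
  · have : 0 < 1 - γ := sub_pos.2 h1
    have : 1 ≤ OfflineRL.logFactor γ ε := OfflineRL.one_le_logFactor h0.le h1 hε
    refine ⟨⟨0, 0, by simpa using by positivity, ?_⟩, 0, 0, by simpa using by positivity, ?_⟩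
    · intro S A _ _ _ _ R d M b μb Adm φ C πs μs m θ₀ Ω mΩ ρ _ ℱ z π hst hπs hμ _ _ hPI _
      exact hPI.isAccurate_zero hst h0.le h1 hπs hμ hlarge
    · intro S A _ _ _ _ R d M b μb Adm φ C πs μs m η θ₀ Ω mΩ ρ _ ℱ z π hst hπs hμ _ _ _ hPI _
      exact hPI.isAccurate_zero hst h0.le h1 hπs hμ hlarge

theorem mainTheorem5 :
    ∃ p : ℕ, ∀ (κ : OfflineRL.Constants) (η₀ c : ℝ), 0 < η₀ → 0 < c →
    ∃ K₀ : ℝ, ∀ γ ε : ℝ, 0 < γ → γ < 1 → 0 < ε →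
      -- SGD-based updates in general
      (∃ T K : ℕ,
        ((K * (T + 1) : ℕ) : ℝ) ≤ K₀ * OfflineRL.logFactor γ ε ^ p / ((1 - γ) ^ 9 * ε ^ 4) ∧
        ∀ (S : Type u) (A : Type v) [Fintype S] [DecidableEq S] [Fintype A] [DecidableEq A]
          (R : Finset ℝ) (d : ℕ) (M : OfflineRL.MDP S A R) (b : S → A → ℝ) (μb : S → ℝ)
          (Adm : Set (S → A → ℝ)) (φ : S → EuclideanSpace ℝ (Fin d))
          (C : Set (EuclideanSpace ℝ (Fin d))) (πs : S → A → ℝ) (μs : S → ℝ)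
          (m : OfflineRL.Method) (θ₀ : ℕ → EuclideanSpace ℝ (Fin d))
          (Ω : Type w) (mΩ : MeasurableSpace Ω) (ρ : MeasureTheory.Measure Ω)
          [MeasureTheory.IsProbabilityMeasure ρ] (ℱ : MeasureTheory.Filtration ℕ mΩ)
          (z : ℕ → Ω → OfflineRL.Sample S A R) (π : ℕ → Ω → S → A → ℝ),
          OfflineRL.Standing κ M γ b μb Adm φ C →
          πs ∈ Adm → M.IsOptimal γ πs → OfflineRL.IsStationary (M.trans πs) μs →
          m.IsSGD →
          OfflineRL.IsOfflineData M b T K ρ ℱ z →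
          OfflineRL.IsPolicyIteration M γ b Adm φ C m (fun t => η₀ / Real.sqrt t) θ₀ T K ρ ℱ z π →
          OfflineRL.AccurateEstimates M μb T K ρ z π κ.estError →
          M.IsAccurate γ πs μs ρ (π K) ε) ∧
      -- SGD-based updates with a strongly convex loss, or TD(0) with a contraction
      (∃ T K : ℕ,
        ((K * (T + 1) : ℕ) : ℝ) ≤ K₀ * OfflineRL.logFactor γ ε ^ p / ((1 - γ) ^ 5 * ε ^ 2) ∧
        ∀ (S : Type u) (A : Type v) [Fintype S] [DecidableEq S] [Fintype A] [DecidableEq A]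
          (R : Finset ℝ) (d : ℕ) (M : OfflineRL.MDP S A R) (b : S → A → ℝ) (μb : S → ℝ)
          (Adm : Set (S → A → ℝ)) (φ : S → EuclideanSpace ℝ (Fin d))
          (C : Set (EuclideanSpace ℝ (Fin d))) (πs : S → A → ℝ) (μs : S → ℝ)
          (m : OfflineRL.Method) (η : ℕ → ℝ) (θ₀ : ℕ → EuclideanSpace ℝ (Fin d))
          (Ω : Type w) (mΩ : MeasurableSpace Ω) (ρ : MeasureTheory.Measure Ω)
          [MeasureTheory.IsProbabilityMeasure ρ] (ℱ : MeasureTheory.Filtration ℕ mΩ)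
          (z : ℕ → Ω → OfflineRL.Sample S A R) (π : ℕ → Ω → S → A → ℝ),
          OfflineRL.Standing κ M γ b μb Adm φ C →
          πs ∈ Adm → M.IsOptimal γ πs → OfflineRL.IsStationary (M.trans πs) μs →
          ((m.IsSGD ∧ ∀ σ ∈ Adm, StrongConvexOn Set.univ c (M.loss γ φ μb σ)) ∨
            (m = OfflineRL.Method.td0 ∧ ∀ σ ∈ Adm, ∃ θs ∈ C, M.SolvesBellman γ φ σ θs ∧
              OfflineRL.IsContraction c (M.meanDirection m γ φ b μb σ) θs)) →
          OfflineRL.IsContractionStep c η →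
          OfflineRL.IsOfflineData M b T K ρ ℱ z →
          OfflineRL.IsPolicyIteration M γ b Adm φ C m η θ₀ T K ρ ℱ z π →
          OfflineRL.AccurateEstimates M μb T K ρ z π κ.estError →
          M.IsAccurate γ πs μs ρ (π K) ε) := by
  obtain ⟨p, hp⟩ := mainTheorem5_general.{u, v, w}
  refine ⟨p, fun κ η₀ c hη₀ hc => ?_⟩
  obtain ⟨K₀, hK₀⟩ := hp κ η₀ c hη₀ hc
  refine ⟨K₀, fun γ ε h0 h1 hε => ?_⟩
  obtain ⟨⟨T, K, hN, hsqrt⟩, T', K', hN', hcontr⟩ := hK₀ γ ε h0 h1 hε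
  refine ⟨⟨T, K, hN, ?_⟩, T', K', hN', ?_⟩
  · intro S A _ _ _ _ R d M b μb Adm φ C πs μs m θ₀ Ω mΩ ρ _ ℱ z π hst hπs _
    exact hsqrt S A R d M b μb Adm φ C πs μs m θ₀ Ω mΩ ρ ℱ z π hst hπs
  · intro S A _ _ _ _ R d M b μb Adm φ C πs μs m η θ₀ Ω mΩ ρ _ ℱ z π hst hπs _
    exact hcontr S A R d M b μb Adm φ C πs μs m η θ₀ Ω mΩ ρ ℱ z π hst hπs
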